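/- Let $F$ be a CNF formula with $m$ clauses and $n$ variables; every clause is a finite set of literals. For a total order $<$ of the clauses and variables of $F$ together and an integer $k\ge 0$, call $<$ a \emph{$k$-interval ordering} of $F$ if for every clause $C$ there are at most $k$ variables $x$ not appearing in $C$ such that either (1) some variable $x'$ appearing in $C$ satisfies $x'<x<C$, or (2) $x$ appears in some clause $C'$ with $C'<C<x$. A \emph{merge} of a total order of the clauses and a total order of the variables is a total order of the clauses and variables together that induces the two given orders. Algorithms run on a unit-cost random access machine over the natural numbers, with addition, truncated subtraction and indirect addressing (no multiplication). \textbf{Corollary.} Given $F$, a total order of its clauses and a total order of its variables: (a) there is a least $k$ such that some merge of the two orders is a $k$-interval ordering of $F$, and one can compute this $k$ in time polynomial in the size of the input; (b) with this least $k$, and if $m\ge 1$, one can from the same input solve \#SAT (compute the number of assignments of the $n$ variables that satisfy $F$) and MaxSAT (compute the maximum number of clauses of $F$ satisfied by an assignment, together with an assignment attaining it), each in total time $\mathcal{O}(m^3\,4^k\,(m+n))$, where the constant is absolute. -/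

import Mathlib

namespace KInterval

/-! ### Random access machines

The machine has registers `reg 0, reg 1, …` and memory segments `mem 0, mem 1, …`, all holding natural
numbers.  A program is a fixed finite text, so it names only finitely many registers and segments; inside a
segment, cells are addressed indirectly, through the contents of a register.  The arithmetic operations are
addition and truncated subtraction (no multiplication, no bitwise operations); each costs one step.  This is
the unit-cost random access machine, with structured control flow in place of jumps. -/

/-- A configuration of the memory. -/
structure State where
  /-- contents of the registers -/
  reg : ℕ → ℕ
  /-- `mem a i` is the content of cell `i` of segment `a` -/
  mem : ℕ → ℕ → ℕ

/-- The elementary instructions. -/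
inductive Instr where
  /-- `reg r := c` -/
  | const (r c : ℕ)
  /-- `reg r := reg a + reg b` -/
  | add (r a b : ℕ)
  /-- `reg r := reg a - reg b`, and `0` if the difference is negative -/
  | sub (r a b : ℕ)
  /-- `reg r := mem a (reg i)` -/
  | load (r a i : ℕ)
  /-- `mem a (reg i) := reg r` -/
  | store (a i r : ℕ)

/-- The effect of an elementary instruction. -/
def Instr.apply : Instr → State → State
  | .const r c, s => { s with reg := Function.update s.reg r c }
  | .add r a b, s => { s with reg := Function.update s.reg r (s.reg a + s.reg b) }
  | .sub r a b, s => { s with reg := Function.update s.reg r (s.reg a - s.reg b) }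
  | .load r a i, s => { s with reg := Function.update s.reg r (s.mem a (s.reg i)) }
  | .store a i r, s =>
      { s with mem := Function.update s.mem a (Function.update (s.mem a) (s.reg i) (s.reg r)) }

/-- Programs. -/
inductive Prog where
  /-- the empty program -/
  | skip
  /-- a single instruction -/
  | instr (i : Instr)
  /-- first `p`, then `q` -/
  | seq (p q : Prog)
  /-- if `reg r ≠ 0` then `p`, else `q` -/
  | branch (r : ℕ) (p q : Prog)
  /-- while `reg r ≠ 0` do `p` -/
  | loop (r : ℕ) (p : Prog)

/-- `Exec p s t s'`: started in `s`, the program `p` halts in `s'` after exactly `t` steps.  Every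
elementary instruction and every evaluation of a test costs one step. -/
inductive Exec : Prog → State → ℕ → State → Prop where
  | skip (s : State) : Exec .skip s 0 s
  | instr (i : Instr) (s : State) : Exec (.instr i) s 1 (i.apply s)
  | seq {p q : Prog} {s s' s'' : State} {t t' : ℕ} :
      Exec p s t s' → Exec q s' t' s'' → Exec (.seq p q) s (t + t') s''
  | branch_true {r : ℕ} {p q : Prog} {s s' : State} {t : ℕ} :
      s.reg r ≠ 0 → Exec p s t s' → Exec (.branch r p q) s (t + 1) s'
  | branch_false {r : ℕ} {p q : Prog} {s s' : State} {t : ℕ} :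
      s.reg r = 0 → Exec q s t s' → Exec (.branch r p q) s (t + 1) s'
  | loop_done {r : ℕ} {p : Prog} {s : State} :
      s.reg r = 0 → Exec (.loop r p) s 1 s
  | loop_step {r : ℕ} {p : Prog} {s s' s'' : State} {t t' : ℕ} :
      s.reg r ≠ 0 → Exec p s t s' → Exec (.loop r p) s' t' s'' →
        Exec (.loop r p) s (t + t' + 1) s''

/-- The machine is deterministic: running time and final state are determined by the start. -/
theorem Exec.deterministic {p : Prog} {s s₁ : State} {t₁ : ℕ} (h : Exec p s t₁ s₁) :
    ∀ {t₂ : ℕ} {s₂ : State}, Exec p s t₂ s₂ → t₁ = t₂ ∧ s₁ = s₂ := by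
  induction h with
  | skip s => intro t₂ s₂ h₂; cases h₂; exact ⟨rfl, rfl⟩
  | instr i s => intro t₂ s₂ h₂; cases h₂; exact ⟨rfl, rfl⟩
  | seq _ _ ih ih' =>
    intro t₂ s₂ h₂
    cases h₂ with
    | seq a b =>
      obtain ⟨rfl, rfl⟩ := ih a
      obtain ⟨rfl, rfl⟩ := ih' b
      exact ⟨rfl, rfl⟩
  | branch_true hr _ ih =>
    intro t₂ s₂ h₂
    cases h₂ with
    | branch_true _ a => obtain ⟨rfl, rfl⟩ := ih a; exact ⟨rfl, rfl⟩
    | branch_false hr' _ => exact absurd hr' hr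
  | branch_false hr _ ih =>
    intro t₂ s₂ h₂
    cases h₂ with
    | branch_true hr' _ => exact absurd hr hr'
    | branch_false _ a => obtain ⟨rfl, rfl⟩ := ih a; exact ⟨rfl, rfl⟩
  | loop_done hr =>
    intro t₂ s₂ h₂
    cases h₂ with
    | loop_done _ => exact ⟨rfl, rfl⟩
    | loop_step hr' _ _ => exact absurd hr hr'
  | loop_step hr _ _ ih ih' =>
    intro t₂ s₂ h₂
    cases h₂ with
    | loop_done hr' => exact absurd hr' hr
    | loop_step _ a b =>
      obtain ⟨rfl, rfl⟩ := ih a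
      obtain ⟨rfl, rfl⟩ := ih' b
      exact ⟨rfl, rfl⟩

/-- Started in `s`, the program `p` halts after at most `T` steps, in a state satisfying `Q`. -/
def HaltsWithin (p : Prog) (s : State) (T : ℕ) (Q : State → Prop) : Prop :=
  ∃ t s', Exec p s t s' ∧ t ≤ T ∧ Q s'

/-! ### CNF formulas and their orderings -/

/-- A CNF formula with clauses `Fin m` and variables `Fin n`.  A literal is a pair `(x, b)`, with `b = true`
for `x` and `b = false` for its negation; a clause is a finite set of literals, listed in any order without
repetition. -/
structure CNF (m n : ℕ) where
  /-- the literals of each clause -/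
  clause : Fin m → List (Fin n × Bool)
  /-- no literal is listed twice in a clause -/
  nodup : ∀ C, (clause C).Nodup

namespace CNF

variable {m n : ℕ}

/-- The variable `x` appears in the clause `C`, positively or negatively. -/
def Appears (F : CNF m n) (x : Fin n) (C : Fin m) : Prop :=
  ∃ b : Bool, (x, b) ∈ F.clause C

/-- The assignment `τ` satisfies the clause `C`. -/
def Satisfies (F : CNF m n) (τ : Fin n → Bool) (C : Fin m) : Prop :=
  ∃ l ∈ F.clause C, τ l.1 = l.2

instance (F : CNF m n) (τ : Fin n → Bool) (C : Fin m) : Decidable (F.Satisfies τ C) :=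
  inferInstanceAs (Decidable (∃ l ∈ F.clause C, τ l.1 = l.2))

/-- The number of assignments that satisfy every clause. -/
def numModels (F : CNF m n) : ℕ :=
  (Finset.univ.filter fun τ : Fin n → Bool => ∀ C, F.Satisfies τ C).card

/-- The number of clauses satisfied by `τ`. -/
def numSatisfied (F : CNF m n) (τ : Fin n → Bool) : ℕ :=
  (Finset.univ.filter fun C : Fin m => F.Satisfies τ C).card

/-- A total order of the clauses and variables together is given by the position `π e` of every element
`e`.  It is a `k`-interval ordering of `F` if for every clause `C` there are at most `k` variables `x` not
appearing in `C` such that some variable `x'` appears in `C` with `x' < x < C`, or `x` appears in some clause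
`C'` with `C' < C < x`. -/
def IsKIntervalOrdering (F : CNF m n) (k : ℕ) (π : Fin m ⊕ Fin n ≃ Fin (m + n)) : Prop :=
  ∀ C : Fin m,
    Set.ncard {x : Fin n | ¬ F.Appears x C ∧
      ((∃ x', F.Appears x' C ∧ π (.inr x') < π (.inr x) ∧ π (.inr x) < π (.inl C)) ∨
        (∃ C', F.Appears x C' ∧ π (.inl C') < π (.inl C) ∧ π (.inl C) < π (.inr x)))} ≤ k

end CNF

/-- A total order of the clauses is given by its enumeration `σ 0, σ 1, …`, a total order of the variables by
its enumeration `ρ 0, ρ 1, …`.  The total order `π` of clauses and variables is a merge of the two if it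
induces `σ` on the clauses and `ρ` on the variables. -/
def IsMerge {m n : ℕ} (σ : Equiv.Perm (Fin m)) (ρ : Equiv.Perm (Fin n))
    (π : Fin m ⊕ Fin n ≃ Fin (m + n)) : Prop :=
  (∀ i j : Fin m, i < j → π (.inl (σ i)) < π (.inl (σ j))) ∧
    (∀ i j : Fin n, i < j → π (.inr (ρ i)) < π (.inr (ρ j)))

/-! ### The input of the machine -/

namespace CNF

variable {m n : ℕ}

/-- The formula as a stream: clause after clause, the literal `(x, b)` is written as `(x + 1, b)`, and every
clause is closed by `(0, 0)`. -/
def stream (F : CNF m n) : List (ℕ × ℕ) :=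
  (List.ofFn F.clause).flatMap fun C =>
    C.map (fun l => ((l.1 : ℕ) + 1, l.2.toNat)) ++ [(0, 0)]

/-- The size of the input: `n` variables, `m` clauses, and all occurrences of literals. -/
def size (F : CNF m n) : ℕ := m + n + ∑ C, (F.clause C).length

/-- The initial state for the formula `F` and the orders `σ`, `ρ`: registers `0` and `1` hold `m` and `n`,
segments `0` and `1` hold the stream of `F`, segments `2` and `3` list the clauses and the variables in their
orders, and everything else is zero. -/
def initState (F : CNF m n) (σ : Equiv.Perm (Fin m)) (ρ : Equiv.Perm (Fin n)) : State where
  reg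
    | 0 => m
    | 1 => n
    | _ => 0
  mem
    | 0, i => (F.stream.getD i (0, 0)).1
    | 1, i => (F.stream.getD i (0, 0)).2
    | 2, i => if h : i < m then (σ ⟨i, h⟩ : ℕ) else 0
    | 3, i => if h : i < n then (ρ ⟨i, h⟩ : ℕ) else 0
    | _, _ => 0

end CNF

end KInterval

/-! Fix the two orders. A merge is determined by its gaps, the numbers `g i` of variables before
clause `i`, which form a nondecreasing sequence; the number of variables violating the interval
condition for clause `i` depends only on `i` and `g i` (`cost`). The least `k` is therefore a
minimum, over nondecreasing sequences, of a maximum of costs, and is computed row by row (`width`,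
`isLeast_width`). Moving a clause past one variable changes the status of that variable alone, so
all costs together take O(mn) steps. Once `k` is known, the least admissible gap for each clause in
turn gives an optimal merge.

Counting and maximising use dynamic programming over the cuts of this merge. An assignment acts
across a cut in two ways: the variables before the cut satisfy a set of clauses behind it (`fwd`),
and the variables behind it satisfy a set of clauses before it (`bwd`). The interval condition
leaves at most `(m + 1) * 2 ^ k` sets of either kind (`length_fwdList_le`, `length_bwdList_le`). To
see this, rank the clauses suitably and take the highest clause that an assignment leaves
unsatisfied. Being unsatisfied, it fixes the values of its own variables on the relevant side of the
cut; every other relevant variable of a clause of lower or equal rank is one of its at most `k`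
violating variables. So the set is determined by one clause and `k` bits.

For a forward set `y` and a backward set `z` of a cut, the table sums the values of the assignments
to the variables before the cut whose forward set is `y`, under the promise that the later variables
satisfy `z` (`total`, `table_apply`). An element of the order moves forward sets forwards and
backward sets backwards, so one step runs over the pairs of an old forward set and a new backward
set. A value has two components: a number of models, which is added, and a number `1 + τ + 2 ^ n *
(satisfied clauses)`, which is maximised. The assignment `τ` is part of the maximised number, so no
backtracking is needed (`numModels_eq`, `exists_best`).

Sets of clauses are numbers and serve directly as addresses; unwritten memory is zero, so the large
address range costs nothing. Without bitwise instructions a union takes O(m) steps. With at most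
`((m + 1) * 2 ^ k) ^ 2` pairs per element, the total is O(m^3 4^k (m + n)).

The programs are verified by evaluating loop-free pieces symbolically and by loop invariants with a
known number of rounds; a frame condition computed from the program text takes care of everything a
piece does not write. -/

namespace KInterval

/-! ### Verification of programs -/

/-- The register that an instruction writes. -/
def Instr.regTarget : Instr → Option ℕ
  | .const r _ => some r
  | .add r _ _ => some r
  | .sub r _ _ => some r
  | .load r _ _ => some r
  | .store _ _ _ => none

/-- The segment that an instruction writes. -/
def Instr.segTarget : Instr → Option ℕ
  | .store a _ _ => some a
  | _ => none

namespace Prog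

/-- The program may write register `r`. -/
def writesReg : Prog → ℕ → Bool
  | .skip, _ => false
  | .instr i, r => i.regTarget == some r
  | .seq p q, r => p.writesReg r || q.writesReg r
  | .branch _ p q, r => p.writesReg r || q.writesReg r
  | .loop _ p, r => p.writesReg r

/-- The program may write segment `a`. -/
def writesSeg : Prog → ℕ → Bool
  | .skip, _ => false
  | .instr i, a => i.segTarget == some a
  | .seq p q, a => p.writesSeg a || q.writesSeg a
  | .branch _ p q, a => p.writesSeg a || q.writesSeg a
  | .loop _ p, a => p.writesSeg a

/-- A sequence of instructions. -/
def block : List Instr → Prog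
  | [] => .skip
  | i :: l => .seq (.instr i) (block l)

/-- The final state of a program without loops. -/
def eval : Prog → State → State
  | .skip, s => s
  | .instr i, s => i.apply s
  | .seq p q, s => q.eval (p.eval s)
  | .branch r p q, s => if s.reg r ≠ 0 then p.eval s else q.eval s
  | .loop _ _, s => s

/-- A bound for the running time of a program without loops. -/
def len : Prog → ℕ
  | .skip => 0
  | .instr _ => 1
  | .seq p q => p.len + q.len
  | .branch _ p q => max p.len q.len + 1
  | .loop _ _ => 0

/-- The program has no loops. -/
def loopFree : Prog → Bool
  | .skip => true
  | .instr _ => true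
  | .seq p q => p.loopFree && q.loopFree
  | .branch _ p q => p.loopFree && q.loopFree
  | .loop _ _ => false

end Prog

/-- `s'` agrees with `s` outside the registers and segments that `p` may write. -/
structure Frame (p : Prog) (s s' : State) : Prop where
  reg : ∀ r, p.writesReg r = false → s'.reg r = s.reg r
  mem : ∀ a, p.writesSeg a = false → s'.mem a = s.mem a

theorem Frame.refl (p : Prog) (s : State) : Frame p s s := ⟨fun _ _ => rfl, fun _ _ => rfl⟩

theorem Frame.trans {p : Prog} {s s' s'' : State} (h : Frame p s s') (h' : Frame p s' s'') :
    Frame p s s'' :=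
  ⟨fun r hr => (h'.reg r hr).trans (h.reg r hr), fun a ha => (h'.mem a ha).trans (h.mem a ha)⟩

theorem Frame.mono {p q : Prog} {s s' : State} (h : Frame p s s')
    (hr : ∀ r, q.writesReg r = false → p.writesReg r = false)
    (ha : ∀ a, q.writesSeg a = false → p.writesSeg a = false) : Frame q s s' :=
  ⟨fun r h' => h.reg r (hr r h'), fun a h' => h.mem a (ha a h')⟩

/-- The possible targets are computed from the program text. For a concrete program the side
conditions of `Frame` are thus closed by evaluation, mostly by `rfl`, and invariants need not
mention untouched data. -/
theorem Exec.frame {p : Prog} {s s' : State} {t : ℕ} (h : Exec p s t s') : Frame p s s' := by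
  induction h with
  | skip s => exact Frame.refl _ _
  | instr i s =>
    constructor
    · intro r hr
      cases i <;> simp_all [Prog.writesReg, Instr.regTarget, Instr.apply, Function.update_apply]
      all_goals intro h; exact absurd h.symm hr
    · intro a ha
      cases i <;> simp_all [Prog.writesSeg, Instr.segTarget, Instr.apply, Function.update_apply] <;>
        (intro h; exact absurd h.symm ha)
  | seq _ _ ih ih' =>
    exact (ih.mono (by simp +contextual [Prog.writesReg]) (by simp +contextual [Prog.writesSeg])).trans
      (ih'.mono (by simp +contextual [Prog.writesReg]) (by simp +contextual [Prog.writesSeg]))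
  | branch_true _ _ ih =>
    exact ih.mono (by simp +contextual [Prog.writesReg]) (by simp +contextual [Prog.writesSeg])
  | branch_false _ _ ih =>
    exact ih.mono (by simp +contextual [Prog.writesReg]) (by simp +contextual [Prog.writesSeg])
  | loop_done _ => exact Frame.refl _ _
  | loop_step _ _ _ ih ih' =>
    exact (ih.mono (by simp [Prog.writesReg]) (by simp [Prog.writesSeg])).trans ih'

namespace HaltsWithin

variable {p q : Prog} {s : State} {T T' : ℕ} {Q R : State → Prop}

theorem mono (h : HaltsWithin p s T Q) (hT : T ≤ T') (hQ : ∀ s', Q s' → R s') :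
    HaltsWithin p s T' R := by
  obtain ⟨t, s', he, ht, hq⟩ := h
  exact ⟨t, s', he, ht.trans hT, hQ _ hq⟩

theorem framed (h : HaltsWithin p s T Q) :
    HaltsWithin p s T (fun s' => Q s' ∧ Frame p s s') := by
  obtain ⟨t, s', he, ht, hq⟩ := h
  exact ⟨t, s', he, ht, hq, he.frame⟩

theorem seq (h : HaltsWithin p s T Q)
    (h' : ∀ s', Q s' → Frame p s s' → HaltsWithin q s' T' R) :
    HaltsWithin (.seq p q) s (T + T') R := by
  obtain ⟨t, s', he, ht, hq⟩ := h
  obtain ⟨t', s'', he', ht', hr⟩ := h' s' hq he.frame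
  exact ⟨t + t', s'', .seq he he', by omega, hr⟩

theorem branch {r : ℕ} (h : s.reg r ≠ 0 → HaltsWithin p s T R)
    (h' : s.reg r = 0 → HaltsWithin q s T R) : HaltsWithin (.branch r p q) s (T + 1) R := by
  by_cases hr : s.reg r = 0
  · obtain ⟨t, s', he, ht, hq⟩ := h' hr
    exact ⟨t + 1, s', .branch_false hr he, by omega, hq⟩
  · obtain ⟨t, s', he, ht, hq⟩ := h hr
    exact ⟨t + 1, s', .branch_true hr he, by omega, hq⟩

theorem loop_done {r : ℕ} (hr : s.reg r = 0) (hR : R s) : HaltsWithin (.loop r p) s 1 R :=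
  ⟨1, s, .loop_done hr, le_rfl, hR⟩

theorem loop_step {r : ℕ} (hr : s.reg r ≠ 0) (h : HaltsWithin p s T Q)
    (h' : ∀ s', Q s' → Frame p s s' → HaltsWithin (.loop r p) s' T' R) :
    HaltsWithin (.loop r p) s (T + T' + 1) R := by
  obtain ⟨t, s', he, ht, hq⟩ := h
  obtain ⟨t', s'', he', ht', hr'⟩ := h' s' hq he.frame
  exact ⟨t + t' + 1, s'', .loop_step hr he he', by omega, hr'⟩

/-- A loop with an invariant `I i` that holds after `i` of `N` rounds. -/
theorem loop {r N c : ℕ} (I : ℕ → State → Prop) (h0 : I 0 s)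
    (hstep : ∀ i s', i < N → I i s' → Frame p s s' →
      s'.reg r ≠ 0 ∧ HaltsWithin p s' c (I (i + 1)))
    (hend : ∀ s', I N s' → s'.reg r = 0) :
    HaltsWithin (.loop r p) s (N * (c + 1) + 1) (fun s' => I N s' ∧ Frame p s s') := by
  -- Induction on the number `d` of remaining rounds, carrying along the frame from the very first
  -- state.
  have key : ∀ d i s', i + d = N → I i s' → Frame p s s' →
      HaltsWithin (.loop r p) s' (d * (c + 1) + 1) (fun s'' => I N s'' ∧ Frame p s s'') := by
    intro d
    induction d with
    | zero =>
      intro i s' hi hI hf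
      obtain rfl : i = N := by omega
      exact (loop_done (hend s' hI) ⟨hI, hf⟩).mono (by omega) fun _ h => h
    | succ d ih =>
      intro i s' hi hI hf
      obtain ⟨hr, hb⟩ := hstep i s' (by omega) hI hf
      refine (loop_step hr hb fun s'' hI' hf' =>
        ih (i + 1) s'' (by omega) hI' (hf.trans hf')).mono ?_ fun _ h => h
      have : (d + 1) * (c + 1) = d * (c + 1) + c + 1 := by ring
      omega
  exact key N 0 s (by omega) h0 (Frame.refl _ _)

theorem straight (p : Prog) (s : State) (hp : p.loopFree = true) :
    HaltsWithin p s p.len (fun s' => s' = p.eval s) := by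
  induction p generalizing s with
  | skip => exact ⟨0, s, .skip s, le_rfl, rfl⟩
  | instr i => exact ⟨1, _, .instr i s, le_rfl, rfl⟩
  | seq p q ih ih' =>
    simp only [Prog.loopFree, Bool.and_eq_true] at hp
    exact (ih s hp.1).seq fun s' hs' _ => by subst hs'; exact ih' _ hp.2
  | branch r p q ih ih' =>
    simp only [Prog.loopFree, Bool.and_eq_true] at hp
    refine branch (fun hr => ?_) (fun hr => ?_)
    · exact (ih s hp.1).mono (le_max_left _ _) fun s' hs' => by simp [Prog.eval, hr, hs']
    · exact (ih' s hp.2).mono (le_max_right _ _) fun s' hs' => by simp [Prog.eval, hr, hs']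
  | loop r p => simp [Prog.loopFree] at hp

/-- Symbolic execution of a program without loops. -/
theorem of_eval (hp : p.loopFree = true) (hT : p.len ≤ T) (hR : R (p.eval s)) :
    HaltsWithin p s T R :=
  (straight p s hp).mono hT fun _ h => h ▸ hR

end HaltsWithin

end KInterval

namespace KInterval

/-! ### Orderings as sequences of gaps -/

/-- The number of variables that violate the interval condition for clause `i` when this clause is placed
right before variable `g`; here `A i j ≠ 0` means that variable `j` appears in clause `i`. -/
def cost (A : ℕ → ℕ → ℕ) (n i g : ℕ) : ℕ :=
  ((Finset.range n).filter fun j => A i j = 0 ∧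
    ((j < g ∧ ∃ j' < j, A i j' ≠ 0) ∨ (g ≤ j ∧ ∃ i' < i, A i' j ≠ 0))).card

theorem cost_le (A : ℕ → ℕ → ℕ) (n i g : ℕ) : cost A n i g ≤ n :=
  (Finset.card_filter_le _ _).trans (by simp)

theorem cost_zero (A : ℕ → ℕ → ℕ) (n i : ℕ) :
    cost A n i 0 = ((Finset.range n).filter fun j => A i j = 0 ∧ ∃ i' < i, A i' j ≠ 0).card := by
  simp [cost]

/-- Moving the clause behind variable `g` affects this variable only: condition (2) ceases to apply
to it and condition (1) begins to. The additive form avoids truncated subtraction; it yields a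
constant-time update of the cost. -/
theorem cost_succ (A : ℕ → ℕ → ℕ) (n i g : ℕ) (hg : g < n) :
    cost A n i (g + 1) + (if A i g = 0 ∧ ∃ i' < i, A i' g ≠ 0 then 1 else 0) =
      cost A n i g + (if A i g = 0 ∧ ∃ j' < g, A i j' ≠ 0 then 1 else 0) := by
  classical
  unfold cost
  have hg' : g ∈ Finset.range n := by simpa using hg
  rw [Finset.card_filter, Finset.card_filter, ← Finset.add_sum_erase _ _ hg',
    ← Finset.add_sum_erase (Finset.range n) (fun j => if A i j = 0 ∧
      ((j < g ∧ ∃ j' < j, A i j' ≠ 0) ∨ (g ≤ j ∧ ∃ i' < i, A i' j ≠ 0)) then 1 else 0) hg']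
  have : ∑ x ∈ (Finset.range n).erase g, (if A i x = 0 ∧
        ((x < g + 1 ∧ ∃ j' < x, A i j' ≠ 0) ∨ (g + 1 ≤ x ∧ ∃ i' < i, A i' x ≠ 0)) then 1 else 0) =
      ∑ x ∈ (Finset.range n).erase g, (if A i x = 0 ∧
        ((x < g ∧ ∃ j' < x, A i j' ≠ 0) ∨ (g ≤ x ∧ ∃ i' < i, A i' x ≠ 0)) then 1 else 0) := by
    refine Finset.sum_congr rfl fun x hx => ?_
    have hne : x ≠ g := (Finset.mem_erase.1 hx).1
    have h1 : x < g + 1 ↔ x < g := by omega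
    have h2 : g + 1 ≤ x ↔ g ≤ x := by omega
    simp only [h1, h2]
  rw [this]
  simp
  omega

/-- The minimum of `n` and of the first values of `D`. -/
def runMin (n : ℕ) (D : ℕ → ℕ) : ℕ → ℕ
  | 0 => n
  | g + 1 => min (runMin n D g) (D g)

theorem runMin_le_iff (n : ℕ) (D : ℕ → ℕ) (g q : ℕ) :
    runMin n D g ≤ q ↔ n ≤ q ∨ ∃ g' < g, D g' ≤ q := by
  induction g with
  | zero => simp [runMin]
  | succ g ih => simp only [runMin, min_le_iff, ih, Nat.exists_lt_succ_right, or_assoc]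

/-- The least possible largest violation for the first `i` clauses, placed at gaps up to `g`. -/
def width (A : ℕ → ℕ → ℕ) (n : ℕ) : ℕ → ℕ → ℕ
  | 0, _ => 0
  | i + 1, g => runMin n (fun g' => max (cost A n i g') (width A n i g')) (g + 1)

/-- The gaps of the first `m` clauses: `g i` variables precede clause `i`. -/
structure IsGaps (m n : ℕ) (g : ℕ → ℕ) : Prop where
  mono : ∀ i j, i ≤ j → j < m → g i ≤ g j
  le : ∀ i < m, g i ≤ n

/-- Fix the last gap first: it confines the gaps of the earlier clauses to be at most itself, which
is the recursion of `width`. -/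
theorem width_le_iff (A : ℕ → ℕ → ℕ) (n i g q : ℕ) :
    width A n i g ≤ q ↔ ∃ h, IsGaps i g h ∧ ∀ i' < i, cost A n i' (h i') ≤ q := by
  induction i generalizing g with
  | zero => simp only [width, Nat.zero_le, true_iff]; exact ⟨fun _ => 0, ⟨by simp, by simp⟩, by simp⟩
  | succ i ih =>
    simp only [width, runMin_le_iff, max_le_iff, ih]
    constructor
    · rintro (hq | ⟨g', hg', hc, h, hh, hc'⟩)
      -- The initial value `n` of `runMin` does no harm: if `n ≤ q`, all gaps are admissible,
      -- because no cost exceeds `n`.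
      · exact ⟨fun _ => 0, ⟨by simp, by simp⟩, fun i' _ => (cost_le _ _ _ _).trans hq⟩
      · refine ⟨fun i' => if i' < i then h i' else g', ⟨fun a b hab hb => ?_, fun a ha => ?_⟩,
          fun a ha => ?_⟩
        · by_cases h1 : b < i
          · simp only [h1, (show a < i by omega), if_true]; exact hh.mono a b hab h1
          · by_cases h2 : a < i
            · simp only [h1, h2, if_true, if_false]; exact hh.le a h2
            · simp [h1, h2]
        · by_cases h2 : a < i
          · simp only [h2, if_true]; exact (hh.le a h2).trans (by omega)
          · simp only [h2, if_false]; omega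
        · by_cases h2 : a < i
          · simp only [h2, if_true]; exact hc' a h2
          · obtain rfl : a = i := by omega
            simpa using hc
    · rintro ⟨h, hh, hc⟩
      refine Or.inr ⟨h i, Nat.lt_succ_of_le (hh.le i (by omega)), hc i (by omega), h,
        ⟨fun a b hab hb => hh.mono a b hab (by omega), fun a ha => hh.mono a i (by omega) (by omega)⟩,
        fun a ha => hc a (by omega)⟩

namespace CNF

variable {m n : ℕ}

open Classical in
/-- In the given orders, literal `(j, b)` is in clause `i`. -/
def lit (F : CNF m n) (σ : Equiv.Perm (Fin m)) (ρ : Equiv.Perm (Fin n)) (b : Bool) (i j : ℕ) : ℕ :=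
  if ∃ (hi : i < m) (hj : j < n), (ρ ⟨j, hj⟩, b) ∈ F.clause (σ ⟨i, hi⟩) then 1 else 0

/-- The number of occurrences of variable `j` in clause `i`, in the given orders. -/
def occ (F : CNF m n) (σ : Equiv.Perm (Fin m)) (ρ : Equiv.Perm (Fin n)) (i j : ℕ) : ℕ :=
  F.lit σ ρ false i j + F.lit σ ρ true i j

variable (F : CNF m n) (σ : Equiv.Perm (Fin m)) (ρ : Equiv.Perm (Fin n))

theorem lit_ne_zero (b : Bool) (i : Fin m) (j : Fin n) :
    F.lit σ ρ b i j ≠ 0 ↔ (ρ j, b) ∈ F.clause (σ i) := by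
  simp [lit]

theorem occ_ne_zero (i : Fin m) (j : Fin n) : F.occ σ ρ i j ≠ 0 ↔ F.Appears (ρ j) (σ i) := by
  have h0 := F.lit_ne_zero σ ρ false i j
  have h1 := F.lit_ne_zero σ ρ true i j
  simp only [occ, Appears, Bool.exists_bool, ← h0, ← h1]
  omega

/-- Both conditions see the merge only through the two given orders and through the side of the
clause on which a variable lies, and the gap records that side. -/
theorem cost_occ (π : Fin m ⊕ Fin n ≃ Fin (m + n)) (hπ : IsMerge σ ρ π) (g : ℕ → ℕ)
    (hg : ∀ (i : Fin m) (j : Fin n), π (.inr (ρ j)) < π (.inl (σ i)) ↔ (j : ℕ) < g i) (i : Fin m) :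
    Set.ncard {x : Fin n | ¬ F.Appears x (σ i) ∧
      ((∃ x', F.Appears x' (σ i) ∧ π (.inr x') < π (.inr x) ∧ π (.inr x) < π (.inl (σ i))) ∨
        (∃ C', F.Appears x C' ∧ π (.inl C') < π (.inl (σ i)) ∧ π (.inl (σ i)) < π (.inr x)))} =
      cost (F.occ σ ρ) n i (g i) := by
  have hρ : ∀ j j' : Fin n, π (.inr (ρ j)) < π (.inr (ρ j')) ↔ j < j' :=
    fun j j' => (show StrictMono fun j => π (.inr (ρ j)) from fun a b h => hπ.2 a b h).lt_iff_lt
  have hσ : ∀ i i' : Fin m, π (.inl (σ i)) < π (.inl (σ i')) ↔ i < i' :=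
    fun i i' => (show StrictMono fun i => π (.inl (σ i)) from fun a b h => hπ.1 a b h).lt_iff_lt
  have hg' : ∀ (i : Fin m) (j : Fin n), π (.inl (σ i)) < π (.inr (ρ j)) ↔ g i ≤ (j : ℕ) := by
    intro i j
    have hne : π (.inl (σ i)) ≠ π (.inr (ρ j)) := by simp
    rw [← not_lt, ← hg, not_lt]
    exact ⟨le_of_lt, fun h => lt_of_le_of_ne h hne⟩
  rw [cost, ← Set.ncard_coe_finset]
  symm
  refine Set.ncard_congr (fun j hj => ρ ⟨j, by simp at hj; exact hj.1⟩) ?_ ?_ ?_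
  · intro j hj
    have hjn : j < n := by simp at hj; exact hj.1
    obtain ⟨j, rfl⟩ : ∃ j' : Fin n, (j' : ℕ) = j := ⟨⟨j, hjn⟩, rfl⟩
    simp only [Finset.coe_filter, Finset.mem_range, Set.mem_ofPred_eq] at hj
    simp only [Fin.eta, Set.mem_ofPred_eq, ← F.occ_ne_zero σ ρ, hj.2.1, hg, hg']
    refine ⟨by simp, hj.2.2.imp ?_ ?_⟩
    · rintro ⟨h, j', h', ha⟩
      refine ⟨ρ ⟨j', by omega⟩, ?_, (hρ _ _).2 (by exact h'), h⟩
      rw [← F.occ_ne_zero σ ρ]; exact ha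
    · rintro ⟨h, i', h', ha⟩
      refine ⟨σ ⟨i', by omega⟩, ?_, (hσ _ _).2 (by exact h'), h⟩
      rw [← F.occ_ne_zero σ ρ]; exact ha
  · intro a b _ _ hab
    simpa using hab
  · intro x hx
    obtain ⟨j, rfl⟩ := ρ.surjective x
    refine ⟨j, ?_, rfl⟩
    simp only [Set.mem_ofPred_eq, ← F.occ_ne_zero σ ρ, not_not, hg, hg'] at hx
    simp only [Finset.coe_filter, Finset.mem_range, Set.mem_ofPred_eq, j.2, true_and]
    refine ⟨hx.1, hx.2.imp ?_ ?_⟩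
    · rintro ⟨x', ha, h1, h2⟩
      obtain ⟨j', rfl⟩ := ρ.surjective x'
      exact ⟨h2, j', (hρ _ _).1 h1, (F.occ_ne_zero σ ρ _ _).2 ha⟩
    · rintro ⟨C', ha, h1, h2⟩
      obtain ⟨i', rfl⟩ := σ.surjective C'
      exact ⟨h2, i', (hσ _ _).1 h1, (F.occ_ne_zero σ ρ _ _).2 ha⟩

/-- Applied to the variables before a clause, which form an initial segment of their order; its
length is the gap of the clause. -/
theorem exists_gap (P : Fin n → Prop) (hP : ∀ i j, i ≤ j → P j → P i) :
    ∃ g ≤ n, ∀ j : Fin n, P j ↔ (j : ℕ) < g := by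
  classical
  have hex : ∃ g, ∀ h : g < n, ¬ P ⟨g, h⟩ := ⟨n, fun h => absurd h (lt_irrefl _)⟩
  refine ⟨Nat.find hex, Nat.find_le fun h => absurd h (lt_irrefl _), fun j => ⟨fun hj => ?_, fun hj => ?_⟩⟩
  · by_contra hlt
    have hlt' : Nat.find hex ≤ j := not_lt.1 hlt
    exact Nat.find_spec hex (lt_of_le_of_lt hlt' j.2) (hP _ _ hlt' hj)
  · have := Nat.find_min hex hj
    push Not at this
    exact this.2

/-- Clause `i` must be preceded by `i` clauses and `g i` variables, variable `j` by `j` variables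
and by the clauses of gap at most `j`. These counts are taken as positions. -/
theorem exists_merge (g : ℕ → ℕ) (hg : IsGaps m n g) :
    ∃ π : Fin m ⊕ Fin n ≃ Fin (m + n), IsMerge σ ρ π ∧
      ∀ (i : Fin m) (j : Fin n), π (.inr (ρ j)) < π (.inl (σ i)) ↔ (j : ℕ) < g i := by
  classical
  let c : ℕ → ℕ := fun j => ((Finset.range m).filter fun i => g i ≤ j).card
  have hc : ∀ j, c j ≤ m := fun j => (Finset.card_filter_le _ _).trans (by simp)
  have hcm : ∀ j j', j ≤ j' → c j ≤ c j' := fun j j' h =>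
    Finset.card_le_card (Finset.monotone_filter_right _ fun i _ hi => le_trans hi h)
  have h1 : ∀ i < m, ∀ j, g i ≤ j → i + 1 ≤ c j := by
    intro i hi j hj
    calc i + 1 = (Finset.range (i + 1)).card := by simp
      _ ≤ _ := Finset.card_le_card fun a ha => by
        simp only [Finset.mem_range, Finset.mem_filter] at ha ⊢
        exact ⟨by omega, (hg.mono a i (by omega) hi).trans hj⟩
  have h2 : ∀ i < m, ∀ j, j < g i → c j ≤ i := by
    intro i hi j hj
    calc c j ≤ (Finset.range i).card := Finset.card_le_card fun a ha => by
          simp only [Finset.mem_range, Finset.mem_filter] at ha ⊢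
          by_contra h
          have := hg.mono i a (by omega) ha.1
          omega
      _ = i := by simp
  let f : Fin m ⊕ Fin n → Fin (m + n) := Sum.elim
    (fun C => ⟨(σ.symm C : ℕ) + g (σ.symm C), by
      have := hg.le _ (σ.symm C).2; have := (σ.symm C).2; omega⟩)
    (fun x => ⟨(ρ.symm x : ℕ) + c (ρ.symm x), by
      have := hc (ρ.symm x); have := (ρ.symm x).2; omega⟩)
  have hlt : ∀ (i : Fin m) (j : Fin n), f (.inr (ρ j)) < f (.inl (σ i)) ↔ (j : ℕ) < g i := by
    intro i j
    simp only [f, Sum.elim_inl, Sum.elim_inr, Equiv.symm_apply_apply, Fin.mk_lt_mk]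
    constructor
    · intro h
      by_contra h'
      have := h1 i i.2 j (by omega)
      omega
    · intro h
      have := h2 i i.2 j h
      omega
  have hgt : ∀ (i : Fin m) (j : Fin n), f (.inl (σ i)) < f (.inr (ρ j)) ↔ g i ≤ (j : ℕ) := by
    intro i j
    simp only [f, Sum.elim_inl, Sum.elim_inr, Equiv.symm_apply_apply, Fin.mk_lt_mk]
    constructor
    · intro h
      by_contra h'
      have := h2 i i.2 j (by omega)
      omega
    · intro h
      have := h1 i i.2 j h
      omega
  have hσ : StrictMono fun i => f (.inl (σ i)) := by
    intro i i' h
    have := hg.mono i i' (le_of_lt h) i'.2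
    simp only [f, Sum.elim_inl, Equiv.symm_apply_apply, Fin.mk_lt_mk]
    omega
  have hρ : StrictMono fun j => f (.inr (ρ j)) := by
    intro j j' h
    have := hcm j j' (le_of_lt h)
    simp only [f, Sum.elim_inr, Equiv.symm_apply_apply, Fin.mk_lt_mk]
    omega
  have hne : ∀ C x, f (.inl C) ≠ f (.inr x) := by
    intro C x h
    obtain ⟨i, rfl⟩ := σ.surjective C
    obtain ⟨j, rfl⟩ := ρ.surjective x
    have a := hlt i j
    have b := hgt i j
    rw [h] at a b
    simp only [lt_self_iff_false, false_iff] at a b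
    omega
  have hinj : Function.Injective f := by
    rintro (C | x) (C' | x') h
    · obtain ⟨i, rfl⟩ := σ.surjective C
      obtain ⟨i', rfl⟩ := σ.surjective C'
      rw [hσ.injective h]
    · exact absurd h (hne _ _)
    · exact absurd h.symm (hne _ _)
    · obtain ⟨i, rfl⟩ := ρ.surjective x
      obtain ⟨i', rfl⟩ := ρ.surjective x'
      rw [hρ.injective h]
  exact ⟨Equiv.ofBijective f ((Fintype.bijective_iff_injective_and_card f).2 ⟨hinj, by simp⟩),
    ⟨fun i j h => hσ h, fun i j h => hρ h⟩, hlt⟩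

/-- The merges that are `q`-interval orderings, in terms of gaps. -/
theorem exists_merge_iff (q : ℕ) :
    (∃ π : Fin m ⊕ Fin n ≃ Fin (m + n), IsMerge σ ρ π ∧ F.IsKIntervalOrdering q π) ↔
      ∃ g, IsGaps m n g ∧ ∀ i < m, cost (F.occ σ ρ) n i (g i) ≤ q := by
  constructor
  · rintro ⟨π, hπ, hq⟩
    have hρ : StrictMono fun j => π (.inr (ρ j)) := fun a b h => hπ.2 a b h
    have hσ : StrictMono fun i => π (.inl (σ i)) := fun a b h => hπ.1 a b h
    have := fun i : Fin m => exists_gap (fun j => π (.inr (ρ j)) < π (.inl (σ i)))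
      fun a b hab hb => lt_of_le_of_lt (hρ.monotone hab) hb
    choose g hg hg' using this
    have hex : ∃ g' : ℕ → ℕ, ∀ i : Fin m, g' i = g i :=
      ⟨fun i => if h : i < m then g ⟨i, h⟩ else 0, fun i => by simp⟩
    obtain ⟨g', hgg⟩ := hex
    refine ⟨g', ⟨fun a b hab hb => ?_, fun a ha => ?_⟩, fun a ha => ?_⟩
    · have h1 := hgg ⟨a, by omega⟩
      have h2 := hgg ⟨b, hb⟩
      simp only at h1 h2
      rw [h1, h2]
      by_contra hlt
      have hlt' := not_le.1 hlt
      have hn := lt_of_lt_of_le hlt' (hg _)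
      have := (hg' ⟨a, by omega⟩ ⟨_, hn⟩).2 hlt'
      have h3 : π (.inl (σ ⟨a, by omega⟩)) ≤ π (.inl (σ ⟨b, hb⟩)) :=
        hσ.monotone (a := ⟨a, by omega⟩) (b := ⟨b, hb⟩) hab
      have := (hg' ⟨b, hb⟩ ⟨_, hn⟩).1 (lt_of_lt_of_le this h3)
      simp at this
    · have h1 := hgg ⟨a, ha⟩
      simp only at h1
      rw [h1]; exact hg _
    · have := F.cost_occ σ ρ π hπ g' (fun i j => by rw [hgg, hg']) ⟨a, ha⟩
      rw [← this]
      exact hq _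
  · rintro ⟨g, hg, hc⟩
    obtain ⟨π, hπ, hπg⟩ := exists_merge σ ρ g hg
    refine ⟨π, hπ, fun C => ?_⟩
    obtain ⟨i, rfl⟩ := σ.surjective C
    rw [F.cost_occ σ ρ π hπ g hπg i]
    exact hc i i.2

theorem isLeast_width : IsLeast {q : ℕ | ∃ π : Fin m ⊕ Fin n ≃ Fin (m + n),
    IsMerge σ ρ π ∧ F.IsKIntervalOrdering q π} (width (F.occ σ ρ) n m n) := by
  constructor
  · rw [Set.mem_ofPred_eq, exists_merge_iff, ← width_le_iff]
  · intro q hq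
    rw [Set.mem_ofPred_eq, exists_merge_iff, ← width_le_iff] at hq
    exact hq

end CNF

end KInterval

namespace KInterval

/-! ### Sets of clauses as numbers -/

open Classical in
/-- The set of all `i` with `lo ≤ i < hi` and `P i`, as a number. -/
noncomputable def code (lo hi : ℕ) (P : ℕ → Prop) : ℕ :=
  ∑ i ∈ Finset.Ico lo hi, if P i then 2 ^ i else 0

theorem code_self (lo : ℕ) (P : ℕ → Prop) : code lo lo P = 0 := by simp [code]

-- The bound and the bits are proved together: adding the top power `2 ^ h` is a disjoint union of
-- bits because the rest is below `2 ^ h`.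
open Classical in
theorem code_lt_and_testBit (lo hi : ℕ) (P : ℕ → Prop) :
    code lo hi P < 2 ^ hi ∧
      ∀ i, (code lo hi P).testBit i = true ↔ lo ≤ i ∧ i < hi ∧ P i := by
  induction hi with
  | zero => simp [code]
  | succ h ih =>
    by_cases hlo : lo ≤ h
    · have hs : code lo (h + 1) P = (if P h then 2 ^ h else 0) + code lo h P := by
        simp only [code, Finset.sum_Ico_succ_top hlo]
        rw [add_comm]
      obtain ⟨hlt, hb⟩ := ih
      rw [hs]
      by_cases hP : P h
      · simp only [hP, if_true]
        refine ⟨by rw [pow_succ]; omega, fun i => ?_⟩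
        have := Nat.two_pow_add_eq_or_of_lt hlt 1
        rw [mul_one] at this
        rw [this, Nat.testBit_or, Bool.or_eq_true, hb, Nat.testBit_two_pow, decide_eq_true_iff]
        constructor
        · rintro (rfl | ⟨h1, h2, h3⟩)
          · exact ⟨hlo, by omega, hP⟩
          · exact ⟨h1, by omega, h3⟩
        · rintro ⟨h1, h2, h3⟩
          by_cases h4 : h = i
          · exact Or.inl h4
          · exact Or.inr ⟨h1, by omega, h3⟩
      · simp only [hP, if_false, zero_add, hb]
        refine ⟨by rw [pow_succ]; omega, fun i => ⟨fun h' => ⟨h'.1, by omega, h'.2.2⟩, ?_⟩⟩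
        rintro ⟨h1, h2, h3⟩
        refine ⟨h1, ?_, h3⟩
        by_contra h4
        obtain rfl : i = h := by omega
        exact hP h3
    · have : code lo (h + 1) P = 0 := by
        simp only [code, Finset.Ico_eq_empty_of_le (show h + 1 ≤ lo by omega), Finset.sum_empty]
      rw [this]
      refine ⟨by positivity, fun i => ?_⟩
      simp only [Nat.zero_testBit, Bool.false_eq_true, false_iff]
      omega

theorem code_lt (lo hi : ℕ) (P : ℕ → Prop) : code lo hi P < 2 ^ hi :=
  (code_lt_and_testBit lo hi P).1

theorem testBit_code (lo hi : ℕ) (P : ℕ → Prop) (i : ℕ) :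
    (code lo hi P).testBit i = true ↔ lo ≤ i ∧ i < hi ∧ P i :=
  (code_lt_and_testBit lo hi P).2 i

/-- A set of clauses from `lo` on leaves the low `lo` bits free. This is why a forward and a
backward set can be added to form one address. -/
theorem code_mod (lo hi : ℕ) (P : ℕ → Prop) : code lo hi P % 2 ^ lo = 0 := by
  refine Nat.eq_of_testBit_eq fun i => ?_
  rw [Nat.testBit_mod_two_pow, Nat.zero_testBit, Bool.eq_iff_iff]
  simp only [Bool.and_eq_true, decide_eq_true_eq, testBit_code]
  constructor
  · rintro ⟨h1, h2, -⟩; omega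
  · simp

theorem code_eq_iff {lo hi : ℕ} {P Q : ℕ → Prop} :
    code lo hi P = code lo hi Q ↔ ∀ i, lo ≤ i → i < hi → (P i ↔ Q i) := by
  constructor
  · intro h i h1 h2
    have hP := testBit_code lo hi P i
    have hQ := testBit_code lo hi Q i
    rw [h, hQ] at hP
    tauto
  · intro h
    refine Nat.eq_of_testBit_eq fun i => ?_
    rw [Bool.eq_iff_iff, testBit_code, testBit_code]
    constructor
    · rintro ⟨h1, h2, h3⟩; exact ⟨h1, h2, (h i h1 h2).1 h3⟩
    · rintro ⟨h1, h2, h3⟩; exact ⟨h1, h2, (h i h1 h2).2 h3⟩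

/-- Add the set `a`, then remove the set `b`, which is a part of `a`. -/
def image (a b z : ℕ) : ℕ := (z ||| a) - b

theorem image_zero (a z : ℕ) : image a 0 z = z ||| a := rfl

/-- Setting bit `c` before subtracting `2 ^ c` prevents a borrow, so the subtraction deletes exactly
the element `c`. -/
theorem testBit_image_pow (c z i : ℕ) :
    (image (2 ^ c) (2 ^ c) z).testBit i = true ↔ i ≠ c ∧ z.testBit i = true := by
  have h : (z ||| 2 ^ c) = 2 ^ c + z.ldiff (2 ^ c) := by
    -- Split `x` at bit `c + 1`. The low part is below `2 ^ c` because bit `c` is clear, so adding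
    -- `2 ^ c` produces no carry.
    have key : ∀ x : ℕ, x.testBit c = false → 2 ^ c + x = 2 ^ c ||| x := by
      intro x hx
      have h1 : 2 ^ c + x = 2 ^ c ||| x ↔ True := by
        have hd : x = 2 ^ (c + 1) * (x / 2 ^ (c + 1)) + x % 2 ^ (c + 1) := (Nat.div_add_mod _ _).symm
        have hm : x % 2 ^ (c + 1) < 2 ^ c := by
          have : (x % 2 ^ (c + 1)).testBit c = false := by
            simp [Nat.testBit_mod_two_pow, hx]
          by_contra hlt
          have h2 : x % 2 ^ (c + 1) < 2 ^ (c + 1) := Nat.mod_lt _ (by positivity)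
          have h3 := Nat.testBit_two_pow_add_eq (x % 2 ^ (c + 1) - 2 ^ c) c
          rw [Nat.add_sub_cancel' (not_lt.1 hlt), this,
            Nat.testBit_lt_two_pow (by rw [pow_succ] at h2; omega)] at h3
          simp at h3
        set q := x / 2 ^ (c + 1)
        set r := x % 2 ^ (c + 1)
        have e1 := Nat.two_pow_add_eq_or_of_lt hm 1
        rw [mul_one] at e1
        have e2 : 2 ^ c + r < 2 ^ (c + 1) := by rw [pow_succ]; omega
        have e3 := Nat.two_pow_add_eq_or_of_lt e2 q
        have e4 := Nat.two_pow_add_eq_or_of_lt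
          (lt_trans hm (Nat.pow_lt_pow_right (by norm_num) (by omega : c < c + 1))) q
        simp only [iff_true]
        rw [hd, e4]
        calc 2 ^ c + (2 ^ (c + 1) * q ||| r) = 2 ^ (c + 1) * q + (2 ^ c + r) := by rw [← e4]; ring
          _ = 2 ^ (c + 1) * q ||| (2 ^ c ||| r) := by rw [e3, e1]
          _ = 2 ^ c ||| (2 ^ (c + 1) * q ||| r) := by
            rw [← Nat.or_assoc, ← Nat.or_assoc, Nat.or_comm (2 ^ (c + 1) * q)]
      exact h1.2 trivial
    rw [key _ (by simp [Nat.testBit_ldiff])]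
    refine Nat.eq_of_testBit_eq fun i => ?_
    simp only [Nat.testBit_or, Nat.testBit_ldiff, Nat.testBit_two_pow]
    by_cases h : c = i <;> simp [h]
  rw [image, h, Nat.add_sub_cancel_left, Nat.testBit_ldiff, Nat.testBit_two_pow]
  simp only [Bool.and_eq_true, Bool.not_eq_true', decide_eq_false_iff_not]
  tauto

/-- Membership is expressed as absorption because the same test with the empty mask of a variable is
then always true. -/
theorem or_two_pow_eq_iff (z c : ℕ) : z ||| 2 ^ c = z ↔ z.testBit c = true := by
  constructor
  · intro h
    rw [← h]; simp
  · intro h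
    refine Nat.eq_of_testBit_eq fun i => ?_
    rw [Nat.testBit_or, Nat.testBit_two_pow]
    by_cases hi : c = i
    · subst hi; simp [h]
    · simp [hi]

/-! ### The merged order -/

/-- The numbers of clauses and of variables among the first `t` elements of the merged order. -/
def pos (g : ℕ → ℕ) : ℕ → ℕ × ℕ
  | 0 => (0, 0)
  | t + 1 => if (pos g t).2 < g (pos g t).1 then ((pos g t).1, (pos g t).2 + 1)
      else ((pos g t).1 + 1, (pos g t).2)

/-- Element `t` of the merged order is a variable. -/
def IsVar (g : ℕ → ℕ) (t : ℕ) : Prop := (pos g t).2 < g (pos g t).1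

instance (g : ℕ → ℕ) (t : ℕ) : Decidable (IsVar g t) :=
  inferInstanceAs (Decidable ((pos g t).2 < g (pos g t).1))

theorem pos_succ_var {g : ℕ → ℕ} {t : ℕ} (h : IsVar g t) :
    pos g (t + 1) = ((pos g t).1, (pos g t).2 + 1) := if_pos h

theorem pos_succ_clause {g : ℕ → ℕ} {t : ℕ} (h : ¬ IsVar g t) :
    pos g (t + 1) = ((pos g t).1 + 1, (pos g t).2) := if_neg h

theorem pos_add (g : ℕ → ℕ) (t : ℕ) : (pos g t).1 + (pos g t).2 = t := by
  induction t with
  | zero => rfl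
  | succ t ih =>
    by_cases h : IsVar g t
    · rw [pos_succ_var h]; simp only; omega
    · rw [pos_succ_clause h]; simp only; omega

/-- The gaps of `m` clauses, with the number `n` of variables as an additional last gap. -/
structure IsGapSeq (m n : ℕ) (g : ℕ → ℕ) : Prop where
  mono : ∀ i j, i ≤ j → j ≤ m → g i ≤ g j
  last : g m = n

section

variable {m n : ℕ} {g : ℕ → ℕ}

/-- The two gap inequalities locate every clause relative to the variables at the cut; the length
bounds apply the interval condition through them. -/
theorem pos_le (hg : IsGapSeq m n g) {t : ℕ} (ht : t ≤ m + n) : (pos g t).1 ≤ m ∧ (pos g t).2 ≤ n ∧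
    (∀ i < (pos g t).1, g i ≤ (pos g t).2) ∧ ∀ i, (pos g t).1 ≤ i → i ≤ m → (pos g t).2 ≤ g i := by
  induction t with
  | zero => simp [pos]
  | succ t ih =>
    obtain ⟨h1, h2, h3, h4⟩ := ih (by omega)
    have hadd := pos_add g t
    by_cases h : IsVar g t
    · rw [pos_succ_var h]
      have h' : (pos g t).2 < g (pos g t).1 := h
      have hn := hg.mono (pos g t).1 m h1 le_rfl
      rw [hg.last] at hn
      refine ⟨h1, by simp only; omega, fun i hi => (h3 i hi).trans (by simp), fun i hi hi' => ?_⟩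
      have := hg.mono _ i hi hi'
      have := lt_of_lt_of_le h' this
      exact this
    · rw [pos_succ_clause h]
      have h' : g (pos g t).1 ≤ (pos g t).2 := not_lt.1 h
      have hlt : (pos g t).1 < m := by
        -- If the clauses were used up, the extra gap `g m = n` would have forced a variable, as the
        -- order is not yet exhausted.
        rcases lt_or_eq_of_le h1 with h5 | h5
        · exact h5
        · rw [h5, hg.last] at h'; omega
      refine ⟨hlt, h2, fun i hi => ?_, fun i hi hi' => h4 i (by simp only at hi; omega) hi'⟩
      simp only at hi ⊢
      rcases Nat.lt_succ_iff_lt_or_eq.1 hi with h5 | rfl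
      · exact h3 i h5
      · exact h'

theorem pos_lt_of_clause (hg : IsGapSeq m n g)
    {t : ℕ} (ht : t < m + n) (h : ¬ IsVar g t) : (pos g t).1 < m := by
  have := (pos_le hg (t := t + 1) ht).1
  rw [pos_succ_clause h] at this
  exact this

theorem pos_lt_of_var (hg : IsGapSeq m n g) {t : ℕ} (ht : t < m + n) (h : IsVar g t) : (pos g t).2 < n := by
  have := (pos_le hg (t := t + 1) ht).2.1
  rw [pos_succ_var h] at this
  exact this

theorem pos_last (hg : IsGapSeq m n g) : pos g (m + n) = (m, n) := by
  have h := pos_le hg (t := m + n) le_rfl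
  have h' := pos_add g (m + n)
  ext <;> simp only <;> omega

end

/-! ### Clauses satisfied from the other side of a cut -/

section

variable (L : Bool → ℕ → ℕ → ℕ) (m n : ℕ) (g : ℕ → ℕ)

/-- The later clauses that are satisfied by the variables among the first `t` elements. -/
noncomputable def fwd (t : ℕ) (τ : ℕ → Bool) : ℕ :=
  code (pos g t).1 m fun i => ∃ j < (pos g t).2, L (τ j) i j ≠ 0

/-- The clauses among the first `t` elements that are satisfied by later variables. -/
noncomputable def bwd (t : ℕ) (τ : ℕ → Bool) : ℕ :=
  code 0 (pos g t).1 fun i => ∃ j, (pos g t).2 ≤ j ∧ j < n ∧ L (τ j) i j ≠ 0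

/-- The later clauses that are satisfied by element `t`, with value `b`; the clause itself, if `t` is a
clause. -/
noncomputable def maskF (b : Bool) (t : ℕ) : ℕ :=
  if IsVar g t then code (pos g t).1 m fun i => L b i (pos g t).2 ≠ 0 else 2 ^ (pos g t).1

/-- The earlier clauses that are satisfied by element `t`, with value `b`; the clause itself, if `t` is a
clause. -/
noncomputable def maskB (b : Bool) (t : ℕ) : ℕ :=
  if IsVar g t then code 0 (pos g t).1 fun i => L b i (pos g t).2 ≠ 0 else 2 ^ (pos g t).1

/-- The clause at position `t`, as a set. -/
def maskC (t : ℕ) : ℕ := if IsVar g t then 0 else 2 ^ (pos g t).1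

variable {L m n g}

theorem fwd_congr {t : ℕ} {τ τ' : ℕ → Bool} (h : ∀ j < (pos g t).2, τ j = τ' j) :
    fwd L m g t τ = fwd L m g t τ' := by
  refine code_eq_iff.2 fun i _ _ => ?_
  constructor
  · rintro ⟨j, hj, hL⟩; exact ⟨j, hj, h j hj ▸ hL⟩
  · rintro ⟨j, hj, hL⟩; exact ⟨j, hj, (h j hj).symm ▸ hL⟩

theorem bwd_congr {t : ℕ} {τ τ' : ℕ → Bool} (h : ∀ j, (pos g t).2 ≤ j → τ j = τ' j) :
    bwd L n g t τ = bwd L n g t τ' := by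
  refine code_eq_iff.2 fun i _ _ => ?_
  constructor
  · rintro ⟨j, hj, hn, hL⟩; exact ⟨j, hj, hn, h j hj ▸ hL⟩
  · rintro ⟨j, hj, hn, hL⟩; exact ⟨j, hj, hn, (h j hj).symm ▸ hL⟩

/-- Passing a variable adds the later clauses that it satisfies; passing a clause removes this
clause, which no longer lies behind the cut. -/
theorem fwd_succ (t : ℕ) (τ : ℕ → Bool) :
    fwd L m g (t + 1) τ = image (maskF L m g (τ (pos g t).2) t) (maskC g t) (fwd L m g t τ) := by
  by_cases h : IsVar g t
  · refine Nat.eq_of_testBit_eq fun i => ?_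
    rw [Bool.eq_iff_iff]
    simp only [fwd, maskF, maskC, if_pos h, image_zero, Nat.testBit_or, Bool.or_eq_true, testBit_code,
      pos_succ_var h, Nat.exists_lt_succ_right, and_or_left]
  · refine Nat.eq_of_testBit_eq fun i => ?_
    rw [Bool.eq_iff_iff]
    simp only [fwd, maskF, maskC, if_neg h, testBit_image_pow, testBit_code, pos_succ_clause h,
      Nat.succ_le_iff, lt_iff_le_and_ne (a := (pos g t).1)]
    tauto

/-- Backward sets evolve from right to left: stepping back over a variable adds the earlier clauses
that it satisfies, stepping back over a clause removes it. -/
theorem bwd_eq (hg : IsGapSeq m n g) {t : ℕ} (ht : t < m + n) (τ : ℕ → Bool) :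
    bwd L n g t τ =
      image (maskB L g (τ (pos g t).2) t) (maskC g t) (bwd L n g (t + 1) τ) := by
  by_cases h : IsVar g t
  · have hn := pos_lt_of_var hg ht h
    refine Nat.eq_of_testBit_eq fun i => ?_
    rw [Bool.eq_iff_iff]
    simp only [bwd, maskB, maskC, if_pos h, image_zero, Nat.testBit_or, Bool.or_eq_true, testBit_code,
      pos_succ_var h, Nat.zero_le, true_and, ← and_or_left]
    refine and_congr_right fun _ => ⟨?_, ?_⟩
    · rintro ⟨j, h1, h2, h3⟩
      rcases Nat.eq_or_lt_of_le h1 with rfl | h4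
      · exact Or.inr h3
      · exact Or.inl ⟨j, h4, h2, h3⟩
    · rintro (⟨j, h1, h2, h3⟩ | h3)
      · exact ⟨j, by omega, h2, h3⟩
      · exact ⟨_, le_rfl, hn, h3⟩
  · refine Nat.eq_of_testBit_eq fun i => ?_
    rw [Bool.eq_iff_iff]
    simp only [bwd, maskB, maskC, if_neg h, testBit_image_pow, testBit_code, pos_succ_clause h,
      Nat.zero_le, true_and, Nat.lt_succ_iff, lt_iff_le_and_ne (b := (pos g t).1)]
    tauto

theorem fwd_zero (τ : ℕ → Bool) : fwd L m g 0 τ = 0 := by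
  refine Nat.eq_of_testBit_eq fun i => ?_
  rw [Bool.eq_iff_iff, fwd, testBit_code]
  simp [pos]

theorem bwd_last (hg : IsGapSeq m n g) (τ : ℕ → Bool) : bwd L n g (m + n) τ = 0 := by
  refine Nat.eq_of_testBit_eq fun i => ?_
  rw [Bool.eq_iff_iff, bwd, testBit_code, pos_last hg]
  simp only [Nat.zero_testBit, Bool.false_eq_true, iff_false]
  rintro ⟨-, -, j, h1, h2, -⟩
  omega

end

/-! ### Enumerating the sets of satisfied clauses -/

/-- Append `y` unless it is in the list. -/
def ins (l : List ℕ) (y : ℕ) : List ℕ := if y ∈ l then l else l ++ [y]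

theorem mem_ins {l : List ℕ} {y x : ℕ} : x ∈ ins l y ↔ x ∈ l ∨ x = y := by
  unfold ins
  split_ifs with h
  · constructor
    · exact Or.inl
    · rintro (h' | rfl) <;> assumption
  · simp

theorem nodup_ins {l : List ℕ} {y : ℕ} (hl : l.Nodup) : (ins l y).Nodup := by
  unfold ins
  split_ifs with h
  · exact hl
  · rw [List.nodup_append]
    refine ⟨hl, by simp, ?_⟩
    intro a ha b hb
    simp only [List.mem_singleton] at hb
    subst hb
    rintro rfl
    exact h ha

/-- The images of the members of `l` under two maps, without repetition. -/
def images (f f' : ℕ → ℕ) (l : List ℕ) : List ℕ :=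
  l.foldl (fun acc z => ins (ins acc (f z)) (f' z)) []

theorem images_append (f f' : ℕ → ℕ) (l : List ℕ) (z : ℕ) :
    images f f' (l ++ [z]) = ins (ins (images f f' l) (f z)) (f' z) := by
  simp [images]

theorem mem_images {f f' : ℕ → ℕ} {l : List ℕ} {y : ℕ} :
    y ∈ images f f' l ↔ ∃ z ∈ l, y = f z ∨ y = f' z := by
  induction l using List.reverseRecOn with
  | nil => simp [images]
  | append_singleton l z ih =>
    rw [images_append, mem_ins, mem_ins, ih]
    simp only [List.mem_append, List.mem_singleton, or_and_right, exists_or, exists_eq_left, or_assoc]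

theorem nodup_images (f f' : ℕ → ℕ) (l : List ℕ) : (images f f' l).Nodup := by
  induction l using List.reverseRecOn with
  | nil => simp [images]
  | append_singleton l z ih => rw [images_append]; exact nodup_ins (nodup_ins ih)

/-- The sets reached after `u` steps from the empty set, with the given masks. -/
def reach (a a' b : ℕ → ℕ) : ℕ → List ℕ
  | 0 => [0]
  | u + 1 => images (image (a u) (b u)) (image (a' u) (b u)) (reach a a' b u)

theorem nodup_reach (a a' b : ℕ → ℕ) (u : ℕ) : (reach a a' b u).Nodup := by
  cases u with
  | zero => simp [reach]
  | succ u => exact nodup_images _ _ _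

section

variable (L : Bool → ℕ → ℕ → ℕ) (m n : ℕ) (g : ℕ → ℕ)

/-- All sets of later clauses that can be satisfied by the variables among the first `t` elements. -/
noncomputable def fwdList (t : ℕ) : List ℕ := reach (maskF L m g false) (maskF L m g true) (maskC g) t

/-- All sets of clauses that can be satisfied by variables behind them, across the cut before the last `u`
elements. -/
noncomputable def bwdList (u : ℕ) : List ℕ :=
  reach (fun u => maskB L g false (m + n - 1 - u)) (fun u => maskB L g true (m + n - 1 - u))
    (fun u => maskC g (m + n - 1 - u)) u

variable {L m n g}

/-- The next set depends on the present one and on the value of one variable that the present one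
does not involve. The two can be chosen independently, so every reachable set is realised. -/
theorem mem_fwdList (t y : ℕ) : y ∈ fwdList L m g t ↔ ∃ τ, fwd L m g t τ = y := by
  induction t generalizing y with
  | zero => simp [fwdList, reach, fwd_zero, eq_comm]
  | succ t ih =>
    rw [fwdList, reach, mem_images]
    change (∃ z ∈ fwdList L m g t, _) ↔ _
    simp only [ih]
    constructor
    · rintro ⟨_, ⟨τ, rfl⟩, h⟩
      -- This also covers a clause: the updated variable then lies behind the cut, and the mask does
      -- not depend on `b`.
      have : ∀ b, fwd L m g (t + 1) (Function.update τ (pos g t).2 b) =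
          image (maskF L m g b t) (maskC g t) (fwd L m g t τ) := by
        intro b
        rw [fwd_succ, Function.update_self]
        congr 1
        exact fwd_congr fun j hj => Function.update_of_ne (by omega) _ _
      rcases h with rfl | rfl
      · exact ⟨_, this false⟩
      · exact ⟨_, this true⟩
    · rintro ⟨τ, rfl⟩
      refine ⟨_, ⟨τ, rfl⟩, ?_⟩
      rw [fwd_succ]
      cases τ (pos g t).2 <;> simp

theorem mem_bwdList (hg : IsGapSeq m n g) {u : ℕ} (hu : u ≤ m + n) (y : ℕ) :
    y ∈ bwdList L m n g u ↔ ∃ τ, bwd L n g (m + n - u) τ = y := by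
  induction u generalizing y with
  | zero => simp [bwdList, reach, bwd_last hg, eq_comm]
  | succ u ih =>
    rw [bwdList, reach, mem_images]
    change (∃ z ∈ bwdList L m n g u, _) ↔ _
    simp only [ih (by omega)]
    obtain ⟨t, ht⟩ : ∃ t, m + n - (u + 1) = t := ⟨_, rfl⟩
    have ht' : m + n - u = t + 1 := by omega
    have ht'' : m + n - 1 - u = t := by omega
    rw [ht, ht', ht'']
    constructor
    · rintro ⟨_, ⟨τ, rfl⟩, h⟩
      -- Here the clause case is separate: at a clause, variable `(pos g t).2` still lies behind the
      -- next cut, so updating it could change the set that is already realised.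
      by_cases hv : IsVar g t
      · have : ∀ b, bwd L n g t (Function.update τ (pos g t).2 b) =
            image (maskB L g b t) (maskC g t) (bwd L n g (t + 1) τ) := by
          intro b
          rw [bwd_eq hg (by omega), Function.update_self]
          congr 1
          refine bwd_congr fun j hj => Function.update_of_ne ?_ _ _
          rw [pos_succ_var hv] at hj
          simp only at hj
          omega
        rcases h with rfl | rfl
        · exact ⟨_, this false⟩
        · exact ⟨_, this true⟩
      · refine ⟨τ, ?_⟩
        rw [bwd_eq hg (by omega)]
        simp only [maskB, if_neg hv, or_self] at h ⊢
        exact h.symm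
    · rintro ⟨τ, rfl⟩
      refine ⟨_, ⟨τ, rfl⟩, ?_⟩
      rw [bwd_eq hg (by omega)]
      cases τ (pos g t).2 <;> simp

/-! ### The number of sets of satisfied clauses -/

open Classical in
/-- If every clause `i` has at most `k` exceptional variables, so that no clause below `i` has other variables
than `i` and these, then few sets of clauses can be satisfied. -/
theorem length_le_of_bad (L : Bool → ℕ → ℕ → ℕ) (lo hi k : ℕ) (J : ℕ → Prop) (r : ℕ → ℕ)
    (bad : ℕ → Finset ℕ) (hbad : ∀ i, lo ≤ i → i < hi → (bad i).card ≤ k)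
    (h : ∀ i i', lo ≤ i → i < hi → lo ≤ i' → i' < hi → r i' ≤ r i → ∀ j, J j → ∀ b, L b i' j ≠ 0 →
      (∃ b', L b' i j ≠ 0) ∨ j ∈ bad i)
    (l : List ℕ) (hl : l.Nodup)
    (hmem : ∀ y ∈ l, ∃ τ : ℕ → Bool, code lo hi (fun i => ∃ j, J j ∧ L (τ j) i j ≠ 0) = y) :
    l.length ≤ 1 + (hi - lo) * 2 ^ k := by
  choose! τ hτ using hmem
  let U : ℕ → Finset ℕ := fun y =>
    (Finset.Ico lo hi).filter fun i => ¬ ∃ j, J j ∧ L (τ y j) i j ≠ 0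
  have hmax : ∀ y, (U y).Nonempty → ∃ i ∈ U y, ∀ i' ∈ U y, r i' ≤ r i :=
    fun y hy => Finset.exists_max_image _ _ hy
  choose! top htop htop' using hmax
  -- A set is encoded by its unsatisfied clause of greatest rank together with the values of the
  -- chosen assignment on the exceptional variables of that clause. If all clauses are satisfied,
  -- the marker `hi` is used, which is no clause in the range.
  let f : ℕ → ℕ × Finset ℕ := fun y =>
    if (U y).Nonempty then (top y, (bad (top y)).filter fun j => τ y j = true) else (hi, ∅)
  let S : Finset (ℕ × Finset ℕ) := insert (hi, ∅)
    ((Finset.Ico lo hi).biUnion fun i => (bad i).powerset.image fun s => (i, s))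
  have hS : S.card ≤ 1 + (hi - lo) * 2 ^ k := by
    refine (Finset.card_insert_le _ _).trans ?_
    rw [add_comm]
    refine Nat.add_le_add_left (Finset.card_biUnion_le.trans ?_) 1
    calc _ ≤ ∑ i ∈ Finset.Ico lo hi, 2 ^ k := Finset.sum_le_sum fun i hi' => by
            refine Finset.card_image_le.trans ?_
            rw [Finset.card_powerset]
            rw [Finset.mem_Ico] at hi'
            exact Nat.pow_le_pow_right (by norm_num) (hbad i hi'.1 hi'.2)
      _ = _ := by simp
  have hU : ∀ y i, i ∈ U y ↔ (lo ≤ i ∧ i < hi) ∧ ¬ ∃ j, J j ∧ L (τ y j) i j ≠ 0 := by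
    intro y i; simp only [U, Finset.mem_filter, Finset.mem_Ico]
  have hUeq : ∀ y ∈ l, ∀ y' ∈ l, U y = U y' → y = y' := by
    intro y hy y' hy' he
    rw [← hτ y hy, ← hτ y' hy']
    refine code_eq_iff.2 fun i h1 h2 => ?_
    have := hU y i
    rw [he, hU y' i, and_congr_right_iff] at this
    exact (not_iff_not.1 (this ⟨h1, h2⟩)).symm
  rw [← List.toFinset_card_of_nodup hl]
  refine le_trans (Finset.card_le_card_of_injOn f ?_ ?_) hS
  · intro y _
    simp only [f, S, Finset.coe_insert, Set.mem_insert_iff, Finset.mem_coe, Finset.mem_biUnion,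
      Finset.mem_image, Finset.mem_powerset]
    split_ifs with hne
    · exact Or.inr ⟨top y, (Finset.mem_filter.1 (htop y hne)).1, _, Finset.filter_subset _ _, rfl⟩
    · exact Or.inl rfl
  · intro y hy y' hy' he
    simp only [Finset.mem_coe, List.mem_toFinset] at hy hy'
    have hlt : ∀ y, (U y).Nonempty → top y < hi := fun y hne => ((hU _ _).1 (htop y hne)).1.2
    apply hUeq y hy y' hy'
    by_cases hne : (U y).Nonempty <;> by_cases hne' : (U y').Nonempty
    · simp only [f, if_pos hne, if_pos hne', Prod.mk.injEq] at he
      obtain ⟨h1, h2⟩ := he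
      have hi1 := (hU _ _).1 (htop y hne)
      have hi2 := (hU _ _).1 (htop y' hne')
      rw [← h1] at hi2 h2
      set i := top y
      -- The common top clause `i` is unsatisfied under both assignments, so all its literals are
      -- false under both, which forces equal values on its variables. On the exceptional variables
      -- the encoding gives equality.
      have agree : ∀ j, J j → ((∃ b', L b' i j ≠ 0) ∨ j ∈ bad i) → τ y j = τ y' j := by
        rintro j hj (⟨b', hb'⟩ | hb)
        · have e1 : τ y j = !b' := by
            by_contra hb
            exact hi1.2 ⟨j, hj, by rw [Bool.eq_not.not, not_not] at hb; rwa [hb]⟩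
          have e2 : τ y' j = !b' := by
            by_contra hb
            exact hi2.2 ⟨j, hj, by rw [Bool.eq_not.not, not_not] at hb; rwa [hb]⟩
          rw [e1, e2]
        · have := Finset.ext_iff.1 h2 j
          simp only [Finset.mem_filter, hb, true_and] at this
          exact Bool.eq_iff_iff.2 this
      ext i'
      -- Clauses ranked at most as high as `i` use only variables on which the assignments agree;
      -- the clauses ranked higher are satisfied by both, because `i` is a top clause for both.
      by_cases hr : r i' ≤ r i
      · rw [hU, hU]
        refine and_congr_right fun hi' => not_congr (exists_congr fun j => and_congr_right fun hj => ?_)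
        by_cases hb : ∃ b, L b i' j ≠ 0
        · obtain ⟨b, hb⟩ := hb
          rw [agree j hj (h i i' hi1.1.1 hi1.1.2 hi'.1 hi'.2 hr j hj b hb)]
        · push Not at hb
          simp [hb]
      · constructor
        · intro hi'; exact absurd (htop' y hne _ hi') hr
        · intro hi'
          have := htop' y' hne' _ hi'
          rw [← h1] at this
          exact absurd this hr
    · simp only [f, if_pos hne, if_neg hne', Prod.mk.injEq] at he
      have := hlt y hne
      omega
    · simp only [f, if_neg hne, if_pos hne', Prod.mk.injEq] at he
      have := hlt y' hne'
      omega
    · rw [Finset.not_nonempty_iff_eq_empty] at hne hne'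
      rw [hne, hne']

/-- The variables that violate the interval condition for clause `i`. -/
def badSet (A : ℕ → ℕ → ℕ) (n i g : ℕ) : Finset ℕ :=
  (Finset.range n).filter fun j => A i j = 0 ∧
    ((j < g ∧ ∃ j' < j, A i j' ≠ 0) ∨ (g ≤ j ∧ ∃ i' < i, A i' j ≠ 0))

theorem sum_eq_zero_or (L : Bool → ℕ → ℕ → ℕ) (i j : ℕ) :
    (∃ b, L b i j ≠ 0) ∨ L false i j + L true i j = 0 := by
  by_cases h0 : L false i j = 0
  · by_cases h1 : L true i j = 0
    · exact Or.inr (by omega)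
    · exact Or.inl ⟨_, h1⟩
  · exact Or.inl ⟨_, h0⟩

theorem sum_ne_zero_of {L : Bool → ℕ → ℕ → ℕ} {b : Bool} {i j : ℕ} (h : L b i j ≠ 0) :
    L false i j + L true i j ≠ 0 := by
  cases b <;> omega

/-- Clauses are ranked by how early their first variable comes: `span i` consists of the positions
before the cut from that variable on. A variable before the cut that appears in a clause starting no
earlier than `i`, but not in `i`, lies between a variable of `i` and clause `i`, so it violates
condition (1). -/
theorem length_fwdList_le (hg : IsGapSeq m n g) {k : ℕ}
    (hk : ∀ i < m, cost (fun i j => L false i j + L true i j) n i (g i) ≤ k) {t : ℕ}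
    (ht : t ≤ m + n) : (fwdList L m g t).length ≤ (m + 1) * 2 ^ k := by
  classical
  obtain ⟨h1, h2, h3, h4⟩ := pos_le hg ht
  set c := (pos g t).1
  set p := (pos g t).2
  let span : ℕ → Finset ℕ := fun i => (Finset.range p).filter fun j => ∃ j' ≤ j, ∃ b, L b i j' ≠ 0
  have := length_le_of_bad L c m k (fun j => j < p) (fun i => (span i).card)
    (fun i => badSet (fun i j => L false i j + L true i j) n i (g i))
    (fun i _ hi => hk i hi) ?_ (fwdList L m g t) (nodup_reach _ _ _ _)
    (fun y hy => (mem_fwdList t y).1 hy)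
  · refine this.trans ?_
    have e1 : 1 ≤ 2 ^ k := Nat.one_le_two_pow
    have e2 : (m - c) * 2 ^ k ≤ m * 2 ^ k := Nat.mul_le_mul_right _ (by omega)
    rw [add_mul, one_mul]
    omega
  · intro i i' hi1 hi2 hi'1 hi'2 hr j hj b hb
    rcases sum_eq_zero_or L i j with h5 | h5
    · exact Or.inl h5
    right
    simp only [badSet, Finset.mem_filter, Finset.mem_range, h5, true_and]
    have hgi := h4 i hi1 (by omega)
    refine ⟨by omega, Or.inl ⟨by omega, ?_⟩⟩
    have hspan : j ∈ span i' := by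
      simp only [span, Finset.mem_filter, Finset.mem_range]
      exact ⟨hj, j, le_rfl, b, hb⟩
    -- Otherwise no variable of clause `i` occurs up to `j`, whereas clause `i'` has one at `j`;
    -- then `span i` is a proper part of `span i'`, against the ranking.
    have hmem : j ∈ span i := by
      by_contra hns
      have hsub : span i ⊂ span i' := by
        rw [Finset.ssubset_iff_of_subset]
        · exact ⟨j, hspan, hns⟩
        · intro x hx
          simp only [span, Finset.mem_filter, Finset.mem_range] at hx hns ⊢
          refine ⟨hx.1, j, ?_, b, hb⟩
          by_contra hxj
          obtain ⟨j', hj', hb'⟩ := hx.2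
          exact hns ⟨hj, j', by omega, hb'⟩
      exact absurd (Finset.card_lt_card hsub) (by omega)
    simp only [span, Finset.mem_filter, Finset.mem_range] at hmem
    obtain ⟨-, j', hj', b', hb'⟩ := hmem
    refine ⟨j', lt_of_le_of_ne hj' ?_, sum_ne_zero_of hb'⟩
    rintro rfl
    exact sum_ne_zero_of hb' h5

/-- Clauses are ranked by their position. A variable behind the cut that appears in an earlier
clause `i'` but not in `i` violates condition (2) for `i`, because clause `i` lies before the cut.
-/
theorem length_bwdList_le (hg : IsGapSeq m n g) {k : ℕ}
    (hk : ∀ i < m, cost (fun i j => L false i j + L true i j) n i (g i) ≤ k) {u : ℕ}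
    (hu : u ≤ m + n) : (bwdList L m n g u).length ≤ (m + 1) * 2 ^ k := by
  obtain ⟨h1, h2, h3, h4⟩ := pos_le hg (t := m + n - u) (by omega)
  set c := (pos g (m + n - u)).1 with hc
  set p := (pos g (m + n - u)).2 with hp
  have := length_le_of_bad L 0 c k (fun j => p ≤ j ∧ j < n) id
    (fun i => badSet (fun i j => L false i j + L true i j) n i (g i))
    (fun i _ hi => hk i (by omega)) ?_ (bwdList L m n g u) (nodup_reach _ _ _ _)
    (fun y hy => by
      obtain ⟨τ, hτ⟩ := (mem_bwdList hg hu y).1 hy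
      refine ⟨τ, ?_⟩
      rw [← hτ, bwd]
      simp only [and_assoc, ← hc, ← hp])
  · refine this.trans ?_
    have e1 : 1 ≤ 2 ^ k := Nat.one_le_two_pow
    have e2 : (c - 0) * 2 ^ k ≤ m * 2 ^ k := Nat.mul_le_mul_right _ (by omega)
    rw [add_mul, one_mul]
    omega
  · intro i i' hi1 hi2 hi'1 hi'2 hr j hj b hb
    rcases sum_eq_zero_or L i j with h5 | h5
    · exact Or.inl h5
    right
    simp only [badSet, Finset.mem_filter, Finset.mem_range, h5, true_and]
    have hgi := h3 i hi2
    refine ⟨by omega, Or.inr ⟨by omega, i', lt_of_le_of_ne hr ?_, sum_ne_zero_of hb⟩⟩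
    rintro rfl
    exact sum_ne_zero_of hb h5

end

end KInterval

namespace KInterval

/-! ### The table of the dynamic program -/

/-- The natural numbers with maximum as addition. -/
@[ext] structure MaxNat where
  /-- the number -/
  val : ℕ

namespace MaxNat

instance : Add MaxNat := ⟨fun a b => ⟨max a.val b.val⟩⟩

instance : Zero MaxNat := ⟨⟨0⟩⟩

@[simp] theorem val_add (a b : MaxNat) : (a + b).val = max a.val b.val := rfl

@[simp] theorem val_zero : (0 : MaxNat).val = 0 := rfl

instance : AddCommMonoid MaxNat where
  add_assoc a b c := by ext; simp [max_assoc]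
  zero_add a := by ext; simp
  add_zero a := by ext; simp
  add_comm a b := by ext; simp [max_comm]
  nsmul := nsmulRec

theorem val_sum_le_iff {ι : Type*} (s : Finset ι) (f : ι → MaxNat) (q : ℕ) :
    (∑ i ∈ s, f i).val ≤ q ↔ ∀ i ∈ s, (f i).val ≤ q := by
  classical
  induction s using Finset.induction_on with
  | empty => simp
  | insert a s ha ih => rw [Finset.sum_insert ha, val_add, max_le_iff, ih, Finset.forall_mem_insert]

theorem exists_val_sum {ι : Type*} (s : Finset ι) (f : ι → MaxNat) (hs : s.Nonempty) :
    ∃ i ∈ s, (∑ i ∈ s, f i).val = (f i).val := by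
  obtain ⟨i, hi, hmax⟩ := Finset.exists_max_image s (fun i => (f i).val) hs
  refine ⟨i, hi, le_antisymm ((val_sum_le_iff _ _ _).2 hmax) ?_⟩
  exact (val_sum_le_iff s f _).1 le_rfl i hi

end MaxNat

/-- A number of models and the best value of an assignment. -/
abbrev Val := ℕ × MaxNat

/-- The effect on a value of one more element, of weight `w` if it is satisfied: unsatisfied, it leaves no
models. -/
def act (s : Prop) [Decidable s] (w : ℕ) : Val →+ Val where
  -- The best value 0 stands for the absence of any assignment. It must not receive the weight, or
  -- the map would not preserve zero.
  toFun v := (if s then v.1 else 0, ⟨if v.2.val = 0 then 0 else v.2.val + if s then w else 0⟩)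
  map_zero' := by ext <;> simp
  map_add' x y := by
    ext
    · by_cases h : s <;> simp [h]
    · by_cases hx : x.2.val = 0 <;> by_cases hy : y.2.val = 0 <;>
        simp [hx, hy, max_add_add_right]

/-- Update the table for the pair `(y, z)` and one value of the new element. -/
def triple (off off' a a' b w y z : ℕ) (G : ℕ → Val) : ℕ → Val :=
  Function.update G (off' + image a b y + z)
    (G (off' + image a b y + z) +
      act (y ||| b = y ∨ z ||| b = z) w (G (off + y + image a' b z)))

/-- The masks and weights of an element, for the two values. -/
structure Elt where
  /-- masks of later clauses -/
  fwd : Bool → ℕ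
  /-- masks of earlier clauses -/
  bwd : Bool → ℕ
  /-- the element itself, if it is a clause -/
  self : ℕ
  /-- weights -/
  weight : Bool → ℕ

/-- Update the table for the pair `(z, z')`. -/
def pairStep (off off' : ℕ) (e : Elt) (z z' : ℕ) (G : ℕ → Val) : ℕ → Val :=
  let H := triple off off' (e.fwd false) (e.bwd false) e.self (e.weight false) z z' G
  if e.self = 0 then triple off off' (e.fwd true) (e.bwd true) e.self (e.weight true) z z' H else H

/-- Update the table for all pairs. -/
def sweep (off off' : ℕ) (e : Elt) (l l' : List ℕ) (G : ℕ → Val) : ℕ → Val :=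
  l.foldl (fun G z => l'.foldl (fun G z' => pairStep off off' e z z' G) G) G

/-- The steps read the very table that they change. An invariant `P` that pins down what is read
makes the contribution of each step known in advance, so the contributions simply add up. -/
theorem foldl_add_apply {α : Type*} (l : List α) (step : α → (ℕ → Val) → ℕ → Val)
    (v : α → ℕ → Val) (P : (ℕ → Val) → Prop)
    (h : ∀ x ∈ l, ∀ G, P G → P (step x G) ∧ ∀ a, step x G a = G a + v x a) (G : ℕ → Val) (hG : P G) :
    P (l.foldl (fun G x => step x G) G) ∧
      ∀ a, l.foldl (fun G x => step x G) G a = G a + (l.map fun x => v x a).sum := by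
  induction l generalizing G with
  | nil => simp [hG]
  | cons x l ih =>
    obtain ⟨h1, h2⟩ := h x (by simp) G hG
    obtain ⟨h3, h4⟩ := ih (fun y hy => h y (by simp [hy])) _ h1
    refine ⟨h3, fun a => ?_⟩
    rw [List.foldl_cons, h4, h2, List.map_cons, List.sum_cons, add_assoc]

/-- What `triple` adds at address `a`. -/
def contrib (off off' a a' b w : ℕ) (G : ℕ → Val) (z z' x : ℕ) : Val :=
  if off' + image a b z + z' = x then
    act (z ||| b = z ∨ z' ||| b = z') w (G (off + z + image a' b z')) else 0

/-- Reads lie below `off'` and writes at or above it; what is read can therefore be taken from the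
table `G0` before the sweep. -/
theorem triple_apply {off off' a a' b w z z' : ℕ} {G G0 : ℕ → Val}
    (hG : ∀ x < off', G x = G0 x) (hr : off + z + image a' b z' < off') :
    (∀ x < off', triple off off' a a' b w z z' G x = G0 x) ∧
      ∀ x, triple off off' a a' b w z z' G x = G x + contrib off off' a a' b w G0 z z' x := by
  constructor
  · intro x hx
    rw [triple, Function.update_of_ne (by omega), hG x hx]
  · intro x
    rw [triple, contrib, Function.update_apply, hG _ hr]
    by_cases h : x = off' + image a b z + z'
    · simp [h]
    · simp [h, Ne.symm h]

/-- What `pairStep` adds at address `a`. -/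
def pairContrib (off off' : ℕ) (e : Elt) (G : ℕ → Val) (z z' x : ℕ) : Val :=
  contrib off off' (e.fwd false) (e.bwd false) e.self (e.weight false) G z z' x +
    if e.self = 0 then contrib off off' (e.fwd true) (e.bwd true) e.self (e.weight true) G z z' x else 0

theorem pairStep_apply {off off' : ℕ} {e : Elt} {z z' : ℕ} {G G0 : ℕ → Val}
    (hG : ∀ x < off', G x = G0 x) (hr : ∀ b, off + z + image (e.bwd b) e.self z' < off') :
    (∀ x < off', pairStep off off' e z z' G x = G0 x) ∧
      ∀ x, pairStep off off' e z z' G x = G x + pairContrib off off' e G0 z z' x := by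
  have h1 := triple_apply (a := e.fwd false) (w := e.weight false) hG (hr false)
  unfold pairStep pairContrib
  by_cases h : e.self = 0
  · have h2 := triple_apply (a := e.fwd true) (w := e.weight true) h1.1 (hr true)
    simp only [if_pos h]
    exact ⟨h2.1, fun x => by rw [h2.2, h1.2, add_assoc]⟩
  · simp only [if_neg h, add_zero]
    exact h1

theorem sweep_apply {off off' : ℕ} {e : Elt} {l l' : List ℕ} (hl : l.Nodup) (hl' : l'.Nodup)
    {G : ℕ → Val} (hr : ∀ z ∈ l, ∀ z' ∈ l', ∀ b, off + z + image (e.bwd b) e.self z' < off') (x : ℕ) :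
    sweep off off' e l l' G x =
      G x + ∑ z ∈ l.toFinset, ∑ z' ∈ l'.toFinset, pairContrib off off' e G z z' x := by
  have hin : ∀ z ∈ l, ∀ H : ℕ → Val, (∀ x < off', H x = G x) →
      (∀ x < off', l'.foldl (fun G z' => pairStep off off' e z z' G) H x = G x) ∧
      ∀ x, l'.foldl (fun G z' => pairStep off off' e z z' G) H x =
        H x + (l'.map fun z' => pairContrib off off' e G z z' x).sum := fun z hz H hH =>
    foldl_add_apply l' (fun z' G => pairStep off off' e z z' G)
      (fun z' x => pairContrib off off' e G z z' x) (fun H => ∀ x < off', H x = G x)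
      (fun z' hz' K hK => pairStep_apply hK (hr z hz z' hz')) H hH
  have hout := foldl_add_apply l
    (fun z G => l'.foldl (fun G z' => pairStep off off' e z z' G) G)
    (fun z x => (l'.map fun z' => pairContrib off off' e G z z' x).sum)
    (fun H => ∀ x < off', H x = G x) hin G fun _ _ => rfl
  rw [sweep, hout.2, List.sum_toFinset _ hl]
  simp only [List.sum_toFinset _ hl']

section

variable (L : Bool → ℕ → ℕ → ℕ) (m n : ℕ) (g : ℕ → ℕ)

/-- The weight of element `t` with value `b`. -/
def weight (b : Bool) (t : ℕ) : ℕ :=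
  if IsVar g t then (if b then 2 ^ (pos g t).2 else 0) else 2 ^ n

/-- The masks and weights of element `t`. -/
noncomputable def elt (t : ℕ) : Elt :=
  ⟨fun b => maskF L m g b t, fun b => maskB L g b t, maskC g t, fun b => weight n g b t⟩

/-- The table after `t` elements; its entries for these start at `t * 2 ^ m`. -/
noncomputable def table : ℕ → ℕ → Val
  | 0 => Function.update 0 0 (1, ⟨1⟩)
  | t + 1 => sweep (t * 2 ^ m) ((t + 1) * 2 ^ m) (elt L m n g t) (fwdList L m g t)
      (bwdList L m n g (m + n - 1 - t)) (table t)

/-- Clause `i` is satisfied by `τ` on the variables among the first `t` elements or belongs to `z`. -/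
def SatBy (t τ z i : ℕ) : Prop := (∃ j < (pos g t).2, L (τ.testBit j) i j ≠ 0) ∨ z.testBit i = true

open Classical in
/-- The value of the assignment `τ` to the variables among the first `t` elements if the clauses in `z` are
satisfied otherwise. -/
noncomputable def value (t τ z : ℕ) : Val :=
  (if ∀ i < (pos g t).1, SatBy L g t τ z i then 1 else 0,
    ⟨1 + τ + 2 ^ n * ((Finset.range (pos g t).1).filter (SatBy L g t τ z)).card⟩)

variable {L m n g}

theorem act_value (s : Prop) [Decidable s] (w t τ z : ℕ) :
    act s w (value L n g t τ z) = (if s then (value L n g t τ z).1 else 0,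
      ⟨(value L n g t τ z).2.val + if s then w else 0⟩) := by
  change (_, MaxNat.mk (if _ then _ else _)) = _
  have hne : (value L n g t τ z).2.val ≠ 0 := by simp [value]
  rw [if_neg hne]

theorem testBit_ext {τ j : ℕ} (hτ : τ < 2 ^ j) (b : Bool) :
    ((if b then 2 ^ j + τ else τ).testBit j = b) ∧
      ∀ j' < j, (if b then 2 ^ j + τ else τ).testBit j' = τ.testBit j' := by
  cases b
  · simp [Nat.testBit_lt_two_pow hτ]
  · simp only [if_true]
    refine ⟨by rw [Nat.testBit_two_pow_add_eq, Nat.testBit_lt_two_pow hτ]; rfl, fun j' hj' => ?_⟩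
    rw [Nat.testBit_two_pow_add_gt hj']

/-- A clause satisfied by the newest variable can be credited to the promised set instead: this
moves the promise back by one cut. The weight records the new bit of `τ`. -/
theorem value_succ_var {t : ℕ} (h : IsVar g t) {τ : ℕ} (hτ : τ < 2 ^ (pos g t).2) (b : Bool)
    (s : Prop) [Decidable s] (hs : s) (z : ℕ) :
    value L n g (t + 1) (if b then 2 ^ (pos g t).2 + τ else τ) z =
      act s (weight n g b t) (value L n g t τ (image (maskB L g b t) (maskC g t) z)) := by
  classical
  obtain ⟨e1, e2⟩ := testBit_ext hτ b
  have hsat : ∀ i < (pos g t).1,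
      (SatBy L g (t + 1) (if b then 2 ^ (pos g t).2 + τ else τ) z i ↔
        SatBy L g t τ (image (maskB L g b t) (maskC g t) z) i) := by
    intro i hi
    simp only [SatBy, pos_succ_var h, Nat.exists_lt_succ_right, maskB, maskC, if_pos h, image_zero,
      Nat.testBit_or, Bool.or_eq_true, testBit_code, e1, hi, Nat.zero_le, true_and]
    have : (∃ j < (pos g t).2, L ((if b then 2 ^ (pos g t).2 + τ else τ).testBit j) i j ≠ 0) ↔
        ∃ j < (pos g t).2, L (τ.testBit j) i j ≠ 0 :=
      exists_congr fun j => and_congr_right fun hj => by rw [e2 j hj]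
    rw [this, or_assoc, or_comm (a := L b i (pos g t).2 ≠ 0)]
  rw [act_value]
  simp only [if_pos hs, value, weight, if_pos h]
  rw [pos_succ_var h]
  refine Prod.ext ?_ ?_
  · simp only
    congr 1
    exact propext (forall_congr' fun i => imp_congr_right fun hi => hsat i hi)
  · simp only [MaxNat.mk.injEq]
    rw [Finset.filter_congr fun i hi => hsat i (Finset.mem_range.1 hi)]
    cases b <;> simp
    ring

/-- The new clause is satisfied either by earlier variables, which its membership in the forward set
shows, or by promise. For the clauses before it, deleting it from the promise changes nothing. -/
theorem value_succ_clause {t : ℕ} (h : ¬ IsVar g t) (hm : (pos g t).1 < m) (τ z : ℕ) (b : Bool)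
    (s : Prop) [Decidable s]
    (hs : s ↔ (fwd L m g t τ.testBit).testBit (pos g t).1 = true ∨ z.testBit (pos g t).1 = true) :
    value L n g (t + 1) τ z =
      act s (weight n g b t) (value L n g t τ (image (maskB L g b t) (maskC g t) z)) := by
  classical
  have hs' : SatBy L g (t + 1) τ z (pos g t).1 ↔ s := by
    rw [hs, SatBy, pos_succ_clause h, fwd, testBit_code]
    simp [hm]
  have hsat : ∀ i < (pos g t).1, (SatBy L g (t + 1) τ z i ↔
      SatBy L g t τ (image (maskB L g b t) (maskC g t) z) i) := by
    intro i hi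
    simp only [SatBy, pos_succ_clause h, maskB, maskC, if_neg h, testBit_image_pow]
    simp [hi.ne]
  rw [act_value]
  simp only [value, weight, if_neg h]
  rw [pos_succ_clause h]
  refine Prod.ext ?_ ?_
  · have key : (∀ i < (pos g t).1, SatBy L g (t + 1) τ z i) ↔ (∀ i < (pos g t).1,
        SatBy L g t τ (image (maskB L g b t) (maskC g t) z) i) :=
      forall_congr' fun i => imp_congr_right fun hi => hsat i hi
    simp only [Nat.forall_lt_succ_right, hs', key]
    by_cases hh : s
    · simp only [hh, and_true, if_true]
    · simp only [hh, and_false, if_false]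
  · simp only [MaxNat.mk.injEq]
    rw [Finset.range_add_one, Finset.filter_insert,
      Finset.filter_congr fun i hi => hsat i (Finset.mem_range.1 hi)]
    by_cases h : s
    · rw [if_pos (hs'.2 h), Finset.card_insert_of_notMem (by simp), if_pos h]
      ring
    · rw [if_neg (fun h' => h (hs'.1 h')), if_neg h]
      ring

/-- The sum of the values of the assignments to the variables among the first `t` elements that satisfy
exactly the later clauses in `y`. -/
noncomputable def total (L : Bool → ℕ → ℕ → ℕ) (m n : ℕ) (g : ℕ → ℕ) (t y z : ℕ) : Val :=
  ∑ τ ∈ Finset.range (2 ^ (pos g t).2), if fwd L m g t τ.testBit = y then value L n g t τ z else 0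

/-- The numbers below `2 ^ (j + 1)` are those below `2 ^ j`, without and with the additional bit
`j`; this bit is the value of the new variable. -/
theorem total_succ_var {t : ℕ} (h : IsVar g t) (y z : ℕ) :
    total L m n g (t + 1) y z = ∑ b : Bool, ∑ τ ∈ Finset.range (2 ^ (pos g t).2),
      if image (maskF L m g b t) (maskC g t) (fwd L m g t τ.testBit) = y then
        act (fwd L m g t τ.testBit ||| maskC g t = fwd L m g t τ.testBit ∨ z ||| maskC g t = z)
          (weight n g b t) (value L n g t τ (image (maskB L g b t) (maskC g t) z)) else 0 := by
  have hf : ∀ b, ∀ τ < 2 ^ (pos g t).2,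
      fwd L m g (t + 1) (if b then 2 ^ (pos g t).2 + τ else τ).testBit =
        image (maskF L m g b t) (maskC g t) (fwd L m g t τ.testBit) := by
    intro b τ hτ
    obtain ⟨e1, e2⟩ := testBit_ext hτ b
    rw [fwd_succ, e1, fwd_congr e2]
  have hv : ∀ b, ∀ τ < 2 ^ (pos g t).2,
      value L n g (t + 1) (if b then 2 ^ (pos g t).2 + τ else τ) z =
        act (fwd L m g t τ.testBit ||| maskC g t = fwd L m g t τ.testBit ∨ z ||| maskC g t = z)
          (weight n g b t) (value L n g t τ (image (maskB L g b t) (maskC g t) z)) :=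
    fun b τ hτ => value_succ_var h hτ b _ (Or.inl (by simp [maskC, if_pos h])) z
  rw [total, pos_succ_var h, Fintype.sum_bool]
  simp only
  rw [pow_succ, mul_two, Finset.sum_range_add]
  refine Eq.trans ?_ (add_comm _ _)
  congr 1
  · refine Finset.sum_congr rfl fun τ hτ => ?_
    rw [← hf false τ (Finset.mem_range.1 hτ), ← hv false τ (Finset.mem_range.1 hτ)]
    simp
  · refine Finset.sum_congr rfl fun τ hτ => ?_
    rw [← hf true τ (Finset.mem_range.1 hτ), ← hv true τ (Finset.mem_range.1 hτ)]
    simp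

theorem total_succ_clause {t : ℕ} (h : ¬ IsVar g t) (hm : (pos g t).1 < m) (y z : ℕ) (b : Bool) :
    total L m n g (t + 1) y z = ∑ τ ∈ Finset.range (2 ^ (pos g t).2),
      if image (maskF L m g b t) (maskC g t) (fwd L m g t τ.testBit) = y then
        act (fwd L m g t τ.testBit ||| maskC g t = fwd L m g t τ.testBit ∨ z ||| maskC g t = z)
          (weight n g b t) (value L n g t τ (image (maskB L g b t) (maskC g t) z)) else 0 := by
  rw [total, pos_succ_clause h]
  refine Finset.sum_congr rfl fun τ _ => ?_
  rw [fwd_succ, value_succ_clause h hm τ z b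
    (fwd L m g t τ.testBit ||| maskC g t = fwd L m g t τ.testBit ∨ z ||| maskC g t = z)
    (by rw [maskC, if_neg h, or_two_pow_eq_iff, or_two_pow_eq_iff])]
  simp only [maskF, if_neg h]

theorem fwd_lt (t : ℕ) (τ : ℕ → Bool) : fwd L m g t τ < 2 ^ m := code_lt _ _ _

theorem bwd_lt (t : ℕ) (τ : ℕ → Bool) : bwd L n g t τ < 2 ^ (pos g t).1 := code_lt _ _ _

/-- Both the forward set and `2 ^ m` are multiples of `2 ^ c`, where `c` is the number of clauses
before the cut, so a remainder below `2 ^ c` still fits in between. -/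
theorem fwd_add_lt (hg : IsGapSeq m n g)
    {t : ℕ} (ht : t ≤ m + n) (τ : ℕ → Bool) {z : ℕ} (hz : z < 2 ^ (pos g t).1) :
    fwd L m g t τ + z < 2 ^ m := by
  have h1 : fwd L m g t τ % 2 ^ (pos g t).1 = 0 := code_mod _ _ _
  have h2 := fwd_lt (L := L) (m := m) (g := g) t τ
  have hc := (pos_le hg ht).1
  obtain ⟨q, hq⟩ := Nat.dvd_of_mod_eq_zero h1
  obtain ⟨r, hr⟩ := Nat.pow_dvd_pow 2 hc
  rw [hq, hr] at h2 ⊢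
  have h3 : q + 1 ≤ r := Nat.lt_of_mul_lt_mul_left h2
  calc _ < 2 ^ (pos g t).1 * (q + 1) := by rw [mul_add, mul_one]; omega
    _ ≤ _ := Nat.mul_le_mul_left _ h3

theorem fwd_add_inj {t : ℕ} {τ τ' : ℕ → Bool} {z z' : ℕ} (hz : z < 2 ^ (pos g t).1)
    (hz' : z' < 2 ^ (pos g t).1) :
    fwd L m g t τ + z = fwd L m g t τ' + z' ↔ fwd L m g t τ = fwd L m g t τ' ∧ z = z' := by
  refine ⟨fun h => ?_, fun h => by rw [h.1, h.2]⟩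
  have h1 : fwd L m g t τ % 2 ^ (pos g t).1 = 0 := code_mod _ _ _
  have h2 : fwd L m g t τ' % 2 ^ (pos g t).1 = 0 := code_mod _ _ _
  have h3 := congrArg (· % 2 ^ (pos g t).1) h
  simp only [Nat.add_mod, h1, h2, zero_add, Nat.mod_eq_of_lt hz,
    Nat.mod_eq_of_lt hz'] at h3
  omega

theorem image_mem_fwdList {t z : ℕ} (hz : z ∈ fwdList L m g t) (b : Bool) :
    image (maskF L m g b t) (maskC g t) z ∈ fwdList L m g (t + 1) := by
  rw [fwdList, reach, mem_images]
  exact ⟨z, hz, by cases b <;> simp⟩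

theorem image_mem_bwdList {t z : ℕ} (ht : t < m + n) (hz : z ∈ bwdList L m n g (m + n - 1 - t))
    (b : Bool) :
    image (maskB L g b t) (maskC g t) z ∈ bwdList L m n g (m + n - t) := by
  rw [show m + n - t = m + n - 1 - t + 1 by omega, bwdList, reach, mem_images]
  rw [show m + n - 1 - (m + n - 1 - t) = t by omega]
  exact ⟨z, hz, by cases b <;> simp⟩

theorem lt_of_mem_bwdList (hg : IsGapSeq m n g)
    {t z : ℕ} (ht : t ≤ m + n) (hz : z ∈ bwdList L m n g (m + n - t)) :
    z < 2 ^ (pos g t).1 := by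
  rw [mem_bwdList hg (by omega), show m + n - (m + n - t) = t by omega] at hz
  obtain ⟨τ, rfl⟩ := hz
  exact bwd_lt _ _

/-- Grouping the assignments by their forward set and then summing over the sets loses nothing;
additivity of `F z` lets a transition act on a whole group at once. -/
theorem sum_fiber {l : List ℕ} {s : Finset ℕ} (f : ℕ → ℕ) (hf : ∀ τ ∈ s, f τ ∈ l)
    (c : ℕ → Prop) [DecidablePred c] (F : ℕ → Val →+ Val) (v : ℕ → Val) :
    ∑ z ∈ l.toFinset, (if c z then F z (∑ τ ∈ s, if f τ = z then v τ else 0) else 0) =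
      ∑ τ ∈ s, if c (f τ) then F (f τ) (v τ) else 0 := by
  have : ∀ z, (if c z then F z (∑ τ ∈ s, if f τ = z then v τ else 0) else 0) =
      ∑ τ ∈ s, if f τ = z then (if c z then F z (v τ) else 0) else 0 := by
    intro z
    by_cases h : c z
    · simp only [if_pos h, map_sum]
      refine Finset.sum_congr rfl fun τ _ => ?_
      split_ifs <;> simp
    · simp [h]
  simp only [this]
  rw [Finset.sum_comm]
  refine Finset.sum_congr rfl fun τ hτ => ?_
  rw [Finset.sum_ite_eq, if_pos (List.mem_toFinset.2 (hf τ hτ))]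

theorem pairContrib_elt (off off' : ℕ) (t : ℕ) (G : ℕ → Val) (z z' x : ℕ) :
    pairContrib off off' (elt L m n g t) G z z' x =
      contrib off off' (maskF L m g false t) (maskB L g false t) (maskC g t) (weight n g false t) G z z' x +
      if maskC g t = 0 then contrib off off' (maskF L m g true t) (maskB L g true t) (maskC g t)
        (weight n g true t) G z z' x else 0 := rfl

/-- The entries of the table. -/
theorem table_apply (hg : IsGapSeq m n g) {t : ℕ} (ht : t ≤ m + n) :
    (∀ y ∈ fwdList L m g t, ∀ z ∈ bwdList L m n g (m + n - t),
      table L m n g t (t * 2 ^ m + y + z) = total L m n g t y z) ∧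
      ∀ a, (t + 1) * 2 ^ m ≤ a → table L m n g t a = 0 := by
  induction t with
  | zero =>
    constructor
    · intro y hy z hz
      rw [mem_fwdList] at hy
      obtain ⟨τ, rfl⟩ := hy
      have := lt_of_mem_bwdList hg ht hz
      simp only [pos, pow_zero, Nat.lt_one_iff] at this
      subst this
      simp only [fwd_zero]
      simp [table, total, pos, fwd_zero, value]
    · intro a ha
      have : 0 < 2 ^ m := by positivity
      simp only [table]
      rw [Function.update_of_ne (by omega)]
      rfl
  | succ t ih =>
    obtain ⟨ih1, ih2⟩ := ih (by omega)
    have hB : ∀ z ∈ bwdList L m n g (m + n - 1 - t), z < 2 ^ (pos g (t + 1)).1 := fun z hz =>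
      lt_of_mem_bwdList hg ht (by rwa [show m + n - (t + 1) = m + n - 1 - t by omega])
    have hr : ∀ z ∈ fwdList L m g t, ∀ z' ∈ bwdList L m n g (m + n - 1 - t), ∀ b,
        t * 2 ^ m + z + image ((elt L m n g t).bwd b) (elt L m n g t).self z' < (t + 1) * 2 ^ m := by
      intro z hz z' hz' b
      obtain ⟨τ, rfl⟩ := (mem_fwdList _ _).1 hz
      have h1 := lt_of_mem_bwdList hg (by omega) (image_mem_bwdList (by omega) hz' b)
      have h2 := fwd_add_lt (L := L) hg (show t ≤ m + n by omega) τ h1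
      simp only [elt]
      rw [add_mul, one_mul]
      omega
    have hw : ∀ z ∈ fwdList L m g t, ∀ b, ∃ τ, image (maskF L m g b t) (maskC g t) z =
        fwd L m g (t + 1) τ := fun z hz b => by
      obtain ⟨τ, hτ⟩ := (mem_fwdList _ _).1 (image_mem_fwdList hz b)
      exact ⟨τ, hτ.symm⟩
    have hsweep := fun a => sweep_apply (e := elt L m n g t) (nodup_reach _ _ _ t)
      (nodup_reach _ _ _ (m + n - 1 - t)) (G := table L m n g t) hr a
    change ∀ a, table L m n g (t + 1) a = _ at hsweep
    constructor
    · intro y hy z hz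
      -- The block of the new cut was still zero before the sweep, so an entry is exactly the sum of
      -- the contributions.
      rw [hsweep, ih2 _ (by omega), zero_add]
      rw [show m + n - (t + 1) = m + n - 1 - t by omega] at hz
      have hin : ∀ x ∈ fwdList L m g t, ∀ b, ∑ z' ∈ (bwdList L m n g (m + n - 1 - t)).toFinset,
          contrib (t * 2 ^ m) ((t + 1) * 2 ^ m) (maskF L m g b t) (maskB L g b t) (maskC g t)
            (weight n g b t) (table L m n g t) x z' ((t + 1) * 2 ^ m + y + z) =
          if image (maskF L m g b t) (maskC g t) x = y then
            act (x ||| maskC g t = x ∨ z ||| maskC g t = z) (weight n g b t)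
              (total L m n g t x (image (maskB L g b t) (maskC g t) z)) else 0 := by
        intro x hx b
        obtain ⟨τ, hτ⟩ := hw x hx b
        obtain ⟨τ', rfl⟩ := (mem_fwdList _ _).1 hy
        -- An address determines its backward part, so only pairs with second component `z` can
        -- write to this cell.
        rw [Finset.sum_eq_single z]
        · simp only [contrib, add_left_inj, add_right_inj]
          congr 1
          rw [ih1 x hx _ (image_mem_bwdList (by omega) hz b)]
        · intro z' hz' hne
          rw [contrib, if_neg]
          intro h
          rw [add_assoc, add_assoc, add_right_inj, hτ,
            fwd_add_inj (hB z' (List.mem_toFinset.1 hz')) (hB z hz)] at h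
          exact hne h.2
        · intro h
          exact absurd (List.mem_toFinset.2 hz) h
      have hfib : ∀ b, ∑ x ∈ (fwdList L m g t).toFinset,
          (if image (maskF L m g b t) (maskC g t) x = y then
            act (x ||| maskC g t = x ∨ z ||| maskC g t = z) (weight n g b t)
              (total L m n g t x (image (maskB L g b t) (maskC g t) z)) else 0) =
          ∑ τ ∈ Finset.range (2 ^ (pos g t).2),
            if image (maskF L m g b t) (maskC g t) (fwd L m g t τ.testBit) = y then
              act (fwd L m g t τ.testBit ||| maskC g t = fwd L m g t τ.testBit ∨
                z ||| maskC g t = z) (weight n g b t)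
                (value L n g t τ (image (maskB L g b t) (maskC g t) z)) else 0 := fun b =>
        sum_fiber (fun τ => fwd L m g t τ.testBit) (fun τ _ => (mem_fwdList _ _).2 ⟨_, rfl⟩)
          (fun x => image (maskF L m g b t) (maskC g t) x = y)
          (fun x => act (x ||| maskC g t = x ∨ z ||| maskC g t = z) (weight n g b t)) _
      have hsum : ∀ b, ∑ x ∈ (fwdList L m g t).toFinset,
          ∑ z' ∈ (bwdList L m n g (m + n - 1 - t)).toFinset,
          contrib (t * 2 ^ m) ((t + 1) * 2 ^ m) (maskF L m g b t) (maskB L g b t) (maskC g t)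
            (weight n g b t) (table L m n g t) x z' ((t + 1) * 2 ^ m + y + z) = _ := fun b =>
        (Finset.sum_congr rfl fun x hx => hin x (List.mem_toFinset.1 hx) b).trans (hfib b)
      simp only [pairContrib_elt]
      -- A clause has a single transition; performing it for both truth values would count every
      -- model twice.
      by_cases h : IsVar g t
      · have hself : maskC g t = 0 := if_pos h
        simp only [if_pos hself, Finset.sum_add_distrib]
        rw [total_succ_var h, Fintype.sum_bool]
        refine Eq.trans ?_ (add_comm _ _)
        exact congrArg₂ (· + ·) (hsum false) (hsum true)
      · have hself : maskC g t ≠ 0 := by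
          rw [maskC, if_neg h]; positivity
        simp only [if_neg hself, add_zero]
        rw [total_succ_clause h (pos_lt_of_clause hg (by omega) h) y z false]
        exact hsum false
    · intro a ha
      rw [hsweep, ih2 a ((Nat.mul_le_mul_right _ (by omega)).trans ha), zero_add]
      refine Finset.sum_eq_zero fun x hx => Finset.sum_eq_zero fun z' hz' => ?_
      have : ∀ b, contrib (t * 2 ^ m) ((t + 1) * 2 ^ m) (maskF L m g b t) (maskB L g b t)
          (maskC g t) (weight n g b t) (table L m n g t) x z' a = 0 := by
        intro b
        obtain ⟨τ, hτ⟩ := hw x (List.mem_toFinset.1 hx) b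
        have := fwd_add_lt (L := L) hg ht τ (hB z' (List.mem_toFinset.1 hz'))
        rw [contrib, if_neg]
        rw [hτ]
        rw [add_mul _ 1 (2 ^ m), one_mul] at ha
        omega
      simp only [pairContrib_elt, this, ite_self, add_zero]

/-- At the last cut both sets are empty, so one entry collects all assignments. -/
theorem table_last (hg : IsGapSeq m n g) : table L m n g (m + n) ((m + n) * 2 ^ m) =
    ∑ τ ∈ Finset.range (2 ^ n), value L n g (m + n) τ 0 := by
  have h := (table_apply (L := L) hg le_rfl).1 0 ?_ 0 ?_
  · rw [add_zero, add_zero] at h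
    rw [h, total, pos_last hg]
    refine Finset.sum_congr rfl fun τ _ => if_pos ?_
    rw [fwd, pos_last hg, code_self]
  · rw [mem_fwdList]
    exact ⟨fun _ => false, by rw [fwd, pos_last hg, code_self]⟩
  · rw [mem_bwdList hg (by omega), Nat.sub_self, Nat.sub_zero]
    exact ⟨fun _ => false, bwd_last hg _⟩

end

end KInterval

namespace KInterval

/-! ### Reading the answers off the last table -/

namespace CNF

variable {m n : ℕ} (F : CNF m n) (σ : Equiv.Perm (Fin m)) (ρ : Equiv.Perm (Fin n))

/-- The assignment whose value of the `j`-th variable is bit `j` of `τ`. -/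
def assign (ρ : Equiv.Perm (Fin n)) (τ : ℕ) : Fin n → Bool := fun x => τ.testBit (ρ.symm x)

theorem assign_injOn {τ τ' : ℕ} (h : τ < 2 ^ n) (h' : τ' < 2 ^ n) (he : assign ρ τ = assign ρ τ') :
    τ = τ' := by
  refine Nat.eq_of_testBit_eq fun j => ?_
  by_cases hj : j < n
  · have := congrFun he (ρ ⟨j, hj⟩)
    simpa [assign] using this
  · have hp := Nat.pow_le_pow_right (show 0 < 2 by norm_num) (not_lt.1 hj)
    rw [Nat.testBit_lt_two_pow (lt_of_lt_of_le h hp), Nat.testBit_lt_two_pow (lt_of_lt_of_le h' hp)]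

theorem exists_assign (α : Fin n → Bool) : ∃ τ < 2 ^ n, assign ρ τ = α := by
  refine ⟨code 0 n fun j => ∃ h : j < n, α (ρ ⟨j, h⟩) = true, code_lt _ _ _, funext fun x => ?_⟩
  rw [assign, Bool.eq_iff_iff, testBit_code]
  simp

theorem satBy_iff {g : ℕ → ℕ} (hg : IsGapSeq m n g) (τ : ℕ) (i : Fin m) :
    SatBy (F.lit σ ρ) g (m + n) τ 0 i ↔ F.Satisfies (assign ρ τ) (σ i) := by
  rw [SatBy, pos_last hg]
  simp only [Nat.zero_testBit, Bool.false_eq_true, or_false, Satisfies, assign]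
  constructor
  · rintro ⟨j, hj, h⟩
    exact ⟨_, (F.lit_ne_zero σ ρ _ i ⟨j, hj⟩).1 h, by simp⟩
  · rintro ⟨⟨x, b⟩, hmem, hb⟩
    obtain ⟨j, rfl⟩ := ρ.surjective x
    simp only [Equiv.symm_apply_apply] at hb
    exact ⟨j, j.2, hb ▸ (F.lit_ne_zero σ ρ b i j).2 hmem⟩

theorem numModels_eq {g : ℕ → ℕ} (hg : IsGapSeq m n g) :
    (table (F.lit σ ρ) m n g (m + n) ((m + n) * 2 ^ m)).1 = F.numModels := by
  classical
  rw [table_last hg, Prod.fst_sum]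
  simp only [value]
  rw [← Finset.card_filter, numModels]
  have hiff : ∀ τ, (∀ i < (pos g (m + n)).1, SatBy (F.lit σ ρ) g (m + n) τ 0 i) ↔
      ∀ C, F.Satisfies (assign ρ τ) C := by
    intro τ
    rw [pos_last hg]
    constructor
    · intro h C
      obtain ⟨i, rfl⟩ := σ.surjective C
      exact (F.satBy_iff σ ρ hg τ i).1 (h i i.2)
    · intro h i hi
      exact (F.satBy_iff σ ρ hg τ ⟨i, hi⟩).2 (h _)
  refine Finset.card_bij (fun τ _ => assign ρ τ) ?_ ?_ ?_
  · intro τ hτ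
    simp only [Finset.mem_filter, hiff] at hτ
    simpa using hτ.2
  · intro τ hτ τ' hτ' he
    simp only [Finset.mem_filter, Finset.mem_range] at hτ hτ'
    exact assign_injOn ρ hτ.1 hτ'.1 he
  · intro α hα
    obtain ⟨τ, hτ, rfl⟩ := exists_assign ρ α
    refine ⟨τ, ?_, rfl⟩
    simp only [Finset.mem_filter, Finset.mem_range, hiff]
    exact ⟨hτ, by simpa using hα⟩

/-- Since `τ < 2 ^ n`, the number of satisfied clauses dominates the comparison of values: it is the
leading digit in base `2 ^ n` once the 1 is subtracted. The remainder is the assignment itself. -/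
theorem exists_best {g : ℕ → ℕ} (hg : IsGapSeq m n g) :
    ∃ τ < 2 ^ n, (table (F.lit σ ρ) m n g (m + n) ((m + n) * 2 ^ m)).2.val =
      1 + τ + 2 ^ n * F.numSatisfied (assign ρ τ) ∧
      ∀ α, F.numSatisfied α ≤ F.numSatisfied (assign ρ τ) := by
  classical
  have hv : ∀ τ, (value (F.lit σ ρ) n g (m + n) τ 0).2.val =
      1 + τ + 2 ^ n * F.numSatisfied (assign ρ τ) := by
    intro τ
    simp only [value]
    congr 2
    rw [numSatisfied, pos_last hg]
    refine Finset.card_bij' (fun i hi => σ ⟨i, by simp at hi; exact hi.1⟩) (fun C _ => (σ.symm C : ℕ))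
      ?_ ?_ ?_ ?_
    · intro i hi
      simp only [Finset.mem_filter, Finset.mem_range] at hi
      simpa using (F.satBy_iff σ ρ hg τ ⟨i, hi.1⟩).1 hi.2
    · intro C hC
      simp only [Finset.mem_filter, Finset.mem_univ, true_and] at hC
      simp only [Finset.mem_filter, Finset.mem_range, Fin.is_lt, true_and]
      exact (F.satBy_iff σ ρ hg τ (σ.symm C)).2 (by simpa using hC)
    · intro i _; simp
    · intro C _; simp
  obtain ⟨τ, hτ, hmax⟩ := MaxNat.exists_val_sum (Finset.range (2 ^ n))
    (fun τ => (value (F.lit σ ρ) n g (m + n) τ 0).2) (by simp)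
  rw [Finset.mem_range] at hτ
  rw [table_last hg, Prod.snd_sum]
  refine ⟨τ, hτ, by rw [hmax, hv], fun α => ?_⟩
  obtain ⟨τ', hτ', rfl⟩ := exists_assign ρ α
  have := (MaxNat.val_sum_le_iff (Finset.range (2 ^ n))
    (fun τ => (value (F.lit σ ρ) n g (m + n) τ 0).2) _).1 le_rfl τ' (by simpa using hτ')
  rw [hmax, hv, hv] at this
  by_contra hlt
  have h1 : F.numSatisfied (assign ρ τ) + 1 ≤ F.numSatisfied (assign ρ τ') := by omega
  have := Nat.mul_le_mul_left (2 ^ n) h1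
  rw [mul_add, mul_one] at this
  omega

end CNF

end KInterval

namespace KInterval

open Prog

/-! ### The union of two sets of clauses -/

/-- The top bit is detected by a comparison and removed by a subtraction, operations that the
machine has; the loop of `orSub` does this from the highest bit down. -/
theorem or_split {i x y : ℕ} (hx : x < 2 ^ (i + 1)) (hy : y < 2 ^ (i + 1)) :
    (if 2 ^ i ≤ x ∨ 2 ^ i ≤ y then 2 ^ i else 0) +
      ((if 2 ^ i ≤ x then x - 2 ^ i else x) ||| (if 2 ^ i ≤ y then y - 2 ^ i else y)) = x ||| y := by
  rw [pow_succ] at hx hy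
  have key : ∀ r < 2 ^ i, 2 ^ i + r = 2 ^ i ||| r := fun r hr => by
    have := Nat.two_pow_add_eq_or_of_lt hr 1
    rwa [mul_one] at this
  by_cases h1 : 2 ^ i ≤ x <;> by_cases h2 : 2 ^ i ≤ y <;> simp only [h1, h2, or_self, or_true, true_or,
    if_true, if_false, zero_add]
  · have hx' : x - 2 ^ i < 2 ^ i := by omega
    have hy' : y - 2 ^ i < 2 ^ i := by omega
    rw [key _ (Nat.or_lt_two_pow hx' hy')]
    conv_rhs => rw [← Nat.add_sub_cancel' h1, ← Nat.add_sub_cancel' h2, key _ hx', key _ hy']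
    refine Nat.eq_of_testBit_eq fun j => ?_
    simp only [Nat.testBit_or]
    cases (2 ^ i).testBit j <;> simp
  · have hx' : x - 2 ^ i < 2 ^ i := by omega
    rw [key _ (Nat.or_lt_two_pow hx' (by omega))]
    conv_rhs => rw [← Nat.add_sub_cancel' h1, key _ hx']
    rw [Nat.or_assoc]
  · have hy' : y - 2 ^ i < 2 ^ i := by omega
    rw [key _ (Nat.or_lt_two_pow (by omega) hy')]
    conv_rhs => rw [← Nat.add_sub_cancel' h2, key _ hy']
    rw [← Nat.or_assoc, ← Nat.or_assoc, Nat.or_comm x]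

/-- One bit of `orSub`. -/
def orBody : Prog :=
  .seq (block [.const 8 1, .sub 3 3 8, .load 4 4 3, .const 9 0, .sub 8 4 5])
    (.seq (.branch 8 .skip (block [.sub 5 5 4, .add 9 4 8]))
      (.seq (block [.sub 8 4 6])
        (.seq (.branch 8 .skip (block [.sub 6 6 4, .add 9 4 8]))
          (block [.add 7 7 9]))))

/-- `reg o := (reg x ||| reg a) - reg b`, for sets of `reg 0` clauses. -/
def orSub (x a b o : ℕ) : Prog :=
  .seq (block [.const 8 0, .add 3 0 8, .add 5 x 8, .add 6 a 8, .const 7 0])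
    (.seq (.loop 3 orBody) (block [.sub o 7 b]))

/-- Registers 3 to 9 are scratch space, hence operands sit in registers from 10 on. The linear cost
of this program contributes one factor `m` to the running time. -/
theorem orSub_spec {x a b o : ℕ} (hx : 10 ≤ x) (ha : 10 ≤ a) (hb : 10 ≤ b) {s : State}
    (hpow : ∀ i < s.reg 0, s.mem 4 i = 2 ^ i) (hxm : s.reg x < 2 ^ s.reg 0)
    (ham : s.reg a < 2 ^ s.reg 0) :
    HaltsWithin (orSub x a b o) s (15 * s.reg 0 + 7)
      (fun s' => s'.reg o = image (s.reg a) (s.reg b) (s.reg x)) := by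
  set m := s.reg 0 with hm
  refine HaltsWithin.mono (T := 5 + ((m * (14 + 1) + 1) + 1)) ?_ (by omega) fun _ h => h
  refine (HaltsWithin.of_eval (R := fun s1 => s1.reg 3 = m ∧ s1.reg 5 = s.reg x ∧
    s1.reg 6 = s.reg a ∧ s1.reg 7 = 0) rfl le_rfl ?_).seq ?_
  · simp [Prog.eval, block, Instr.apply, hm, show x ≠ 3 by omega,
      show x ≠ 8 by omega, show a ≠ 8 by omega, show a ≠ 3 by omega, show a ≠ 5 by omega]
  rintro s1 ⟨h3, h5, h6, h7⟩ hf1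
  have h0 : s1.reg 0 = m := hf1.reg 0 rfl
  have hmem : s1.mem = s.mem := funext fun i => hf1.mem i rfl
  -- The bits already collected plus the union of what remains of both operands is constant; after
  -- `i` rounds only bits below `m - i` remain.
  refine (HaltsWithin.loop (N := m) (c := 14) (fun i s' => s'.reg 3 = m - i ∧ s'.reg 5 < 2 ^ (m - i) ∧
    s'.reg 6 < 2 ^ (m - i) ∧ s'.reg 7 + (s'.reg 5 ||| s'.reg 6) = s.reg x ||| s.reg a) ?_ ?_ ?_).seq ?_
  · simp [h3, h5, h6, h7, hxm, ham]
  · rintro i s' hi ⟨e3, e5, e6, e7⟩ hf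
    refine ⟨by omega, HaltsWithin.of_eval rfl (by decide) ?_⟩
    obtain ⟨d, hd⟩ : ∃ d, m - (i + 1) = d := ⟨_, rfl⟩
    have hd' : m - i = d + 1 := by omega
    have hp : s'.mem 4 d = 2 ^ d := by
      rw [hf.mem 4 rfl, hmem]; exact hpow d (by omega)
    rw [hd'] at e3 e5 e6
    rw [hd]
    have hsplit := or_split e5 e6
    have e5' := e5
    have e6' := e6
    rw [pow_succ] at e5' e6'
    by_cases c1 : 2 ^ d ≤ s'.reg 5 <;> by_cases c2 : 2 ^ d ≤ s'.reg 6 <;>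
      simp only [c1, c2, or_self, or_true, true_or, if_true, if_false, zero_add] at hsplit <;>
      simp [orBody, Prog.eval, block, Instr.apply, e3, hp, Nat.sub_eq_zero_iff_le,
        c1, c2] <;> omega
  · rintro s' ⟨e3, -⟩
    omega
  rintro s2 ⟨⟨-, e5, e6, e7⟩, hf2⟩ -
  refine HaltsWithin.of_eval rfl le_rfl ?_
  simp only [Nat.sub_self, pow_zero, Nat.lt_one_iff] at e5 e6
  rw [e5, e6] at e7
  have hbb : s2.reg b = s.reg b := by
    rw [hf2.reg b, hf1.reg b]
    · simp [writesReg, block, Instr.regTarget]; omega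
    · simp [orBody, writesReg, block, Instr.regTarget]; omega
  simp [Prog.eval, block, Instr.apply, image, hbb, ← e7]

end KInterval

namespace KInterval

open Prog

theorem image_lt {a b z m : ℕ} (ha : a < 2 ^ m) (hz : z < 2 ^ m) : image a b z < 2 ^ m :=
  lt_of_le_of_lt (Nat.sub_le _ _) (Nat.or_lt_two_pow hz ha)

/-! ### Enumerating the reachable sets -/

/-- The list `l` is stored from address `p` on. -/
def ListAt (f : ℕ → ℕ) (p : ℕ) (l : List ℕ) : Prop := ∀ q < l.length, f (p + q) = l.getD q 0

/-- Append the image of `reg 20` under the masks in `reg a` and `reg 18`, unless it is marked. -/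
def pushImage (base a : ℕ) : Prog :=
  .seq (orSub 20 a 18 22) (.seq (block [.load 23 (base + 5) 22, .sub 23 14 23])
    (.branch 23 (block [.store (base + 5) 22 14, .store (base + 3) 12 22, .add 12 12 11]) .skip))

/-- The new list `acc` is stored from address `p` on, and exactly its members carry the current mark. -/
structure Acc (base p stamp : ℕ) (old : ℕ → ℕ) (acc : List ℕ) (s : State) : Prop where
  out : s.reg 12 = p + acc.length
  list : ListAt (s.mem (base + 3)) p acc
  old : ∀ x < p, s.mem (base + 3) x = old x
  mark : ∀ y, s.mem (base + 5) y = stamp ↔ y ∈ acc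
  mark_le : ∀ y, s.mem (base + 5) y ≤ stamp

theorem Acc.congr {base p stamp : ℕ} {old : ℕ → ℕ} {acc : List ℕ} {s s' : State}
    (h : Acc base p stamp old acc s) (h12 : s'.reg 12 = s.reg 12) (hm : s'.mem = s.mem) :
    Acc base p stamp old acc s' :=
  ⟨h12.trans h.out, hm ▸ h.list, hm ▸ h.old, hm ▸ h.mark, hm ▸ h.mark_le⟩

/-- Whether a set is already listed is decided by one mark, stored at the address which is the set
itself. The mark is the number of the current list, so earlier marks need not be erased. -/
theorem pushImage_spec {base a p stamp : ℕ} {old : ℕ → ℕ} {acc : List ℕ} {s : State}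
    (ha : 16 ≤ a) (hpow : ∀ i < s.reg 0, s.mem 4 i = 2 ^ i)
    (hz : s.reg 20 < 2 ^ s.reg 0) (ham : s.reg a < 2 ^ s.reg 0) (h14 : s.reg 14 = stamp)
    (h11 : s.reg 11 = 1) (h : Acc base p stamp old acc s) :
    HaltsWithin (pushImage base a) s (15 * s.reg 0 + 13)
      (Acc base p stamp old (ins acc (image (s.reg a) (s.reg 18) (s.reg 20)))) := by
  refine HaltsWithin.mono (T := (15 * s.reg 0 + 7) + 6) ?_ (by omega) fun _ h => h
  refine (orSub_spec (by norm_num) (by omega) (by norm_num) hpow hz ham).seq fun s1 h22 hf => ?_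
  set y := image (s.reg a) (s.reg 18) (s.reg 20)
  have h1 := h.congr (s' := s1) (hf.reg 12 rfl) (funext fun i => hf.mem i rfl)
  have e14 : s1.reg 14 = stamp := (hf.reg 14 rfl).trans h14
  have e11 : s1.reg 11 = 1 := (hf.reg 11 rfl).trans h11
  refine HaltsWithin.of_eval rfl le_rfl ?_
  obtain ⟨h12, hl, hold, hmark, hle⟩ := h1
  unfold ins
  by_cases hy : y ∈ acc
  · rw [if_pos hy]
    have hm : s1.mem (base + 5) y = stamp := (hmark y).2 hy
    constructor <;> simp [Prog.eval, block, Instr.apply, h22, hm, e14] <;> assumption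
  · rw [if_neg hy]
    have hm : s1.mem (base + 5) y ≠ stamp := fun h' => hy ((hmark y).1 h')
    have hne : stamp - s1.mem (base + 5) y ≠ 0 := by have := hle y; omega
    constructor
    · simp [Prog.eval, block, Instr.apply, h22, hne, e14, h12, e11]
      omega
    · intro q hq
      simp [Prog.eval, block, Instr.apply, Function.update_apply, h22, hne, e14, h12]
      rw [List.length_append, List.length_singleton] at hq
      by_cases hq' : q = acc.length
      · subst hq'; simp
      · rw [if_neg hq', hl q (by omega)]
        simp [List.getElem?_append, show q < acc.length by omega]
    · intro x hx
      simp [Prog.eval, block, Instr.apply, Function.update_apply, h22, hne, e14, h12]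
      rw [if_neg (by omega), hold x hx]
    · intro x
      simp [Prog.eval, block, Instr.apply, Function.update_apply, h22, hne, e14]
      by_cases hx : x = y
      · simp [hx]
      · simp [hx, hmark x]
    · intro x
      simp [Prog.eval, block, Instr.apply, Function.update_apply, h22, hne, e14]
      split_ifs
      · exact le_rfl
      · exact hle x

/-- The images of one list element. -/
def pushBody (base : ℕ) : Prog :=
  .seq (block [.load 20 (base + 3) 13]) (.seq (pushImage base 16) (.seq (pushImage base 17)
    (block [.add 13 13 11, .sub 19 19 11])))

/-- The images of one list. -/
def pushAll (base : ℕ) : Prog :=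
  .seq (block [.load 16 base 14, .load 17 (base + 1) 14, .load 18 (base + 2) 14, .add 14 14 11,
      .sub 19 12 13])
    (.seq (.loop 19 (pushBody base))
      (block [.add 21 14 11, .store (base + 4) 21 12, .sub 15 15 11]))

/-- Enumerate `reach` for the masks in the segments `base`, `base + 1`, `base + 2`: the lists are stored
one after another in segment `base + 3`, and segment `base + 4` has their starts. -/
def reachProg (base : ℕ) : Prog :=
  .seq (block [.const 10 0, .const 11 1, .store (base + 3) 10 10, .store (base + 4) 11 11, .const 12 1,
      .const 13 0, .const 14 0, .add 15 0 1])
    (.loop 15 (pushAll base))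

theorem pushBody_loop {base u : ℕ} (hbase : 13 ≤ base) {l : List ℕ} {s : State}
    (hpow : ∀ i < s.reg 0, s.mem 4 i = 2 ^ i) (hz : ∀ z ∈ l, z < 2 ^ s.reg 0)
    (h16 : s.reg 16 < 2 ^ s.reg 0) (h17 : s.reg 17 < 2 ^ s.reg 0) (h14 : s.reg 14 = u + 1)
    (h11 : s.reg 11 = 1) (h19 : s.reg 19 = l.length) (h12 : s.reg 12 = s.reg 13 + l.length)
    (hl : ListAt (s.mem (base + 3)) (s.reg 13) l) (hmark : ∀ y, s.mem (base + 5) y ≤ u) :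
    HaltsWithin (.loop 19 (pushBody base)) s (l.length * (30 * s.reg 0 + 30) + 1) (fun s' =>
      s'.reg 13 = s.reg 12 ∧ Acc base (s.reg 12) (u + 1) (s.mem (base + 3))
        (images (image (s.reg 16) (s.reg 18)) (image (s.reg 17) (s.reg 18)) l) s') := by
  have hmem : ∀ {s' : State}, Frame (pushBody base) s s' → ∀ x, x ≠ base + 3 → x ≠ base + 5 →
      s'.mem x = s.mem x := by
    intro s' hf x h3 h5
    refine hf.mem x ?_
    simp [pushBody, pushImage, orSub, orBody, block, writesSeg, Instr.segTarget, h3.symm, h5.symm]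
  refine HaltsWithin.mono (HaltsWithin.loop (N := l.length) (c := 30 * s.reg 0 + 29) (fun i s' =>
    s'.reg 19 = l.length - i ∧ s'.reg 13 = s.reg 13 + i ∧ Acc base (s.reg 12) (u + 1) (s.mem (base + 3))
      (images (image (s.reg 16) (s.reg 18)) (image (s.reg 17) (s.reg 18)) (l.take i)) s') ?_ ?_ ?_)
    le_rfl ?_
  · refine ⟨by simp [h19], by simp, ?_⟩
    constructor
    · simp [images]
    · intro q hq; simp [images] at hq
    · intro x _; rfl
    -- All old marks are at most `u`, below the current mark `u + 1`, so the new list counts as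
    -- empty.
    · intro y
      have := hmark y
      simp [images]; omega
    · intro y
      have := hmark y
      omega
  · rintro i s' hi ⟨e19, e13, hacc⟩ hf
    refine ⟨by omega, ?_⟩
    refine HaltsWithin.mono (T := 1 + ((15 * s.reg 0 + 13) + ((15 * s.reg 0 + 13) + 2))) ?_ (by omega)
      fun _ h => h
    refine (HaltsWithin.of_eval (R := fun s1 => s1.reg 20 = l.getD i 0 ∧ s1.reg 12 = s'.reg 12 ∧
      s1.mem = s'.mem ∧ s1.reg 19 = s'.reg 19 ∧ s1.reg 13 = s'.reg 13) rfl le_rfl ?_).seq ?_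
    · simp only [Prog.eval, block, Instr.apply]
      have : s'.mem (base + 3) (s'.reg 13) = l.getD i 0 := by
        -- The list being read ends where the new one starts, so appending has not overwritten it.
        rw [hacc.old _ (by omega), e13]
        exact hl i hi
      simp [this]
    rintro s1 ⟨f20, f12, fm, f19, f13⟩ hf1
    have hgetD : l.getD i 0 = l[i] := by simp [hi]
    have f0 : s1.reg 0 = s.reg 0 := (hf1.reg 0 rfl).trans (hf.reg 0 rfl)
    have f11 : s1.reg 11 = 1 := ((hf1.reg 11 rfl).trans (hf.reg 11 rfl)).trans h11
    have f14 : s1.reg 14 = u + 1 := ((hf1.reg 14 rfl).trans (hf.reg 14 rfl)).trans h14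
    have f16 : s1.reg 16 = s.reg 16 := (hf1.reg 16 rfl).trans (hf.reg 16 rfl)
    have f17 : s1.reg 17 = s.reg 17 := (hf1.reg 17 rfl).trans (hf.reg 17 rfl)
    have f18 : s1.reg 18 = s.reg 18 := (hf1.reg 18 rfl).trans (hf.reg 18 rfl)
    have fpow : s1.mem 4 = s.mem 4 := by rw [fm]; exact hmem hf 4 (by omega) (by omega)
    have hzi : l.getD i 0 < 2 ^ s.reg 0 := by rw [hgetD]; exact hz _ (List.getElem_mem hi)
    rw [← f0]
    refine (pushImage_spec (base := base) (by norm_num) (by rw [f0, fpow]; exact hpow)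
      (by rw [f20, f0]; exact hzi)
      (by rw [f16, f0]; exact h16) f14 f11 (hacc.congr f12 fm)).seq ?_
    intro s2 hacc2 hf2
    have g0 : s2.reg 0 = s1.reg 0 := hf2.reg 0 rfl
    have g20 : s2.reg 20 = s1.reg 20 := hf2.reg 20 rfl
    have g17 : s2.reg 17 = s1.reg 17 := hf2.reg 17 rfl
    have g18 : s2.reg 18 = s1.reg 18 := hf2.reg 18 rfl
    have gpow : s2.mem 4 = s1.mem 4 := hf2.mem 4 (by
      simp [pushImage, orSub, orBody, block, writesSeg, Instr.segTarget]; omega)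
    rw [← g0]
    refine (pushImage_spec (base := base) (by norm_num) (by rw [g0, gpow, f0, fpow]; exact hpow)
      (by rw [g20, g0, f20, f0]; exact hzi)
      (by rw [g17, g0, f17, f0]; exact h17) ((hf2.reg 14 rfl).trans f14)
      ((hf2.reg 11 rfl).trans f11) hacc2).seq ?_
    intro s3 hacc3 hf3
    have k11 : s3.reg 11 = 1 := (hf3.reg 11 rfl).trans ((hf2.reg 11 rfl).trans f11)
    have k13 : s3.reg 13 = s.reg 13 + i := by
      rw [hf3.reg 13 rfl, hf2.reg 13 rfl, f13, e13]
    have k19 : s3.reg 19 = l.length - i := by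
      rw [hf3.reg 19 rfl, hf2.reg 19 rfl, f19, e19]
    refine HaltsWithin.of_eval rfl le_rfl ⟨?_, ?_, ?_⟩
    · simp [Prog.eval, block, Instr.apply, k11, k19]; omega
    · simp [Prog.eval, block, Instr.apply, k11, k13]; omega
    · rw [List.take_add_one, List.getElem?_eq_getElem hi, Option.toList_some, images_append, ← hgetD]
      rw [g20, g17, f17, g18, f16, f18, f20] at hacc3
      exact hacc3.congr rfl rfl
  · rintro s' ⟨e, -⟩; omega
  · rintro s' ⟨⟨-, e13, hacc⟩, -⟩
    rw [List.take_length] at hacc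
    exact ⟨by omega, hacc⟩

theorem reach_lt {a a' b : ℕ → ℕ} {m N : ℕ} (ha : ∀ u < N, a u < 2 ^ m) (ha' : ∀ u < N, a' u < 2 ^ m)
    {u : ℕ} (hu : u ≤ N) : ∀ z ∈ reach a a' b u, z < 2 ^ m := by
  induction u with
  | zero => intro z hz; simp only [reach, List.mem_singleton] at hz; subst hz; positivity
  | succ u ih =>
    intro z hz
    rw [reach, mem_images] at hz
    obtain ⟨w, hw, rfl | rfl⟩ := hz
    · exact image_lt (ha u hu) (ih (by omega) w hw)
    · exact image_lt (ha' u hu) (ih (by omega) w hw)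

theorem ListAt.congr {f f' : ℕ → ℕ} {p : ℕ} {l : List ℕ} (h : ListAt f p l)
    (hf : ∀ x < p + l.length, f' x = f x) : ListAt f' p l :=
  fun q hq => (hf _ (by omega)).trans (h q hq)

/-- All lists are kept, not just the current one: the backward lists are generated from the last cut
to the first but are used in the opposite direction. -/
theorem reachProg_spec {base K : ℕ} (hbase : 13 ≤ base) {s : State}
    (hpow : ∀ i < s.reg 0, s.mem 4 i = 2 ^ i)
    (ha : ∀ u < s.reg 0 + s.reg 1, s.mem base u < 2 ^ s.reg 0)
    (ha' : ∀ u < s.reg 0 + s.reg 1, s.mem (base + 1) u < 2 ^ s.reg 0)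
    (h4 : s.mem (base + 4) 0 = 0) (h5 : ∀ y, s.mem (base + 5) y = 0)
    (hK : ∀ u < s.reg 0 + s.reg 1,
      (reach (s.mem base) (s.mem (base + 1)) (s.mem (base + 2)) u).length ≤ K) :
    HaltsWithin (reachProg base) s
      ((s.reg 0 + s.reg 1) * (K * (30 * s.reg 0 + 30) + 10) + 9) (fun s' =>
      ∀ u ≤ s.reg 0 + s.reg 1, ListAt (s'.mem (base + 3)) (s'.mem (base + 4) u)
        (reach (s.mem base) (s.mem (base + 1)) (s.mem (base + 2)) u) ∧
        s'.mem (base + 4) (u + 1) = s'.mem (base + 4) u +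
          (reach (s.mem base) (s.mem (base + 1)) (s.mem (base + 2)) u).length) := by
  set lst := reach (s.mem base) (s.mem (base + 1)) (s.mem (base + 2)) with hlst
  set N := s.reg 0 + s.reg 1 with hN
  refine HaltsWithin.mono (T := 8 + (N * (K * (30 * s.reg 0 + 30) + 10) + 1)) ?_ (by omega)
    fun _ h => h
  refine (HaltsWithin.of_eval (R := fun s1 => s1.reg 11 = 1 ∧ s1.reg 12 = 1 ∧
    s1.reg 13 = 0 ∧ s1.reg 14 = 0 ∧ s1.reg 15 = N ∧ s1.mem (base + 3) 0 = 0 ∧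
    s1.mem (base + 4) 0 = 0 ∧ s1.mem (base + 4) 1 = 1) rfl le_rfl ?_).seq ?_
  · simp [Prog.eval, block, Instr.apply, h4, hN]
  rintro s1 ⟨e11, e12, e13, e14, e15, e3, e4, e4'⟩ hf1
  have hm1 : ∀ x, x ≠ base + 3 → x ≠ base + 4 → s1.mem x = s.mem x := fun x h3 h4 => by
    refine hf1.mem x ?_
    simp [block, writesSeg, Instr.segTarget, h3.symm, h4.symm]
  have hmem : ∀ {s' : State}, Frame (pushAll base) s1 s' → ∀ x, x ≠ base + 3 → x ≠ base + 4 →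
      x ≠ base + 5 → s'.mem x = s.mem x := by
    intro s' hf x h3 h4 h5
    rw [← hm1 x h3 h4]
    refine hf.mem x ?_
    simp [pushAll, pushBody, pushImage, orSub, orBody, block, writesSeg, Instr.segTarget, h3.symm,
      h5.symm, h4.symm]
  -- The last conjunct puts all finished lists in front of the free space, so the next round leaves
  -- them intact.
  refine HaltsWithin.mono (HaltsWithin.loop (N := N) (c := K * (30 * s.reg 0 + 30) + 9) (fun i s' =>
    s'.reg 15 = N - i ∧ s'.reg 14 = i ∧ s'.reg 13 = s'.mem (base + 4) i ∧
    s'.reg 12 = s'.mem (base + 4) (i + 1) ∧ (∀ y, s'.mem (base + 5) y ≤ i) ∧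
    ∀ u ≤ i, ListAt (s'.mem (base + 3)) (s'.mem (base + 4) u) (lst u) ∧
      s'.mem (base + 4) (u + 1) = s'.mem (base + 4) u + (lst u).length ∧
      s'.mem (base + 4) (u + 1) ≤ s'.mem (base + 4) (i + 1)) ?_ ?_ ?_) le_rfl ?_
  · refine ⟨by simp [e15], e14, by rw [e13, e4], by rw [e12, e4'], fun y => ?_, fun u hu => ?_⟩
    · rw [hm1 (base + 5) (by omega) (by omega), h5]
    · obtain rfl : u = 0 := by omega
      refine ⟨?_, by rw [e4, e4']; simp [hlst, reach], le_rfl⟩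
      intro q hq
      obtain rfl : q = 0 := by simp [hlst, reach] at hq; exact hq
      rw [e4]
      simp [hlst, reach, e3]
  · rintro i s' hi ⟨f15, f14, f13, f12, fmark, flists⟩ hf
    refine ⟨by omega, ?_⟩
    obtain ⟨hlist, hlen, -⟩ := flists i le_rfl
    have hKi := hK i hi
    have f0 : s'.reg 0 = s.reg 0 := (hf.reg 0 rfl).trans (hf1.reg 0 rfl)
    have f11 : s'.reg 11 = 1 := (hf.reg 11 rfl).trans e11
    refine HaltsWithin.mono (T := 5 + (((lst i).length * (30 * s.reg 0 + 30) + 1) + 3)) ?_ ?_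
      fun _ h => h
    · refine (HaltsWithin.of_eval (R := fun s2 => s2.reg 16 = s.mem base i ∧
        s2.reg 17 = s.mem (base + 1) i ∧ s2.reg 18 = s.mem (base + 2) i ∧ s2.reg 14 = i + 1 ∧
        s2.reg 19 = (lst i).length) rfl le_rfl ?_).seq ?_
      · simp [Prog.eval, block, Instr.apply, f14, f11, f12, f13,
          hmem hf base (by omega) (by omega) (by omega), hmem hf (base + 1) (by omega) (by omega) (by omega),
          hmem hf (base + 2) (by omega) (by omega) (by omega), hlen]
      rintro s2 ⟨g16, g17, g18, g14, g19⟩ hf2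
      have g0 : s2.reg 0 = s.reg 0 := (hf2.reg 0 rfl).trans f0
      have gm : s2.mem = s'.mem := funext fun x => hf2.mem x rfl
      have g11 : s2.reg 11 = 1 := (hf2.reg 11 rfl).trans f11
      have g12 : s2.reg 12 = s'.reg 12 := hf2.reg 12 rfl
      have g13 : s2.reg 13 = s'.reg 13 := hf2.reg 13 rfl
      rw [← g0]
      refine (pushBody_loop (u := i) (l := lst i) hbase ?_ ?_ ?_ ?_ g14 g11 g19 ?_ ?_ ?_).seq ?_
      · rw [g0, gm, hmem hf 4 (by omega) (by omega) (by omega)]; exact hpow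
      · rw [g0]; exact reach_lt ha ha' hi.le
      · rw [g0, g16]; exact ha i hi
      · rw [g0, g17]; exact ha' i hi
      · rw [g12, g13, f12, f13, hlen]
      · rw [gm, g13, f13]; exact hlist
      · rw [gm]; exact fmark
      rintro s3 ⟨k13, hacc⟩ hf3
      rw [g16, g17, g18, gm] at hacc
      change Acc base _ _ _ (lst (i + 1)) s3 at hacc
      have k11 : s3.reg 11 = 1 := (hf3.reg 11 rfl).trans g11
      have k14 : s3.reg 14 = i + 1 := (hf3.reg 14 rfl).trans g14
      have k15 : s3.reg 15 = N - i := ((hf3.reg 15 rfl).trans (hf2.reg 15 rfl)).trans f15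
      have k4 : s3.mem (base + 4) = s'.mem (base + 4) := by
        rw [hf3.mem (base + 4), gm]
        simp [pushBody, pushImage, orSub, orBody, block, writesSeg, Instr.segTarget]
      have k12 := hacc.out
      rw [g12, f12] at k12 hacc
      rw [g12, f12] at k13
      refine HaltsWithin.of_eval rfl le_rfl ⟨?_, ?_, ?_, ?_, ?_, ?_⟩
      · simp [Prog.eval, block, Instr.apply, k15, k11]; omega
      · simp [Prog.eval, block, Instr.apply, k14]
      · simp [Prog.eval, block, Instr.apply, k14, k11, k13, k4]
      · simp [Prog.eval, block, Instr.apply, k14, k11]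
      · simp [Prog.eval, block, Instr.apply]
        exact hacc.mark_le
      · intro u hu
        simp only [Prog.eval, block, Instr.apply, Function.update_apply, k14, k11, k4, k12]
        simp only [show base + 3 ≠ base + 4 by omega, if_true, if_false, Nat.reduceEqDiff]
        rcases Nat.lt_succ_iff_lt_or_eq.1 (Nat.lt_succ_of_le hu) with hu' | rfl
        · obtain ⟨p1, p2, p3⟩ := flists u (by omega)
          rw [Function.update_of_ne (by omega), Function.update_of_ne (by omega), Function.update_self]
          refine ⟨p1.congr fun x hx => hacc.old x (by omega), p2, by omega⟩
        · rw [Function.update_of_ne (by omega), Function.update_self]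
          exact ⟨hacc.list, rfl, le_rfl⟩
    · have := Nat.mul_le_mul_right (30 * s.reg 0 + 30) hKi
      omega
  · rintro s' ⟨e, -⟩; omega
  · rintro s' ⟨⟨-, -, -, -, -, h⟩, -⟩ u hu
    exact ⟨(h u hu).1, (h u hu).2.1⟩

end KInterval

namespace KInterval

open Prog

/-! ### Filling the table -/

/-- The two tables hold the values `G`. -/
structure Tab (G : ℕ → Val) (s : State) : Prop where
  count : ∀ x, s.mem 27 x = (G x).1
  best : ∀ x, s.mem 28 x = (G x).2.val

theorem Tab.congr {G : ℕ → Val} {s s' : State} (h : Tab G s) (hm : s'.mem = s.mem) : Tab G s' :=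
  ⟨hm ▸ h.count, hm ▸ h.best⟩

/-- `triple` for the masks in `reg f`, `reg b` and the weight in `reg w`. -/
def tripleProg (f b w : ℕ) : Prog :=
  .seq (orSub 30 f 19 34) (.seq (orSub 33 b 19 35) (.seq (orSub 30 19 30 36) (.seq (orSub 33 19 33 37)
    (.seq (block [.add 38 16 34, .add 38 38 33, .add 39 14 30, .add 39 39 35, .load 40 27 39,
        .load 41 28 39, .const 42 0])
      (.seq (.branch 36 (.branch 37 (block [.const 40 0]) (block [.add 42 w 42])) (block [.add 42 w 42]))
        (.seq (.branch 41 (block [.add 41 41 42]) .skip)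
          (block [.load 43 27 38, .add 43 43 40, .store 27 38 43, .load 44 28 38, .sub 45 41 44,
            .add 44 44 45, .store 28 38 44])))))))

/-- With this, absorption is tested by the program for unions: the difference vanishes exactly if
the union adds nothing. -/
theorem image_self_eq_zero (z b : ℕ) : image b z z = 0 ↔ z ||| b = z := by
  have : z ≤ z ||| b := Nat.left_le_or
  rw [image, Nat.sub_eq_zero_iff_le]
  exact ⟨fun h => le_antisymm h this, fun h => h.le⟩

theorem act_apply (p : Prop) [Decidable p] (w : ℕ) (v : Val) :
    act p w v = (if p then v.1 else 0,
      ⟨if v.2.val = 0 then 0 else v.2.val + if p then w else 0⟩) := rfl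

/-- The cost is that of four unions and a constant: two unions give the addresses and two decide
whether the element is satisfied. -/
theorem tripleProg_spec {f b w : ℕ} (hf : 17 ≤ f ∧ f ≤ 23) (hb : 17 ≤ b ∧ b ≤ 23)
    (hw : 17 ≤ w ∧ w ≤ 23) {s : State} {G : ℕ → Val} (hpow : ∀ i < s.reg 0, s.mem 4 i = 2 ^ i)
    (h30 : s.reg 30 < 2 ^ s.reg 0) (h33 : s.reg 33 < 2 ^ s.reg 0) (h19 : s.reg 19 < 2 ^ s.reg 0)
    (hfm : s.reg f < 2 ^ s.reg 0) (hbm : s.reg b < 2 ^ s.reg 0) (hG : Tab G s) :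
    HaltsWithin (tripleProg f b w) s (60 * s.reg 0 + 47)
      (Tab (triple (s.reg 14) (s.reg 16) (s.reg f) (s.reg b) (s.reg 19) (s.reg w) (s.reg 30) (s.reg 33)
        G)) := by
  have hreg : ∀ {x a c o : ℕ} {s s' : State}, Frame (orSub x a c o) s s' → 34 ≤ o →
      ∀ r, 10 ≤ r → r ≤ 33 → s'.reg r = s.reg r := by
    intro x a c o s s' h ho r h1 h2
    refine h.reg r ?_
    simp [orSub, orBody, block, writesReg, Instr.regTarget]
    omega
  have hreg0 : ∀ {x a c o : ℕ} {s s' : State}, Frame (orSub x a c o) s s' → 34 ≤ o →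
      s'.reg 0 = s.reg 0 := by
    intro x a c o s s' h ho
    refine h.reg 0 ?_
    simp [orSub, orBody, block, writesReg, Instr.regTarget]
    omega
  have hmem : ∀ {x a c o : ℕ} {s s' : State}, Frame (orSub x a c o) s s' → s'.mem = s.mem :=
    fun h => funext fun i => h.mem i rfl
  refine HaltsWithin.mono (T := (15 * s.reg 0 + 7) + ((15 * s.reg 0 + 7) + ((15 * s.reg 0 + 7) +
    ((15 * s.reg 0 + 7) + 19)))) ?_ (by omega) fun _ h => h
  refine (orSub_spec (by norm_num) (by omega) (by norm_num) hpow h30 hfm).seq fun s1 e34 f1 => ?_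
  have z1 := hreg0 f1 (by norm_num)
  have r1 := hreg f1 (by norm_num)
  have m1 := hmem f1
  rw [← z1]
  refine (orSub_spec (by norm_num) (by omega) (by norm_num) (by rw [z1, m1]; exact hpow)
    (by rw [z1, r1 33 (by norm_num) (by norm_num)]; exact h33)
    (by rw [z1, r1 b (by omega) (by omega)]; exact hbm)).seq fun s2 e35 f2 => ?_
  have z2 := (hreg0 f2 (by norm_num)).trans z1
  have r2 : ∀ r, 10 ≤ r → r ≤ 33 → s2.reg r = s.reg r := fun r h h' =>
    (hreg f2 (by norm_num) r h h').trans (r1 r h h')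
  have m2 := (hmem f2).trans m1
  rw [z1, ← z2]
  refine (orSub_spec (by norm_num) (by omega) (by norm_num) (by rw [z2, m2]; exact hpow)
    (by rw [z2, r2 30 (by norm_num) (by norm_num)]; exact h30)
    (by rw [z2, r2 19 (by omega) (by omega)]; exact h19)).seq fun s3 e36 f3 => ?_
  have z3 := (hreg0 f3 (by norm_num)).trans z2
  have r3 : ∀ r, 10 ≤ r → r ≤ 33 → s3.reg r = s.reg r := fun r h h' =>
    (hreg f3 (by norm_num) r h h').trans (r2 r h h')
  have m3 := (hmem f3).trans m2
  rw [z2, ← z3]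
  refine (orSub_spec (by norm_num) (by omega) (by norm_num) (by rw [z3, m3]; exact hpow)
    (by rw [z3, r3 33 (by norm_num) (by norm_num)]; exact h33)
    (by rw [z3, r3 19 (by omega) (by omega)]; exact h19)).seq fun s4 e37 f4 => ?_
  have r4 : ∀ r, 10 ≤ r → r ≤ 33 → s4.reg r = s.reg r := fun r h h' =>
    (hreg f4 (by norm_num) r h h').trans (r3 r h h')
  have m4 := (hmem f4).trans m3
  have g34 : s4.reg 34 = image (s.reg f) (s.reg 19) (s.reg 30) := by
    rw [f4.reg 34 rfl, f3.reg 34 rfl, f2.reg 34, e34]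
    simp [orSub, orBody, block, writesReg, Instr.regTarget]
  have g35 : s4.reg 35 = image (s.reg b) (s.reg 19) (s.reg 33) := by
    rw [f4.reg 35 rfl, f3.reg 35 rfl, e35, r1 b (by omega) (by omega), r1 19 (by omega) (by omega),
      r1 33 (by omega) (by omega)]
  have g36 : s4.reg 36 = image (s.reg 19) (s.reg 30) (s.reg 30) := by
    rw [f4.reg 36 rfl, e36, r2 19 (by omega) (by omega), r2 30 (by omega) (by omega)]
  have g37 : s4.reg 37 = image (s.reg 19) (s.reg 33) (s.reg 33) := by
    rw [e37, r3 19 (by omega) (by omega), r3 33 (by omega) (by omega)]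
  have g14 := r4 14 (by norm_num) (by norm_num)
  have g16 := r4 16 (by norm_num) (by norm_num)
  have g30 := r4 30 (by norm_num) (by norm_num)
  have g33 := r4 33 (by norm_num) (by norm_num)
  have gw := r4 w (by omega) (by omega)
  have c36 := image_self_eq_zero (s.reg 30) (s.reg 19)
  have c37 := image_self_eq_zero (s.reg 33) (s.reg 19)
  rw [← g36] at c36
  rw [← g37] at c37
  obtain ⟨hc, hbst⟩ := hG
  rw [← m4] at hc hbst
  set W := s.reg 16 + image (s.reg f) (s.reg 19) (s.reg 30) + s.reg 33 with hW
  set V := act (s.reg 30 ||| s.reg 19 = s.reg 30 ∨ s.reg 33 ||| s.reg 19 = s.reg 33) (s.reg w)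
    (G (s.reg 14 + s.reg 30 + image (s.reg b) (s.reg 19) (s.reg 33))) with hV
  refine HaltsWithin.mono (T := 7 + (3 + (2 + 7))) ?_ (by omega) fun _ h => h
  refine (HaltsWithin.of_eval (R := fun s5 => s5.reg 38 = W ∧
    s5.reg 40 = (G (s.reg 14 + s.reg 30 + image (s.reg b) (s.reg 19) (s.reg 33))).1 ∧
    s5.reg 41 = (G (s.reg 14 + s.reg 30 + image (s.reg b) (s.reg 19) (s.reg 33))).2.val ∧
    s5.reg 42 = 0) rfl le_rfl ?_).seq ?_
  · simp [Prog.eval, block, Instr.apply, g16, g34, g33, g14, g30, g35, hc, hbst, hW]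
  rintro s5 ⟨i38, i40, i41, i42⟩ f5
  have i36 : s5.reg 36 = s4.reg 36 := f5.reg 36 rfl
  have i37 : s5.reg 37 = s4.reg 37 := f5.reg 37 rfl
  have iw : s5.reg w = s.reg w := by
    rw [f5.reg w, gw]
    simp [block, writesReg, Instr.regTarget]
    omega
  rw [act_apply] at hV
  refine (HaltsWithin.of_eval (T := 3) (R := fun s6 => s6.reg 38 = W ∧ s6.reg 40 = V.1 ∧
    (if s6.reg 41 = 0 then 0 else s6.reg 41 + s6.reg 42) = V.2.val ∧ s6.mem = s4.mem) rfl
    (by simp [len, block]) ?_).seq ?_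
  · have m5 : s5.mem = s4.mem := funext fun i => f5.mem i rfl
    by_cases k36 : s4.reg 36 = 0
    · simp [Prog.eval, block, Instr.apply, i36, i38, i40, i41, i42, iw, k36, hV, c36.1 k36, m5]
    · by_cases k37 : s4.reg 37 = 0
      · simp [Prog.eval, block, Instr.apply, i36, i37, i38, i40, i41, i42, iw, k36, k37, hV, c37.1 k37, m5]
      · have n36 := mt c36.2 k36
        have n37 := mt c37.2 k37
        simp [Prog.eval, block, Instr.apply, i36, i37, i38, i41, i42, k36, k37, hV, n36, n37, m5]
  rintro s6 ⟨j38, j40, j41, jm⟩ -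
  refine (HaltsWithin.of_eval (R := fun s7 => s7.reg 38 = W ∧ s7.reg 40 = V.1 ∧
    s7.reg 41 = V.2.val ∧ s7.mem = s4.mem) rfl (by decide) ?_).seq ?_
  · by_cases k : s6.reg 41 = 0
    · simp [k] at j41
      simp [Prog.eval, j38, j40, k, jm, ← j41]
    · simp [k] at j41
      simp [Prog.eval, block, Instr.apply, j38, j40, k, jm, j41]
  rintro s7 ⟨l38, l40, l41, lm⟩ -
  rw [← lm] at hc hbst
  refine HaltsWithin.of_eval rfl le_rfl ?_
  have hG' : ∀ x, triple (s.reg 14) (s.reg 16) (s.reg f) (s.reg b) (s.reg 19) (s.reg w) (s.reg 30)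
      (s.reg 33) G x = if x = W then G W + V else G x := fun x => by
    rw [triple, Function.update_apply]
  constructor
  · intro x
    rw [hG']
    by_cases hx : x = W <;> simp [Prog.eval, block, Instr.apply, hx, l38, l40, hc]
  · intro x
    rw [hG']
    by_cases hx : x = W
    -- The machine computes a maximum as `x + (v - x)` with truncated subtraction.
    · simp [Prog.eval, block, Instr.apply, hx, l38, l41, hbst]
      omega
    · simp [Prog.eval, block, Instr.apply, hx, l38, hbst]

/-- `pairStep` for the set in `reg 30` and the next set of the second list. -/
def pairProg : Prog :=
  .seq (block [.load 33 22 31, .add 31 31 11, .sub 32 32 11])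
    (.seq (tripleProg 17 20 22) (.branch 19 .skip (tripleProg 18 21 23)))

/-- All pairs with the next set of the first list. -/
def rowProg : Prog :=
  .seq (block [.load 30 16 24, .add 24 24 11, .sub 26 26 11, .const 31 0, .add 32 28 31, .add 31 27 31])
    (.loop 32 pairProg)

/-- The registers hold the masks and weights of `e`. -/
structure EltRegs (e : Elt) (s : State) : Prop where
  f0 : s.reg 17 = e.fwd false
  f1 : s.reg 18 = e.fwd true
  self : s.reg 19 = e.self
  b0 : s.reg 20 = e.bwd false
  b1 : s.reg 21 = e.bwd true
  w0 : s.reg 22 = e.weight false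
  w1 : s.reg 23 = e.weight true

/-- All masks are sets of `m` clauses. -/
structure Elt.Lt (e : Elt) (m : ℕ) : Prop where
  fwd : ∀ b, e.fwd b < 2 ^ m
  bwd : ∀ b, e.bwd b < 2 ^ m
  self : e.self < 2 ^ m

theorem pairProg_spec {e : Elt} {s : State} {G : ℕ → Val} (he : EltRegs e s) (hlt : e.Lt (s.reg 0))
    (hpow : ∀ i < s.reg 0, s.mem 4 i = 2 ^ i) (h30 : s.reg 30 < 2 ^ s.reg 0)
    (h33 : s.mem 22 (s.reg 31) < 2 ^ s.reg 0) (h11 : s.reg 11 = 1) (hG : Tab G s) :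
    HaltsWithin pairProg s (120 * s.reg 0 + 98) (fun s' => s'.reg 31 = s.reg 31 + 1 ∧
      s'.reg 32 = s.reg 32 - 1 ∧
      Tab (pairStep (s.reg 14) (s.reg 16) e (s.reg 30) (s.mem 22 (s.reg 31)) G) s') := by
  refine HaltsWithin.mono (T := 3 + ((60 * s.reg 0 + 47) + (60 * s.reg 0 + 47 + 1))) ?_ (by omega)
    fun _ h => h
  refine (HaltsWithin.of_eval (R := fun s1 => s1.reg 33 = s.mem 22 (s.reg 31) ∧
    s1.reg 31 = s.reg 31 + 1 ∧ s1.reg 32 = s.reg 32 - 1) rfl le_rfl ?_).seq ?_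
  · simp [Prog.eval, block, Instr.apply, h11]
  rintro s1 ⟨e33, e31, e32⟩ f1
  have m1 : s1.mem = s.mem := funext fun i => f1.mem i rfl
  have z1 : s1.reg 0 = s.reg 0 := f1.reg 0 rfl
  have e17 := (f1.reg 17 rfl).trans he.f0
  have e19 := (f1.reg 19 rfl).trans he.self
  have e20 := (f1.reg 20 rfl).trans he.b0
  have e22 := (f1.reg 22 rfl).trans he.w0
  have e14 : s1.reg 14 = s.reg 14 := f1.reg 14 rfl
  have e16 : s1.reg 16 = s.reg 16 := f1.reg 16 rfl
  have e30 : s1.reg 30 = s.reg 30 := f1.reg 30 rfl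
  have t1 := tripleProg_spec (f := 17) (b := 20) (w := 22) (by norm_num) (by norm_num) (by norm_num)
    (s := s1) (G := G) (by rw [z1, m1]; exact hpow) (by rw [z1, e30]; exact h30)
    (by rw [z1, e33]; exact h33) (by rw [z1, e19]; exact hlt.self) (by rw [z1, e17]; exact hlt.fwd _)
    (by rw [z1, e20]; exact hlt.bwd _) (hG.congr m1)
  rw [z1, e14, e16, e17, e20, e19, e22, e30, e33] at t1
  refine t1.seq fun s2 hG2 f2 => ?_
  have m2 : s2.mem 4 = s.mem 4 := (f2.mem 4 rfl).trans (f1.mem 4 rfl)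
  have z2 : s2.reg 0 = s.reg 0 := (f2.reg 0 rfl).trans z1
  have g18 := ((f2.reg 18 rfl).trans (f1.reg 18 rfl)).trans he.f1
  have g19 := (f2.reg 19 rfl).trans e19
  have g21 := ((f2.reg 21 rfl).trans (f1.reg 21 rfl)).trans he.b1
  have g23 := ((f2.reg 23 rfl).trans (f1.reg 23 rfl)).trans he.w1
  have g14 := (f2.reg 14 rfl).trans e14
  have g16 := (f2.reg 16 rfl).trans e16
  have g30 := (f2.reg 30 rfl).trans e30
  have g31 := (f2.reg 31 rfl).trans e31
  have g32 := (f2.reg 32 rfl).trans e32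
  have g33 := (f2.reg 33 rfl).trans e33
  refine HaltsWithin.branch (fun h => ?_) (fun h => ?_)
  · rw [g19] at h
    refine HaltsWithin.of_eval rfl (by simp [len]) ⟨g31, g32, ?_⟩
    simp only [Prog.eval, pairStep, if_neg h]
    exact hG2
  · rw [g19] at h
    have t2 := tripleProg_spec (f := 18) (b := 21) (w := 23) (by norm_num) (by norm_num) (by norm_num)
      (s := s2) (by rw [z2, m2]; exact hpow) (by rw [z2, g30]; exact h30)
      (by rw [z2, g33]; exact h33) (by rw [z2, g19]; exact hlt.self)
      (by rw [z2, g18]; exact hlt.fwd _) (by rw [z2, g21]; exact hlt.bwd _) hG2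
    rw [z2, g14, g16, g18, g21, g19, g23, g30, g33] at t2
    refine t2.framed.mono le_rfl fun s3 h3 => ⟨(h3.2.reg 31 rfl).trans g31,
      (h3.2.reg 32 rfl).trans g32, ?_⟩
    simp only [pairStep, if_pos h]
    exact h3.1

theorem EltRegs.frame {e : Elt} {s s' : State} (h : EltRegs e s)
    (hr : ∀ r, 17 ≤ r → r ≤ 23 → s'.reg r = s.reg r) : EltRegs e s' :=
  ⟨(hr 17 (by norm_num) (by norm_num)).trans h.f0, (hr 18 (by norm_num) (by norm_num)).trans h.f1,
    (hr 19 (by norm_num) (by norm_num)).trans h.self, (hr 20 (by norm_num) (by norm_num)).trans h.b0,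
    (hr 21 (by norm_num) (by norm_num)).trans h.b1, (hr 22 (by norm_num) (by norm_num)).trans h.w0,
    (hr 23 (by norm_num) (by norm_num)).trans h.w1⟩

theorem pairProg_writesReg (r : ℕ) (h : 17 ≤ r) (h' : r ≤ 23) : pairProg.writesReg r = false := by
  simp [pairProg, tripleProg, orSub, orBody, block, writesReg, Instr.regTarget]
  omega

theorem rowProg_writesReg (r : ℕ) (h : 17 ≤ r) (h' : r ≤ 23) : rowProg.writesReg r = false := by
  simp [rowProg, pairProg, tripleProg, orSub, orBody, block, writesReg, Instr.regTarget]
  omega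

theorem rowProg_spec {e : Elt} {s : State} {G : ℕ → Val} {l' : List ℕ} (he : EltRegs e s)
    (hlt : e.Lt (s.reg 0)) (hpow : ∀ i < s.reg 0, s.mem 4 i = 2 ^ i)
    (h30 : s.mem 16 (s.reg 24) < 2 ^ s.reg 0) (hl' : ListAt (s.mem 22) (s.reg 27) l')
    (hlt' : ∀ z ∈ l', z < 2 ^ s.reg 0) (h28 : s.reg 28 = l'.length) (h11 : s.reg 11 = 1)
    (hG : Tab G s) :
    HaltsWithin rowProg s (l'.length * (120 * s.reg 0 + 99) + 7) (fun s' =>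
      s'.reg 24 = s.reg 24 + 1 ∧ s'.reg 26 = s.reg 26 - 1 ∧
      Tab (l'.foldl (fun G z' => pairStep (s.reg 14) (s.reg 16) e (s.mem 16 (s.reg 24)) z' G) G) s') := by
  refine HaltsWithin.mono (T := 6 + (l'.length * ((120 * s.reg 0 + 98) + 1) + 1)) ?_
    (by simp only [Nat.add_assoc, Nat.reduceAdd]; omega)
    fun _ h => h
  refine (HaltsWithin.of_eval (R := fun s1 => s1.reg 30 = s.mem 16 (s.reg 24) ∧
    s1.reg 24 = s.reg 24 + 1 ∧ s1.reg 26 = s.reg 26 - 1 ∧ s1.reg 31 = s.reg 27 ∧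
    s1.reg 32 = l'.length) rfl le_rfl ?_).seq ?_
  · simp [Prog.eval, block, Instr.apply, h11, h28]
  rintro s1 ⟨e30, e24, e26, e31, e32⟩ f1
  have m1 : s1.mem = s.mem := funext fun i => f1.mem i rfl
  have z1 : s1.reg 0 = s.reg 0 := f1.reg 0 rfl
  refine HaltsWithin.mono (HaltsWithin.loop (N := l'.length) (c := 120 * s.reg 0 + 98) (fun i s' =>
    s'.reg 32 = l'.length - i ∧ s'.reg 31 = s.reg 27 + i ∧
    Tab ((l'.take i).foldl (fun G z' => pairStep (s.reg 14) (s.reg 16) e (s.mem 16 (s.reg 24)) z' G) G)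
      s') ?_ ?_ ?_) le_rfl ?_
  · exact ⟨by simp [e32], by simp [e31], by simpa using hG.congr m1⟩
  · rintro i s' hi ⟨g32, g31, hG'⟩ hf
    refine ⟨by omega, ?_⟩
    have z' : s'.reg 0 = s.reg 0 := (hf.reg 0 rfl).trans z1
    have g30 : s'.reg 30 = s.mem 16 (s.reg 24) := (hf.reg 30 rfl).trans e30
    have g14 : s'.reg 14 = s.reg 14 := (hf.reg 14 rfl).trans (f1.reg 14 rfl)
    have g16 : s'.reg 16 = s.reg 16 := (hf.reg 16 rfl).trans (f1.reg 16 rfl)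
    have g22 : s'.mem 22 = s.mem 22 := (hf.mem 22 rfl).trans (f1.mem 22 rfl)
    have hget : s'.mem 22 (s'.reg 31) = l'[i] := by
      rw [g22, g31, hl' i hi]
      simp [hi]
    have he' : EltRegs e s' := he.frame fun r h h' =>
      (hf.reg r (pairProg_writesReg r h h')).trans (f1.reg r (by
        simp [block, writesReg, Instr.regTarget]; omega))
    have hp := pairProg_spec (G := _) he' (by rw [z']; exact hlt)
      (by rw [z', hf.mem 4 rfl, m1]; exact hpow) (by rw [z', g30]; exact h30)
      (by rw [z', hget]; exact hlt' _ (List.getElem_mem hi))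
      (((hf.reg 11 rfl).trans (f1.reg 11 rfl)).trans h11) hG'
    rw [z', g14, g16, g30, hget, g31, g32] at hp
    refine hp.mono le_rfl ?_
    rintro s'' ⟨k31, k32, kG⟩
    refine ⟨by omega, by omega, ?_⟩
    rw [List.take_add_one, List.getElem?_eq_getElem hi, Option.toList_some, List.foldl_append]
    exact kG
  · rintro s' ⟨h, -⟩; omega
  · rintro s' ⟨⟨-, -, hG'⟩, hf⟩
    rw [List.take_length] at hG'
    exact ⟨(hf.reg 24 rfl).trans e24, (hf.reg 26 rfl).trans e26, hG'⟩

/-- The table for one more element. -/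
def sweepProg : Prog :=
  .seq (block [.sub 13 13 11, .add 16 14 15, .load 17 13 12, .load 18 14 12, .load 19 15 12,
      .load 20 19 13, .load 21 20 13, .load 22 25 12, .load 23 26 12, .load 24 17 12, .add 25 12 11,
      .load 26 17 25, .sub 26 26 24, .load 27 23 13, .add 28 13 11, .load 28 23 28, .sub 28 28 27])
    (.seq (.loop 26 rowProg) (block [.const 14 0, .add 14 16 14, .add 12 12 11]))

/-- The tables for all elements. -/
def tableProg : Prog :=
  .seq (block [.const 10 0, .const 11 1, .const 12 0, .add 13 0 1, .const 14 0, .load 15 4 0,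
      .store 27 10 11, .store 28 10 11])
    (.loop 13 sweepProg)

/-- Forward data are indexed by `t`, backward data by the distance `N - 1 - t` from the end, because
the backward lists grow from the last cut. -/
theorem sweepProg_spec {e : Elt} {s : State} {G : ℕ → Val} {l l' : List ℕ} {N t K : ℕ}
    (hlt : e.Lt (s.reg 0)) (hpow : ∀ i < s.reg 0, s.mem 4 i = 2 ^ i) (h12 : s.reg 12 = t)
    (h13 : s.reg 13 = N - t) (h11 : s.reg 11 = 1) (f0 : s.mem 13 t = e.fwd false)
    (f1 : s.mem 14 t = e.fwd true)
    (hself : s.mem 15 t = e.self) (b0 : s.mem 19 (N - 1 - t) = e.bwd false)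
    (b1 : s.mem 20 (N - 1 - t) = e.bwd true)
    (w0 : s.mem 25 t = e.weight false) (w1 : s.mem 26 t = e.weight true)
    (hl : ListAt (s.mem 16) (s.mem 17 t) l) (hlen : s.mem 17 (t + 1) = s.mem 17 t + l.length)
    (hl' : ListAt (s.mem 22) (s.mem 23 (N - 1 - t)) l')
    (hlen' : s.mem 23 (N - 1 - t + 1) = s.mem 23 (N - 1 - t) + l'.length)
    (hlm : ∀ z ∈ l, z < 2 ^ s.reg 0) (hlm' : ∀ z ∈ l', z < 2 ^ s.reg 0)
    (hK : l.length ≤ K) (hK' : l'.length ≤ K) (hG : Tab G s) :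
    HaltsWithin sweepProg s (K * (K * (120 * s.reg 0 + 99) + 8) + 21) (fun s' =>
      s'.reg 12 = t + 1 ∧ s'.reg 13 = N - (t + 1) ∧ s'.reg 14 = s.reg 14 + s.reg 15 ∧
      Tab (sweep (s.reg 14) (s.reg 14 + s.reg 15) e l l' G) s') := by
  refine HaltsWithin.mono (T := 17 + ((l.length * ((K * (120 * s.reg 0 + 99) + 7) + 1) + 1) + 3)) ?_ ?_
    fun _ h => h
  swap
  · have := Nat.mul_le_mul_right (K * (120 * s.reg 0 + 99) + 8) hK
    simp only [Nat.add_assoc, Nat.reduceAdd] at this ⊢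
    omega
  have hN : N - t - 1 = N - 1 - t := by omega
  refine (HaltsWithin.of_eval (R := fun s1 => EltRegs e s1 ∧ s1.reg 13 = N - 1 - t ∧
    s1.reg 16 = s.reg 14 + s.reg 15 ∧ s1.reg 24 = s.mem 17 t ∧ s1.reg 26 = l.length ∧
    s1.reg 27 = s.mem 23 (N - 1 - t) ∧ s1.reg 28 = l'.length) rfl le_rfl ?_).seq ?_
  · refine ⟨?_, ?_⟩
    · constructor <;> simp [Prog.eval, block, Instr.apply, *]
    · simp [Prog.eval, block, Instr.apply, h11, h12, h13, hN, hlen, hlen']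
  rintro s1 ⟨he, e13, e16, e24, e26, e27, e28⟩ fr1
  have m1 : s1.mem = s.mem := funext fun i => fr1.mem i rfl
  have z1 : s1.reg 0 = s.reg 0 := fr1.reg 0 rfl
  have e14 : s1.reg 14 = s.reg 14 := fr1.reg 14 rfl
  refine HaltsWithin.seq (HaltsWithin.loop (N := l.length) (c := K * (120 * s.reg 0 + 99) + 7)
    (fun i s' => s'.reg 26 = l.length - i ∧ s'.reg 24 = s.mem 17 t + i ∧
      Tab (sweep (s.reg 14) (s.reg 14 + s.reg 15) e (l.take i) l' G) s') ?_ ?_ ?_) ?_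
  · exact ⟨by simp [e26], by simp [e24], by simpa [sweep] using hG.congr m1⟩
  · rintro i s' hi ⟨g26, g24, hG'⟩ hf
    refine ⟨by omega, ?_⟩
    have z' : s'.reg 0 = s.reg 0 := (hf.reg 0 rfl).trans z1
    have g14 : s'.reg 14 = s.reg 14 := (hf.reg 14 rfl).trans e14
    have g16 : s'.reg 16 = s.reg 14 + s.reg 15 := (hf.reg 16 rfl).trans e16
    have g27 := (hf.reg 27 rfl).trans e27
    have g28 := (hf.reg 28 rfl).trans e28
    have gm : s'.mem 16 = s.mem 16 := by rw [hf.mem 16 rfl, m1]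
    have gm' : s'.mem 22 = s.mem 22 := by rw [hf.mem 22 rfl, m1]
    have hget : s'.mem 16 (s'.reg 24) = l[i] := by
      rw [gm, g24, hl i hi]
      simp [hi]
    have hp := rowProg_spec (l' := l') (he.frame fun r h h' => hf.reg r (rowProg_writesReg r h h'))
      (by rw [z']; exact hlt)
      (by rw [z', hf.mem 4 rfl, m1]; exact hpow)
      (by rw [z', hget]; exact hlm _ (List.getElem_mem hi)) (by rw [gm', g27]; exact hl')
      (by rw [z']; exact hlm') g28 (((hf.reg 11 rfl).trans (fr1.reg 11 rfl)).trans h11) hG'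
    rw [z', g14, g16, hget, g24, g26] at hp
    refine hp.mono (Nat.add_le_add_right (Nat.mul_le_mul_right _ hK') _) ?_
    rintro s'' ⟨k24, k26, kG⟩
    refine ⟨by omega, by omega, ?_⟩
    rw [List.take_add_one, List.getElem?_eq_getElem hi, Option.toList_some, sweep, List.foldl_append]
    exact kG
  · rintro s' ⟨h, -⟩; omega
  rintro s2 ⟨⟨-, -, hG2⟩, f2⟩ -
  rw [List.take_length] at hG2
  have k12 : s2.reg 12 = t := ((f2.reg 12 rfl).trans (fr1.reg 12 rfl)).trans h12
  have k13 : s2.reg 13 = N - 1 - t := (f2.reg 13 rfl).trans e13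
  have k16 := (f2.reg 16 rfl).trans e16
  have k11 : s2.reg 11 = 1 := ((f2.reg 11 rfl).trans (fr1.reg 11 rfl)).trans h11
  refine HaltsWithin.of_eval rfl le_rfl ⟨?_, ?_, ?_, hG2.congr rfl⟩
  · simp [Prog.eval, block, Instr.apply, k12, k11]
  · simp [Prog.eval, block, Instr.apply, k13]; omega
  · simp [Prog.eval, block, Instr.apply, k16]

section

variable {L : Bool → ℕ → ℕ → ℕ} {m n : ℕ} {g : ℕ → ℕ}

/-- The segments hold the masks and weights of all elements. -/
structure Masks (L : Bool → ℕ → ℕ → ℕ) (m n : ℕ) (g : ℕ → ℕ) (s : State) : Prop where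
  f0 : ∀ t < m + n, s.mem 13 t = maskF L m g false t
  f1 : ∀ t < m + n, s.mem 14 t = maskF L m g true t
  self : ∀ t < m + n, s.mem 15 t = maskC g t
  b0 : ∀ t < m + n, s.mem 19 (m + n - 1 - t) = maskB L g false t
  b1 : ∀ t < m + n, s.mem 20 (m + n - 1 - t) = maskB L g true t
  self' : ∀ t < m + n, s.mem 21 (m + n - 1 - t) = maskC g t
  w0 : ∀ t < m + n, s.mem 25 t = weight n g false t
  w1 : ∀ t < m + n, s.mem 26 t = weight n g true t

theorem elt_lt (hg : IsGapSeq m n g) {t : ℕ} (ht : t < m + n) : (elt L m n g t).Lt m := by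
  by_cases h : IsVar g t
  · have hle := (pos_le hg ht.le).1
    refine ⟨fun b => ?_, fun b => ?_, ?_⟩
    · simp only [elt, maskF, if_pos h]; exact code_lt _ _ _
    · simp only [elt, maskB, if_pos h]
      exact lt_of_lt_of_le (code_lt _ _ _) (Nat.pow_le_pow_right (by norm_num) hle)
    · simp only [elt, maskC, if_pos h]; positivity
  · have := Nat.pow_lt_pow_right (show 1 < 2 by norm_num) (pos_lt_of_clause hg ht h)
    exact ⟨fun b => by simpa only [elt, maskF, if_neg h], fun b => by simpa only [elt, maskB, if_neg h],
      by simpa only [elt, maskC, if_neg h]⟩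

theorem reach_congr {a a' b c c' d : ℕ → ℕ} {u : ℕ} (h : ∀ v < u, a v = c v)
    (h' : ∀ v < u, a' v = c' v) (h'' : ∀ v < u, b v = d v) : reach a a' b u = reach c c' d u := by
  induction u with
  | zero => rfl
  | succ u ih =>
    rw [reach, reach, h u (by omega), h' u (by omega), h'' u (by omega),
      ih (fun v hv => h v (by omega)) (fun v hv => h' v (by omega)) fun v hv => h'' v (by omega)]

theorem Masks.reach_fwd {s : State} (h : Masks L m n g s) {u : ℕ} (hu : u ≤ m + n) :
    reach (s.mem 13) (s.mem 14) (s.mem 15) u = fwdList L m g u :=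
  reach_congr (fun v hv => h.f0 v (by omega)) (fun v hv => h.f1 v (by omega))
    fun v hv => h.self v (by omega)

theorem Masks.reach_bwd {s : State} (h : Masks L m n g s) {u : ℕ} (hu : u ≤ m + n) :
    reach (s.mem 19) (s.mem 20) (s.mem 21) u = bwdList L m n g u := by
  have hv : ∀ v < u, m + n - 1 - (m + n - 1 - v) = v := fun v hv => by omega
  refine reach_congr (fun v hvu => ?_) (fun v hvu => ?_) fun v hvu => ?_
  · rw [← h.b0 _ (by omega), hv v hvu]
  · rw [← h.b1 _ (by omega), hv v hvu]
  · rw [← h.self' _ (by omega), hv v hvu]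

/-- The tables of successive cuts occupy successive blocks of `2 ^ m` addresses. Only cells reached
by some pair are touched, and sums start from unwritten cells, hence the assumptions `h27` and
`h28`. -/
theorem tableProg_spec (hg : IsGapSeq m n g) {K : ℕ} {s : State} (h0 : s.reg 0 = m) (h1 : s.reg 1 = n)
    (hpow : ∀ i ≤ m, s.mem 4 i = 2 ^ i) (hm : Masks L m n g s)
    (hF : ∀ u ≤ m + n, ListAt (s.mem 16) (s.mem 17 u) (fwdList L m g u) ∧
      s.mem 17 (u + 1) = s.mem 17 u + (fwdList L m g u).length)
    (hB : ∀ u ≤ m + n, ListAt (s.mem 22) (s.mem 23 u) (bwdList L m n g u) ∧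
      s.mem 23 (u + 1) = s.mem 23 u + (bwdList L m n g u).length)
    (hKF : ∀ u ≤ m + n, (fwdList L m g u).length ≤ K)
    (hKB : ∀ u ≤ m + n, (bwdList L m n g u).length ≤ K)
    (h27 : ∀ x, s.mem 27 x = 0) (h28 : ∀ x, s.mem 28 x = 0) :
    HaltsWithin tableProg s ((m + n) * (K * (K * (120 * m + 99) + 8) + 22) + 9) (fun s' =>
      s'.reg 14 = (m + n) * 2 ^ m ∧ Tab (table L m n g (m + n)) s') := by
  refine HaltsWithin.mono (T := 8 + ((m + n) * ((K * (K * (120 * m + 99) + 8) + 21) + 1) + 1)) ?_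
    (by simp only [Nat.add_assoc, Nat.reduceAdd]; omega) fun _ h => h
  refine (HaltsWithin.of_eval (R := fun s1 => s1.reg 11 = 1 ∧ s1.reg 12 = 0 ∧ s1.reg 13 = m + n ∧
    s1.reg 14 = 0 ∧ s1.reg 15 = 2 ^ m ∧ Tab (table L m n g 0) s1) rfl le_rfl ?_).seq ?_
  · refine ⟨by simp [Prog.eval, block, Instr.apply], by simp [Prog.eval, block, Instr.apply],
      by simp [Prog.eval, block, Instr.apply, h0, h1], by simp [Prog.eval, block, Instr.apply],
      by simp [Prog.eval, block, Instr.apply, h0, hpow m le_rfl], ?_, ?_⟩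
    · intro x
      by_cases hx : x = 0 <;> simp [Prog.eval, block, Instr.apply, table, hx, h27]
    · intro x
      by_cases hx : x = 0 <;> simp [Prog.eval, block, Instr.apply, table, hx, h28]
  rintro s1 ⟨e11, e12, e13, e14, e15, hG⟩ f1
  refine HaltsWithin.mono (HaltsWithin.loop (N := m + n) (c := K * (K * (120 * m + 99) + 8) + 21)
    (fun t s' => s'.reg 12 = t ∧ s'.reg 13 = m + n - t ∧ s'.reg 14 = t * 2 ^ m ∧
      Tab (table L m n g t) s') ?_ ?_ ?_) le_rfl ?_
  · exact ⟨e12, e13, by simp [e14], hG⟩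
  · rintro t s' ht ⟨g12, g13, g14, hG'⟩ hf
    refine ⟨by omega, ?_⟩
    have z' : s'.reg 0 = m := ((hf.reg 0 rfl).trans (f1.reg 0 rfl)).trans h0
    have g15 : s'.reg 15 = 2 ^ m := (hf.reg 15 rfl).trans e15
    have hmem : ∀ x, x ≠ 27 → x ≠ 28 → s'.mem x = s.mem x := by
      intro x h h'
      rw [hf.mem x, f1.mem x]
      · simp [block, writesSeg, Instr.segTarget]; omega
      · simp [sweepProg, rowProg, pairProg, tripleProg, orSub, orBody, block, writesSeg, Instr.segTarget]
        omega
    have hlm : ∀ z ∈ fwdList L m g t, z < 2 ^ s'.reg 0 := by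
      intro z hz
      obtain ⟨τ, rfl⟩ := (mem_fwdList _ _).1 hz
      rw [z']; exact fwd_lt _ _
    have hlm' : ∀ z ∈ bwdList L m n g (m + n - 1 - t), z < 2 ^ s'.reg 0 := by
      intro z hz
      rw [show m + n - 1 - t = m + n - (t + 1) by omega] at hz
      rw [z']
      exact lt_of_lt_of_le (lt_of_mem_bwdList hg (by omega) hz)
        (Nat.pow_le_pow_right (by norm_num) (pos_le hg (by omega)).1)
    have hp := sweepProg_spec (e := elt L m n g t) (l := fwdList L m g t)
      (l' := bwdList L m n g (m + n - 1 - t)) (N := m + n) (t := t) (K := K)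
      (by rw [z']; exact elt_lt hg ht)
      (by rw [z', hmem 4 (by norm_num) (by norm_num)]; exact fun i hi => hpow i hi.le) g12 g13
      ((hf.reg 11 rfl).trans e11)
      (by rw [hmem 13 (by norm_num) (by norm_num)]; exact hm.f0 t ht)
      (by rw [hmem 14 (by norm_num) (by norm_num)]; exact hm.f1 t ht)
      (by rw [hmem 15 (by norm_num) (by norm_num)]; exact hm.self t ht)
      (by rw [hmem 19 (by norm_num) (by norm_num)]; exact hm.b0 t ht)
      (by rw [hmem 20 (by norm_num) (by norm_num)]; exact hm.b1 t ht)
      (by rw [hmem 25 (by norm_num) (by norm_num)]; exact hm.w0 t ht)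
      (by rw [hmem 26 (by norm_num) (by norm_num)]; exact hm.w1 t ht)
      (by rw [hmem 16 (by norm_num) (by norm_num), hmem 17 (by norm_num) (by norm_num)]
          exact (hF t ht.le).1)
      (by rw [hmem 17 (by norm_num) (by norm_num)]; exact (hF t ht.le).2)
      (by rw [hmem 22 (by norm_num) (by norm_num), hmem 23 (by norm_num) (by norm_num)]
          exact (hB _ (by omega)).1)
      (by rw [hmem 23 (by norm_num) (by norm_num)]; exact (hB _ (by omega)).2)
      hlm hlm' (hKF t ht.le) (hKB _ (by omega)) hG'
    rw [z', g14, g15] at hp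
    refine hp.mono le_rfl ?_
    rintro s'' ⟨k12, k13, k14, kG⟩
    rw [show t * 2 ^ m + 2 ^ m = (t + 1) * 2 ^ m by ring] at k14 kG
    exact ⟨k12, k13, k14, kG⟩
  · rintro s' ⟨-, h, -⟩; omega
  · rintro s' ⟨⟨-, -, h, hG'⟩, -⟩
    exact ⟨h, hG'⟩

end

end KInterval

namespace KInterval

open Prog

/-! ### Reading the input -/

/-- Fill segment 4 with powers of two. -/
def powProg : Prog :=
  .seq (block [.const 11 1, .add 12 0 1, .add 12 12 11, .const 13 0, .const 14 1])
    (.loop 12 (block [.store 4 13 14, .add 14 14 14, .add 13 13 11, .sub 12 12 11]))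

/-- Exponents up to `m + n` cover the bits of clause sets and assignments, the block size `2 ^ m`
and the clause weight `2 ^ n`. -/
theorem powProg_spec (s : State) :
    HaltsWithin powProg s ((s.reg 0 + s.reg 1 + 1) * 5 + 6) (fun s' =>
      ∀ i ≤ s.reg 0 + s.reg 1, s'.mem 4 i = 2 ^ i) := by
  set N := s.reg 0 + s.reg 1 with hN
  refine HaltsWithin.mono (T := 5 + ((N + 1) * (4 + 1) + 1)) ?_ (by omega) fun _ h => h
  refine (HaltsWithin.of_eval (R := fun s1 => s1.reg 11 = 1 ∧ s1.reg 12 = N + 1 ∧ s1.reg 13 = 0 ∧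
    s1.reg 14 = 1) rfl le_rfl ?_).seq ?_
  · simp [Prog.eval, block, Instr.apply, hN]
  rintro s1 ⟨e11, e12, e13, e14⟩ -
  refine HaltsWithin.mono (HaltsWithin.loop (N := N + 1) (c := 4) (fun i s' => s'.reg 12 = N + 1 - i ∧
    s'.reg 13 = i ∧ s'.reg 14 = 2 ^ i ∧ ∀ x < i, s'.mem 4 x = 2 ^ x) ?_ ?_ ?_) le_rfl ?_
  · simp [e12, e13, e14]
  · rintro i s' hi ⟨g12, g13, g14, hm⟩ hf
    have g11 : s'.reg 11 = 1 := (hf.reg 11 rfl).trans e11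
    refine ⟨by omega, HaltsWithin.of_eval rfl le_rfl ⟨?_, ?_, ?_, fun x hx => ?_⟩⟩
    · simp [Prog.eval, block, Instr.apply, g11, g12]; omega
    · simp [Prog.eval, block, Instr.apply, g11, g13]
    · simp [Prog.eval, block, Instr.apply, g14]; ring
    · simp only [Prog.eval, block, Instr.apply, g13, g14, Function.update_self]
      by_cases h : x = i
      · rw [h, Function.update_self]
      · rw [Function.update_of_ne h, hm x (by omega)]
  · rintro s' ⟨h, -⟩; omega
  · rintro s' ⟨⟨-, -, -, h⟩, -⟩ i hi
    exact h i (by omega)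

/-- `mem dst (mem src i) := i * reg 16`, for all `i` below `reg cnt`. -/
def invProg (src dst cnt : ℕ) : Prog :=
  .seq (block [.const 11 1, .const 13 0, .add 12 cnt 13, .const 14 0])
    (.loop 12 (block [.load 15 src 13, .store dst 15 14, .add 14 14 16, .add 13 13 11, .sub 12 12 11]))

/-- With `reg 16 = 1` this inverts the order of the variables; with `reg 16 = n` it gives the row
offsets of the clauses, so that a matrix address is a sum and needs no multiplication. -/
theorem invProg_spec {src dst cnt N : ℕ} (hne : src ≠ dst) (hcnt : cnt ≤ 1) {s : State}
    (hN : s.reg cnt = N) (hinj : ∀ i < N, ∀ j < N, s.mem src i = s.mem src j → i = j) :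
    HaltsWithin (invProg src dst cnt) s (N * 6 + 5) (fun s' =>
      ∀ i < N, s'.mem dst (s.mem src i) = i * s.reg 16) := by
  refine HaltsWithin.mono (T := 4 + (N * (5 + 1) + 1)) ?_ (by omega) fun _ h => h
  refine (HaltsWithin.of_eval (R := fun s1 => s1.reg 11 = 1 ∧ s1.reg 12 = N ∧ s1.reg 13 = 0 ∧
    s1.reg 14 = 0) rfl le_rfl ?_).seq ?_
  · simp [Prog.eval, block, Instr.apply, show cnt ≠ 11 by omega, show cnt ≠ 13 by omega, hN]
  rintro s1 ⟨e11, e12, e13, e14⟩ hf1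
  refine HaltsWithin.mono (HaltsWithin.loop (N := N) (c := 5) (fun i s' => s'.reg 12 = N - i ∧
    s'.reg 13 = i ∧ s'.reg 14 = i * s.reg 16 ∧ ∀ x < i, s'.mem dst (s.mem src x) = x * s.reg 16)
    ?_ ?_ ?_) le_rfl ?_
  · simp [e12, e13, e14]
  · rintro i s' hi ⟨g12, g13, g14, hm⟩ hf
    have g11 : s'.reg 11 = 1 := (hf.reg 11 rfl).trans e11
    have g16 : s'.reg 16 = s.reg 16 := (hf.reg 16 rfl).trans (hf1.reg 16 rfl)
    have gm : s'.mem src = s.mem src := by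
      rw [hf.mem src, hf1.mem src rfl]
      simp [block, writesSeg, Instr.segTarget, hne.symm]
    refine ⟨by omega, HaltsWithin.of_eval rfl le_rfl ⟨?_, ?_, ?_, fun x hx => ?_⟩⟩
    · simp [Prog.eval, block, Instr.apply, g11, g12]; omega
    · simp [Prog.eval, block, Instr.apply, g11, g13]
    · simp [Prog.eval, block, Instr.apply, g14, g16]; ring
    · simp [Prog.eval, block, Instr.apply, g13, g14, gm]
      by_cases h : x = i
      · rw [h, Function.update_self]
      · rw [Function.update_of_ne fun h' => h (hinj x (by omega) i hi h'), hm x (by omega)]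
  · rintro s' ⟨h, -⟩; omega
  · rintro s' ⟨⟨-, -, -, h⟩, -⟩
    exact h

/-- One entry of the stream. -/
def entryProg : Prog :=
  .seq (block [.load 15 0 13, .load 16 1 13, .add 13 13 11])
    (.branch 15 (.seq (block [.sub 15 15 11, .load 17 5 15, .load 18 6 14, .add 17 17 18])
        (.branch 16 (block [.store 8 17 11]) (block [.store 7 17 11])))
      (block [.add 14 14 11, .sub 12 12 11]))

/-- Turn the stream into matrices of negative and positive literals. -/
def matrixProg : Prog :=
  .seq (block [.const 11 1, .const 13 0, .add 12 0 13, .const 14 0]) (.loop 12 entryProg)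

/-- The stream `R`, starting in clause `C`, puts a literal of sign `b` into cell `a`. -/
def Marks (vp rb : ℕ → ℕ) (b : Bool) (a : ℕ) : ℕ → List (ℕ × ℕ) → Prop
  | _, [] => False
  | C, (0, _) :: R => Marks vp rb b a (C + 1) R
  | C, (v + 1, c) :: R => ((c ≠ 0 ↔ b = true) ∧ a = vp v + rb C) ∨ Marks vp rb b a C R

theorem ite_ite_eq_ite_or (P Q : Prop) [Decidable P] [Decidable Q] [Decidable (Q ∨ P)] (x y : ℕ) :
    (if P then x else if Q then x else y) = if Q ∨ P then x else y := by
  split_ifs <;> tauto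

-- The loop counter is the number of unread clause terminators. The stream ends with a terminator,
-- so the counter stays positive until the stream is used up, and there is one round per entry.
open Classical in
theorem entryProg_loop (R : List (ℕ × ℕ)) (s : State) (h11 : s.reg 11 = 1)
    (h12 : s.reg 12 = R.countP fun e => e.1 = 0) (hlast : ∀ e ∈ R.getLast?, e.1 = 0)
    (hR : ∀ q < R.length, s.mem 0 (s.reg 13 + q) = (R.getD q (0, 0)).1 ∧
      s.mem 1 (s.reg 13 + q) = (R.getD q (0, 0)).2) :
    HaltsWithin (.loop 12 entryProg) s (R.length * 11 + 1) (fun s' =>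
      ∀ (b : Bool) (a : ℕ), s'.mem (7 + b.toNat) a =
        if Marks (s.mem 5) (s.mem 6) b a (s.reg 14) R then 1 else s.mem (7 + b.toNat) a) := by
  induction R generalizing s with
  | nil =>
    refine HaltsWithin.loop_done (by simpa using h12) fun b a => ?_
    simp [Marks]
  | cons e R ih =>
    have hlast' : ∀ e ∈ R.getLast?, e.1 = 0 := by
      intro e' he'
      refine hlast e' ?_
      cases R with
      | nil => simp at he'
      | cons x R => simpa [List.getLast?_cons_cons] using he'
    have hpos : s.reg 12 ≠ 0 := by
      rw [h12]
      have hne : e :: R ≠ [] := by simp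
      have h1 := hlast ((e :: R).getLast hne) (by rw [List.getLast?_eq_some_getLast hne]; rfl)
      have : 0 < (e :: R).countP fun e => e.1 = 0 :=
        List.countP_pos_iff.2 ⟨_, List.getLast_mem hne, by simpa using h1⟩
      omega
    obtain ⟨r0, r1⟩ := hR 0 (by simp)
    simp only [add_zero, List.getD_cons_zero] at r0 r1
    have hRq : ∀ q < R.length, s.mem 0 (s.reg 13 + 1 + q) = (R.getD q (0, 0)).1 ∧
        s.mem 1 (s.reg 13 + 1 + q) = (R.getD q (0, 0)).2 := by
      intro q hq
      have := hR (q + 1) (by simp; omega)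
      rw [show s.reg 13 + 1 + q = s.reg 13 + (q + 1) by omega]
      simpa only [List.getD_cons_succ] using this
    refine HaltsWithin.mono (T := 10 + (R.length * 11 + 1) + 1) ?_ (by simp; omega) fun _ h => h
    obtain ⟨v, c⟩ := e
    simp only at r0 r1
    cases v with
    | zero =>
      refine HaltsWithin.loop_step hpos (HaltsWithin.of_eval (R := fun s' => s' = entryProg.eval s) rfl
        (by decide) rfl) ?_
      rintro s' rfl -
      have hs : (entryProg.eval s).mem = s.mem ∧ (entryProg.eval s).reg 11 = 1 ∧
          (entryProg.eval s).reg 12 = s.reg 12 - 1 ∧ (entryProg.eval s).reg 13 = s.reg 13 + 1 ∧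
          (entryProg.eval s).reg 14 = s.reg 14 + 1 := by
        simp [entryProg, Prog.eval, block, Instr.apply, r0, h11]
      obtain ⟨s1, s2, s3, s4, s5⟩ := hs
      refine (ih _ s2 ?_ hlast' ?_).mono le_rfl fun s'' h b a => ?_
      · rw [s3, h12]; simp
      · rw [s4, s1]; exact hRq
      · rw [h b a, s1, s5]; simp only [Marks]; congr
    | succ v =>
      refine HaltsWithin.loop_step hpos (HaltsWithin.of_eval (R := fun s' => s' = entryProg.eval s) rfl
        (by decide) rfl) ?_
      rintro s' rfl hf
      have hs : (entryProg.eval s).reg 11 = 1 ∧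
          (entryProg.eval s).reg 12 = s.reg 12 ∧ (entryProg.eval s).reg 13 = s.reg 13 + 1 ∧
          (entryProg.eval s).reg 14 = s.reg 14 := by
        by_cases hc : c = 0 <;>
          simp [entryProg, Prog.eval, block, Instr.apply, r0, r1, h11, hc]
      have hm : ∀ (b : Bool) (a : ℕ), (entryProg.eval s).mem (7 + b.toNat) a =
          if (c ≠ 0 ↔ b = true) ∧ a = s.mem 5 v + s.mem 6 (s.reg 14) then 1
          else s.mem (7 + b.toNat) a := by
        intro b a
        by_cases hc : c = 0 <;> cases b <;>
          simp [entryProg, Prog.eval, block, Instr.apply, r0, r1, h11, hc, Function.update_apply]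
      obtain ⟨s2, s3, s4, s5⟩ := hs
      refine (ih _ s2 ?_ hlast' ?_).mono le_rfl fun s'' h b a => ?_
      · rw [s3, h12]; simp
      · rw [s4, hf.mem 0 rfl, hf.mem 1 rfl]; exact hRq
      · rw [h b a, hf.mem 5 rfl, hf.mem 6 rfl, s5, hm]
        rw [ite_ite_eq_ite_or]
        simp only [Marks]
        congr

namespace CNF

variable {m n : ℕ}

/-- The stream of a list of clauses. -/
def encode (cs : List (List (Fin n × Bool))) : List (ℕ × ℕ) :=
  cs.flatMap fun C => C.map (fun l => ((l.1 : ℕ) + 1, l.2.toNat)) ++ [(0, 0)]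

theorem marks_encode (vp rb : ℕ → ℕ) (b : Bool) (a C : ℕ) (cs : List (List (Fin n × Bool))) :
    Marks vp rb b a C (encode cs) ↔
      ∃ (i : ℕ) (h : i < cs.length), ∃ l ∈ cs[i], l.2 = b ∧ a = vp l.1 + rb (C + i) := by
  induction cs generalizing C with
  | nil => simp [encode, Marks]
  | cons c cs ih =>
    have hcons : ∀ (ls : List (Fin n × Bool)) (R : List (ℕ × ℕ)),
        Marks vp rb b a C (ls.map (fun l => ((l.1 : ℕ) + 1, l.2.toNat)) ++ (0, 0) :: R) ↔
          (∃ l ∈ ls, l.2 = b ∧ a = vp l.1 + rb C) ∨ Marks vp rb b a (C + 1) R := by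
      intro ls R
      induction ls with
      | nil => simp [Marks]
      | cons l ls ih =>
        have : (l.2.toNat ≠ 0 ↔ b = true) ↔ l.2 = b := by cases l.2 <;> cases b <;> simp
        simp only [List.map_cons, List.cons_append, Marks, ih, this, List.mem_cons, or_and_right,
          exists_or, exists_eq_left, or_assoc]
    have he : encode (c :: cs) =
        c.map (fun l => ((l.1 : ℕ) + 1, l.2.toNat)) ++ (0, 0) :: encode cs := by
      simp [encode]
    rw [he, hcons, ih]
    constructor
    · rintro (⟨l, hl, h⟩ | ⟨i, hi, l, hl, h1, h2⟩)
      · exact ⟨0, by simp, l, by simpa using hl, by simpa using h⟩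
      · exact ⟨i + 1, by simpa using hi, l, by simpa using hl, h1, by rw [h2]; congr 2; omega⟩
    · rintro ⟨i, hi, l, hl, h1, h2⟩
      cases i with
      | zero => exact Or.inl ⟨l, by simpa using hl, h1, by simpa using h2⟩
      | succ i =>
        exact Or.inr ⟨i, by simpa using hi, l, by simpa using hl, h1, by rw [h2]; congr 2; omega⟩

theorem countP_encode (cs : List (List (Fin n × Bool))) :
    (encode cs).countP (fun e => e.1 = 0) = cs.length := by
  induction cs with
  | nil => simp [encode]
  | cons c cs ih =>
    have he : encode (c :: cs) =
        c.map (fun l => ((l.1 : ℕ) + 1, l.2.toNat)) ++ (0, 0) :: encode cs := by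
      simp [encode]
    have h0 : (c.map fun l => ((l.1 : ℕ) + 1, l.2.toNat)).countP (fun e => e.1 = 0) = 0 := by
      rw [List.countP_eq_zero]
      intro e he
      obtain ⟨l, -, rfl⟩ := List.mem_map.1 he
      simp
    rw [he, List.countP_append, List.countP_cons, ih, h0]
    simp

theorem getLast_encode (cs : List (List (Fin n × Bool))) :
    ∀ e ∈ (encode cs).getLast?, e.1 = 0 := by
  induction cs using List.reverseRecOn with
  | nil => simp [encode]
  | append_singleton cs c _ =>
    intro e he
    rw [encode, List.flatMap_append, List.flatMap_singleton, ← List.append_assoc,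
      List.getLast?_concat] at he
    simp at he
    rw [← he]

theorem length_stream (F : CNF m n) : F.stream.length = m + ∑ C, (F.clause C).length := by
  simp [stream, List.length_flatMap, List.sum_ofFn, Function.comp_def, Finset.sum_add_distrib, add_comm]

variable (F : CNF m n) (σ : Equiv.Perm (Fin m)) (ρ : Equiv.Perm (Fin n))

theorem mul_add_inj {i i' j j' : ℕ} (hj : j < n) (hj' : j' < n) (h : i * n + j = i' * n + j') :
    i = i' ∧ j = j' := by
  have h1 : (i * n + j) / n = i := by
    rw [Nat.add_comm, Nat.add_mul_div_right _ _ (by omega), Nat.div_eq_of_lt hj, zero_add]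
  have h2 : (i' * n + j') / n = i' := by
    rw [Nat.add_comm, Nat.add_mul_div_right _ _ (by omega), Nat.div_eq_of_lt hj', zero_add]
  rw [h, h2] at h1
  subst h1
  exact ⟨rfl, by omega⟩

theorem matrixProg_spec {s : State} (h0 : s.reg 0 = m) (hs0 : s.mem 0 = (F.initState σ ρ).mem 0)
    (hs1 : s.mem 1 = (F.initState σ ρ).mem 1) (h5 : ∀ j : Fin n, s.mem 5 (ρ j) = j)
    (h6 : ∀ i : Fin m, s.mem 6 (σ i) = i * n) (h7 : ∀ x, s.mem 7 x = 0) (h8 : ∀ x, s.mem 8 x = 0) :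
    HaltsWithin matrixProg s (F.stream.length * 11 + 5) (fun s' => ∀ i < m, ∀ j < n,
      s'.mem 7 (i * n + j) = F.lit σ ρ false i j ∧ s'.mem 8 (i * n + j) = F.lit σ ρ true i j) := by
  classical
  refine HaltsWithin.mono (T := 4 + (F.stream.length * 11 + 1)) ?_ (by omega) fun _ h => h
  refine (HaltsWithin.of_eval (R := fun s1 => s1.reg 11 = 1 ∧ s1.reg 12 = m ∧ s1.reg 13 = 0 ∧
    s1.reg 14 = 0) rfl le_rfl ?_).seq ?_
  · simp [Prog.eval, block, Instr.apply, h0]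
  rintro s1 ⟨e11, e12, e13, e14⟩ hf1
  have hm : s1.mem = s.mem := funext fun i => hf1.mem i rfl
  have henc : F.stream = encode (List.ofFn F.clause) := rfl
  refine HaltsWithin.mono (entryProg_loop F.stream s1 e11 ?_ ?_ ?_) le_rfl ?_
  · rw [e12, henc, countP_encode, List.length_ofFn]
  · rw [henc]; exact getLast_encode _
  · intro q _
    rw [e13, hm, hs0, hs1, zero_add]
    exact ⟨rfl, rfl⟩
  · intro s' h
    have key : ∀ (b : Bool) (i : Fin m) (j : Fin n), s'.mem (7 + b.toNat) (i * n + j) =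
        F.lit σ ρ b i j := by
      intro b i j
      rw [h b, e14, hm, henc]
      have hz : s.mem (7 + b.toNat) (i * n + j) = 0 := by cases b <;> simp [h7, h8]
      rw [hz, lit]
      congr 1
      rw [marks_encode, eq_iff_iff]
      constructor
      · rintro ⟨i', hi', ⟨x, b'⟩, hl, hb, ha⟩
        rw [List.length_ofFn] at hi'
        simp only at hb
        subst hb
        obtain ⟨c, hc⟩ := σ.surjective ⟨i', hi'⟩
        obtain ⟨j', rfl⟩ := ρ.surjective x
        have h6' := h6 c
        rw [hc] at h6'
        simp only at h6'
        rw [zero_add, h6', h5, add_comm] at ha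
        obtain ⟨k1, k2⟩ := mul_add_inj (i := i) (i' := c) j.2 j'.2 (by omega)
        refine ⟨i.2, j.2, ?_⟩
        simp only [List.getElem_ofFn] at hl
        rw [← hc] at hl
        have e1 : c = i := Fin.ext k1.symm
        have e2 : j' = j := Fin.ext k2.symm
        rw [e1, e2] at hl
        exact hl
      · rintro ⟨_, _, hl⟩
        refine ⟨σ i, by simp, (ρ j, b), by simpa using hl, rfl, ?_⟩
        rw [zero_add, h6, h5, add_comm]
    intro i hi j hj
    exact ⟨key false ⟨i, hi⟩ ⟨j, hj⟩, key true ⟨i, hi⟩ ⟨j, hj⟩⟩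

end CNF

end KInterval

namespace KInterval

open Prog

/-! ### Computing the least width -/

/-- Segments 7 and 8 hold the two `m × n` matrices `L false` and `L true`. -/
def Entries (L : Bool → ℕ → ℕ → ℕ) (m n : ℕ) (s : State) : Prop :=
  ∀ i < m, ∀ j < n, s.mem 7 (i * n + j) = L false i j ∧ s.mem 8 (i * n + j) = L true i j

/-- The state of the dynamic program after `i` rows. -/
structure Rows (A : ℕ → ℕ → ℕ) (n i : ℕ) (s : State) : Prop where
  seen : ∀ j < n, s.mem 9 j = ∑ i' ∈ Finset.range i, A i' j
  best : ∀ g ≤ n, s.mem 11 g = width A n i g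
  costs : ∀ r < i, ∀ g ≤ n, s.mem 10 (r * (n + 1) + g) = cost A n r g

/-- One column of the first pass over a row. -/
def costInit : Prog :=
  .seq (block [.load 19 7 15, .load 20 8 15, .add 19 19 20, .load 20 9 17])
    (.seq (.branch 19 .skip (.branch 20 (block [.add 18 18 11]) .skip))
      (block [.add 15 15 11, .add 17 17 11, .sub 16 16 11]))

/-- One column of the second pass over a row. -/
def costStep : Prog :=
  .seq (block [.store 10 14 18, .add 14 14 11, .load 23 11 17, .sub 24 23 18, .add 24 24 18, .sub 25 22 24,
      .sub 22 22 25, .store 11 17 22, .load 19 7 15, .load 23 8 15, .add 19 19 23, .load 20 9 17])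
    (.seq (.branch 19 .skip (.seq (.branch 21 (block [.add 18 18 11]) .skip)
        (.branch 20 (block [.sub 18 18 11]) .skip)))
      (block [.add 20 20 19, .store 9 17 20, .add 21 21 19, .add 15 15 11, .add 17 17 11, .sub 16 16 11]))

/-- One row of the dynamic program. -/
def costRow : Prog :=
  .seq (block [.add 15 13 10, .add 16 1 10, .const 17 0, .const 18 0])
    (.seq (.loop 16 costInit)
      (.seq (block [.add 15 13 10, .add 16 1 11, .const 17 0, .const 21 0, .add 22 1 10])
        (.seq (.loop 16 costStep) (block [.add 13 13 1, .sub 12 12 11]))))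

/-- The violations of all clauses at all gaps, and the least width. -/
def costProg : Prog :=
  .seq (block [.const 10 0, .const 11 1, .add 12 0 10, .const 13 0, .const 14 0]) (.loop 12 costRow)

theorem sum_range_ne_zero (A : ℕ → ℕ) (i : ℕ) : ∑ i' ∈ Finset.range i, A i' ≠ 0 ↔ ∃ i' < i, A i' ≠ 0 := by
  simp [Finset.sum_eq_zero_iff]

section

variable {L : Bool → ℕ → ℕ → ℕ} {A : ℕ → ℕ → ℕ} {m n i : ℕ}

/-- At gap 0 only condition (2) can apply, and the column sums in segment 9 tell which variables
occur in earlier clauses. -/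
theorem costInit_loop (hA : ∀ i j, A i j = L false i j + L true i j) {s : State} (hi : i < m)
    (hE : Entries L m n s) (h11 : s.reg 11 = 1) (h15 : s.reg 15 = i * n)
    (h16 : s.reg 16 = n) (h17 : s.reg 17 = 0) (h18 : s.reg 18 = 0) (h : Rows A n i s) :
    HaltsWithin (.loop 16 costInit) s (n * 12 + 1) (fun s' => s'.reg 18 = cost A n i 0) := by
  refine HaltsWithin.mono (HaltsWithin.loop (N := n) (c := 11) (fun j s' => s'.reg 15 = i * n + j ∧
    s'.reg 16 = n - j ∧ s'.reg 17 = j ∧ s'.reg 18 = ∑ j' ∈ Finset.range j,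
      if A i j' = 0 ∧ ∃ i' < i, A i' j' ≠ 0 then 1 else 0) ?_ ?_ ?_) le_rfl ?_
  · simp [h15, h16, h17, h18]
  · rintro j s' hj ⟨e15, e16, e17, e18⟩ hf
    have e11 : s'.reg 11 = 1 := (hf.reg 11 rfl).trans h11
    obtain ⟨m7, m8⟩ := hE i hi j hj
    have m9 := h.seen j hj
    rw [← hf.mem 7 rfl] at m7
    rw [← hf.mem 8 rfl] at m8
    rw [← hf.mem 9 rfl] at m9
    refine ⟨by omega, HaltsWithin.of_eval rfl (by decide) ?_⟩
    rw [Finset.sum_range_succ, ← e18]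
    have hs := sum_range_ne_zero (fun i' => A i' j) i
    have hsum : s'.mem 7 (i * n + j) + s'.mem 8 (i * n + j) = A i j := by rw [m7, m8, hA]
    simp only [← hs]
    by_cases c1 : A i j = 0 <;> by_cases c2 : ∑ i' ∈ Finset.range i, A i' j = 0 <;>
      simp [costInit, Prog.eval, block, Instr.apply, e11, e15, e16, e17, hsum, m9, c1, c2] <;> omega
  · rintro s' ⟨-, h, -⟩; omega
  · rintro s' ⟨⟨-, -, -, h⟩, -⟩
    rw [h, cost_zero, Finset.card_filter]

/-- The cost is carried along by `cost_succ`, and the minima are updated in place: the new entry at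
`g` needs the old one only at `g`, which is read just before it is overwritten. -/
theorem costStep_loop (hA : ∀ i j, A i j = L false i j + L true i j) {s : State} (hi : i < m)
    (hE : Entries L m n s) (h11 : s.reg 11 = 1) (h14 : s.reg 14 = i * (n + 1)) (h15 : s.reg 15 = i * n)
    (h16 : s.reg 16 = n + 1) (h17 : s.reg 17 = 0) (h18 : s.reg 18 = cost A n i 0) (h21 : s.reg 21 = 0)
    (h22 : s.reg 22 = n) (h : Rows A n i s) :
    HaltsWithin (.loop 16 costStep) s ((n + 1) * 25 + 1) (fun s' =>
      s'.reg 14 = (i + 1) * (n + 1) ∧ Rows A n (i + 1) s') := by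
  set D : ℕ → ℕ := fun g' => max (cost A n i g') (width A n i g') with hD
  -- The round `g = n` stores the last cost and minimum but then reads a cell beyond the row. The
  -- running cost and row sum are meaningless afterwards, hence the guard `g ≤ n`.
  refine HaltsWithin.mono (HaltsWithin.loop (N := n + 1) (c := 24) (fun g s' =>
    (s'.reg 15 = i * n + g ∧ s'.reg 16 = n + 1 - g ∧ s'.reg 17 = g ∧ s'.reg 14 = i * (n + 1) + g ∧
      s'.reg 22 = runMin n D g) ∧
    (g ≤ n → s'.reg 18 = cost A n i g ∧ s'.reg 21 = ∑ j' ∈ Finset.range g, A i j') ∧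
    (∀ j < n, s'.mem 9 j = (∑ i' ∈ Finset.range i, A i' j) + if j < g then A i j else 0) ∧
    (∀ g' ≤ n, s'.mem 11 g' = if g' < g then runMin n D (g' + 1) else width A n i g') ∧
    (∀ x < i * (n + 1), s'.mem 10 x = s.mem 10 x) ∧
    ∀ g' < g, s'.mem 10 (i * (n + 1) + g') = cost A n i g') ?_ ?_ ?_) le_rfl ?_
  · refine ⟨?_, fun _ => ?_, fun j hj => ?_, fun g' hg' => ?_, fun x _ => rfl, by simp⟩
    · simp [h15, h16, h17, h14, h22, runMin]
    · simp [h18, h21]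
    · simp [h.seen j hj]
    · simp [h.best g' hg']
  · rintro g s' hg ⟨⟨e15, e16, e17, e14, e22⟩, he, m9, m11, m10, m10'⟩ hf
    obtain ⟨e18, e21⟩ := he (by omega)
    have e11 : s'.reg 11 = 1 := (hf.reg 11 rfl).trans h11
    have m11g := m11 g (by omega)
    rw [if_neg (lt_irrefl _)] at m11g
    -- Maximum and minimum in terms of truncated subtraction, as the program computes them.
    have hmax : width A n i g - cost A n i g + cost A n i g = D g := by simp only [hD]; omega
    have hmin : runMin n D g - (runMin n D g - D g) = runMin n D (g + 1) := by simp only [runMin]; omega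
    refine ⟨by omega, HaltsWithin.of_eval rfl (by decide) ?_⟩
    -- The cell content gets a name of its own, because for `g = n` it is not an entry of row `i`.
    obtain ⟨a, ha⟩ : ∃ a, s'.mem 7 (i * n + g) + s'.mem 8 (i * n + g) = a := ⟨_, rfl⟩
    have hregs : (costStep.eval s').reg 15 = i * n + (g + 1) ∧ (costStep.eval s').reg 16 = n + 1 - (g + 1) ∧
        (costStep.eval s').reg 17 = g + 1 ∧ (costStep.eval s').reg 14 = i * (n + 1) + (g + 1) ∧
        (costStep.eval s').reg 22 = runMin n D (g + 1) := by
      by_cases c1 : a = 0 <;> by_cases c2 : s'.mem 9 g = 0 <;>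
        by_cases c3 : ∑ j' ∈ Finset.range g, A i j' = 0 <;>
        simp [costStep, Prog.eval, block, Instr.apply, e17, ha, c1, c2, c3, e21, 
          e11, e14, e15, e16, e18, e22, m11g, hmax, hmin] <;> omega
    have hm11 : (costStep.eval s').mem 11 = Function.update (s'.mem 11) g (runMin n D (g + 1)) := by
      by_cases c1 : a = 0 <;> by_cases c2 : s'.mem 9 g = 0 <;>
        by_cases c3 : ∑ j' ∈ Finset.range g, A i j' = 0 <;>
        simp [costStep, Prog.eval, block, Instr.apply, e17, ha, c1, c2, c3, e21, 
          e14, e15, e18, e22, m11g, hmax, hmin]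
    have hm10 : (costStep.eval s').mem 10 = Function.update (s'.mem 10) (i * (n + 1) + g) (cost A n i g) := by
      by_cases c1 : a = 0 <;> by_cases c2 : s'.mem 9 g = 0 <;>
        by_cases c3 : ∑ j' ∈ Finset.range g, A i j' = 0 <;>
        simp [costStep, Prog.eval, block, Instr.apply, e17, ha, c1, c2, c3, e21, e14, e15, e18]
    have hm9 : (costStep.eval s').mem 9 = Function.update (s'.mem 9) g
        (s'.mem 9 g + a) := by
      by_cases c1 : a = 0 <;> by_cases c2 : s'.mem 9 g = 0 <;>
        by_cases c3 : ∑ j' ∈ Finset.range g, A i j' = 0 <;>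
        simp [costStep, Prog.eval, block, Instr.apply, e17, ha, c1, c2, c3, e21, e15]
    refine ⟨hregs, fun hgn => ?_, fun j hj => ?_, fun g' hg' => ?_, fun x hx => ?_, fun g' hg' => ?_⟩
    · obtain ⟨m7, m8⟩ := hE i hi g hgn
      rw [← hf.mem 7 rfl] at m7
      rw [← hf.mem 8 rfl] at m8
      have m9g := m9 g hgn
      rw [if_neg (lt_irrefl _), add_zero] at m9g
      have hc := cost_succ A n i g hgn
      have hs := sum_range_ne_zero (fun i' => A i' g) i
      have hs' := sum_range_ne_zero (fun j' => A i j') g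
      simp only [← hs, ← hs'] at hc
      obtain rfl : A i g = a := by rw [hA, ← m7, ← m8, ha]
      rw [Finset.sum_range_succ]
      by_cases c1 : A i g = 0 <;> by_cases c2 : ∑ i' ∈ Finset.range i, A i' g = 0 <;>
        by_cases c3 : ∑ j' ∈ Finset.range g, A i j' = 0 <;>
        simp [c1, c2, c3] at hc <;>
        simp [costStep, Prog.eval, block, Instr.apply, e11, e15, e17, e18, e21, ha, m9g, c1, c2, c3] <;>
        omega
    · rw [hm9]
      by_cases hjg : j = g
      · subst hjg
        obtain ⟨m7, m8⟩ := hE i hi j hj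
        rw [Function.update_self, ← ha, hf.mem 7 rfl, hf.mem 8 rfl, m7, m8, m9 j hj, ← hA]
        simp
      · rw [Function.update_of_ne hjg, m9 j hj]
        simp only [show j < g + 1 ↔ j < g by omega]
    · rw [hm11]
      by_cases hjg : g' = g
      · subst hjg; simp
      · rw [Function.update_of_ne hjg, m11 g' hg']
        simp only [show g' < g + 1 ↔ g' < g by omega]
    · rw [hm10, Function.update_of_ne (by omega), m10 x hx]
    · rw [hm10]
      by_cases hjg : g' = g
      · subst hjg; simp
      · rw [Function.update_of_ne (by omega), m10' g' (by omega)]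
  · rintro s' ⟨⟨-, h, -⟩, -⟩; omega
  · rintro s' ⟨⟨⟨-, -, -, e14, -⟩, -, m9, m11, m10, m10'⟩, -⟩
    refine ⟨by rw [e14]; ring, fun j hj => ?_, fun g hg => ?_, fun i' hi' g hg => ?_⟩
    · rw [m9 j hj, if_pos (by omega), Finset.sum_range_succ]
    · rw [m11 g hg, if_pos (by omega)]; rfl
    · rcases Nat.lt_succ_iff_lt_or_eq.1 hi' with h' | rfl
      · have : (i' + 1) * (n + 1) ≤ i * (n + 1) := Nat.mul_le_mul_right _ h'
        rw [m10 _ (by linarith), h.costs i' h' g hg]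
      · exact m10' g (by omega)

theorem Rows.congr {s s' : State} (h : Rows A n i s) (h9 : s'.mem 9 = s.mem 9) (h10 : s'.mem 10 = s.mem 10)
    (h11 : s'.mem 11 = s.mem 11) : Rows A n i s' :=
  ⟨h9 ▸ h.seen, h11 ▸ h.best, h10 ▸ h.costs⟩

theorem Entries.congr {s s' : State} (h : Entries L m n s) (h7 : s'.mem 7 = s.mem 7)
    (h8 : s'.mem 8 = s.mem 8) : Entries L m n s' := by
  unfold Entries; rw [h7, h8]; exact h

theorem costProg_spec (hA : ∀ i j, A i j = L false i j + L true i j) {s : State} (h0 : s.reg 0 = m)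
    (h1 : s.reg 1 = n) (hE : Entries L m n s) (h9 : ∀ x, s.mem 9 x = 0) (h11 : ∀ x, s.mem 11 x = 0) :
    HaltsWithin costProg s (m * (n * 37 + 39) + 6) (Rows A n m) := by
  refine HaltsWithin.mono (T := 5 + (m * ((n * 37 + 38) + 1) + 1)) ?_
    (by simp only [Nat.add_assoc, Nat.reduceAdd]; omega) fun _ h => h
  refine (HaltsWithin.of_eval (R := fun s1 => s1.reg 10 = 0 ∧ s1.reg 11 = 1 ∧ s1.reg 12 = m ∧
    s1.reg 13 = 0 ∧ s1.reg 14 = 0) rfl le_rfl ?_).seq ?_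
  · simp [Prog.eval, block, Instr.apply, h0]
  rintro s1 ⟨e10, e11, e12, e13, e14⟩ f1
  refine HaltsWithin.mono (HaltsWithin.loop (N := m) (c := n * 37 + 38) (fun i s' => s'.reg 12 = m - i ∧
    s'.reg 13 = i * n ∧ s'.reg 14 = i * (n + 1) ∧ Rows A n i s') ?_ ?_ ?_) le_rfl ?_
  · refine ⟨by simp [e12], by simp [e13], by simp [e14], ⟨?_, ?_, by simp⟩⟩
    · intro j _; rw [f1.mem 9 rfl, h9]; simp
    · intro g _; rw [f1.mem 11 rfl, h11]; rfl
  · rintro i s' hi ⟨g12, g13, g14, hR⟩ hf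
    have z1 : s'.reg 1 = n := ((hf.reg 1 rfl).trans (f1.reg 1 rfl)).trans h1
    have g10 : s'.reg 10 = 0 := (hf.reg 10 rfl).trans e10
    have g11 : s'.reg 11 = 1 := (hf.reg 11 rfl).trans e11
    have hE' : Entries L m n s' := hE.congr ((hf.mem 7 rfl).trans (f1.mem 7 rfl))
      ((hf.mem 8 rfl).trans (f1.mem 8 rfl))
    refine ⟨by omega, ?_⟩
    refine HaltsWithin.mono (T := 4 + ((n * 12 + 1) + (5 + (((n + 1) * 25 + 1) + 2)))) ?_ (by omega)
      fun _ h => h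
    refine (HaltsWithin.of_eval (R := fun s2 => s2.reg 15 = i * n ∧ s2.reg 16 = n ∧ s2.reg 17 = 0 ∧
      s2.reg 18 = 0) rfl le_rfl ?_).seq ?_
    · simp [Prog.eval, block, Instr.apply, g10, g13, z1]
    rintro s2 ⟨k15, k16, k17, k18⟩ f2
    refine (costInit_loop hA hi (hE'.congr (f2.mem 7 rfl) (f2.mem 8 rfl)) ((f2.reg 11 rfl).trans g11) k15 k16
      k17 k18 (hR.congr (f2.mem 9 rfl) (f2.mem 10 rfl) (f2.mem 11 rfl))).seq ?_
    rintro s3 l18 f3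
    have mem3 : s3.mem = s'.mem := funext fun a => (f3.mem a rfl).trans (f2.mem a rfl)
    have l1 : s3.reg 1 = n := ((f3.reg 1 rfl).trans (f2.reg 1 rfl)).trans z1
    have l10 : s3.reg 10 = 0 := ((f3.reg 10 rfl).trans (f2.reg 10 rfl)).trans g10
    have l11 : s3.reg 11 = 1 := ((f3.reg 11 rfl).trans (f2.reg 11 rfl)).trans g11
    have l12 : s3.reg 12 = m - i := ((f3.reg 12 rfl).trans (f2.reg 12 rfl)).trans g12
    have l13 : s3.reg 13 = i * n := ((f3.reg 13 rfl).trans (f2.reg 13 rfl)).trans g13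
    have l14 : s3.reg 14 = i * (n + 1) := ((f3.reg 14 rfl).trans (f2.reg 14 rfl)).trans g14
    refine (HaltsWithin.of_eval (R := fun s4 => s4.reg 15 = i * n ∧ s4.reg 16 = n + 1 ∧ s4.reg 17 = 0 ∧
      s4.reg 21 = 0 ∧ s4.reg 22 = n) rfl le_rfl ?_).seq ?_
    · simp [Prog.eval, block, Instr.apply, l1, l10, l11, l13]
    rintro s4 ⟨k15, k16, k17, k21, k22⟩ f4
    have mem4 : s4.mem = s'.mem := (funext fun a => f4.mem a rfl).trans mem3
    refine (costStep_loop hA hi (hE'.congr (by rw [mem4]) (by rw [mem4])) ((f4.reg 11 rfl).trans l11)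
      ((f4.reg 14 rfl).trans l14) k15 k16 k17 ((f4.reg 18 rfl).trans l18) k21 k22
      (hR.congr (by rw [mem4]) (by rw [mem4]) (by rw [mem4]))).seq ?_
    rintro s5 ⟨p14, hR5⟩ f5
    have p1 : s5.reg 1 = n := ((f5.reg 1 rfl).trans (f4.reg 1 rfl)).trans l1
    have p11 : s5.reg 11 = 1 := ((f5.reg 11 rfl).trans (f4.reg 11 rfl)).trans l11
    have p12 : s5.reg 12 = m - i := ((f5.reg 12 rfl).trans (f4.reg 12 rfl)).trans l12
    have p13 : s5.reg 13 = i * n := ((f5.reg 13 rfl).trans (f4.reg 13 rfl)).trans l13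
    refine HaltsWithin.of_eval rfl le_rfl ⟨?_, ?_, ?_, hR5.congr rfl rfl rfl⟩
    · simp [Prog.eval, block, Instr.apply, p11, p12]; omega
    · simp [Prog.eval, block, Instr.apply, p1, p13]; ring
    · simp [Prog.eval, block, Instr.apply, p14]
  · rintro s' ⟨h, -⟩; omega
  · rintro s' ⟨⟨-, -, -, h⟩, -⟩
    exact h

end

end KInterval

namespace KInterval

open Prog

/-! ### Choosing the gaps -/

/-- The least admissible gap of one clause. -/
def greedyRow : Prog :=
  .seq (block [.load 17 10 16, .sub 17 17 12])
    (.seq (.loop 17 (block [.add 15 15 11, .add 16 16 11, .load 17 10 16, .sub 17 17 12]))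
      (block [.store 12 14 15, .add 14 14 11, .add 16 16 11, .add 16 16 1, .sub 13 13 11]))

/-- Write gaps of least width into segment 12. -/
def greedyProg : Prog :=
  .seq (block [.const 10 0, .const 11 1, .load 12 11 1, .add 13 0 10, .const 14 0, .const 15 0, .const 16 0])
    (.seq (.loop 13 greedyRow) (block [.store 12 0 1]))

/-- The search cannot run past `h`, an admissible gap not before the starting point `c`. -/
theorem greedyRow_spec {A : ℕ → ℕ → ℕ} {n i c k h : ℕ} {s : State}
    (hR : ∀ g ≤ n, s.mem 10 (i * (n + 1) + g) = cost A n i g) (h1 : s.reg 1 = n) (h11 : s.reg 11 = 1)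
    (h12 : s.reg 12 = k) (h14 : s.reg 14 = i) (h15 : s.reg 15 = c) (h16 : s.reg 16 = i * (n + 1) + c)
    (hc : c ≤ h) (hn : h ≤ n) (hk : cost A n i h ≤ k) :
    HaltsWithin greedyRow s (n * 5 + 8) (fun s' => ∃ c', c ≤ c' ∧ c' ≤ h ∧ cost A n i c' ≤ k ∧
      s'.reg 13 = s.reg 13 - 1 ∧ s'.reg 14 = i + 1 ∧ s'.reg 15 = c' ∧
      s'.reg 16 = (i + 1) * (n + 1) + c' ∧ s'.mem 12 = Function.update (s.mem 12) i c') := by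
  classical
  have hex : ∃ d, cost A n i (c + d) ≤ k := ⟨h - c, by rwa [Nat.add_sub_cancel' hc]⟩
  have hd1 := Nat.find_spec hex
  have hd2 : Nat.find hex ≤ h - c := Nat.find_min' hex (by rwa [Nat.add_sub_cancel' hc])
  have hd3 := fun e => Nat.find_min hex (m := e)
  generalize Nat.find hex = d at hd1 hd2 hd3
  refine HaltsWithin.mono (T := 2 + ((d * (4 + 1) + 1) + 5)) ?_ (by omega) fun _ h => h
  refine (HaltsWithin.of_eval (R := fun s1 => s1.reg 17 = cost A n i c - k) rfl le_rfl ?_).seq ?_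
  · simp [Prog.eval, block, Instr.apply, h16, hR c (by omega), h12]
  intro s1 e17 f1
  refine (HaltsWithin.loop (N := d) (c := 4) (fun e s' => s'.reg 15 = c + e ∧
    s'.reg 16 = i * (n + 1) + (c + e) ∧ s'.reg 17 = cost A n i (c + e) - k) ?_ ?_ ?_).seq ?_
  · exact ⟨(f1.reg 15 rfl).trans h15, (f1.reg 16 rfl).trans h16, e17⟩
  · rintro e s' he ⟨g15, g16, g17⟩ hf
    have g11 : s'.reg 11 = 1 := ((hf.reg 11 rfl).trans (f1.reg 11 rfl)).trans h11
    have g12 : s'.reg 12 = k := ((hf.reg 12 rfl).trans (f1.reg 12 rfl)).trans h12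
    have hc' := hR (c + (e + 1)) (by omega)
    rw [← f1.mem 10 rfl, ← hf.mem 10 rfl] at hc'
    have := hd3 e he
    refine ⟨by omega, HaltsWithin.of_eval rfl le_rfl ⟨?_, ?_, ?_⟩⟩
    · simp [Prog.eval, block, Instr.apply, g11, g15]; omega
    · simp [Prog.eval, block, Instr.apply, g11, g16]; omega
    · simp [Prog.eval, block, Instr.apply, g11, g16, g12, add_assoc, hc']
  · rintro s' ⟨-, -, h⟩; omega
  rintro s2 ⟨⟨g15, g16, -⟩, f2⟩ -
  have g1 : s2.reg 1 = n := ((f2.reg 1 rfl).trans (f1.reg 1 rfl)).trans h1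
  have g11 : s2.reg 11 = 1 := ((f2.reg 11 rfl).trans (f1.reg 11 rfl)).trans h11
  have g13 : s2.reg 13 = s.reg 13 := (f2.reg 13 rfl).trans (f1.reg 13 rfl)
  have g14 : s2.reg 14 = i := ((f2.reg 14 rfl).trans (f1.reg 14 rfl)).trans h14
  have gm : s2.mem 12 = s.mem 12 := (f2.mem 12 rfl).trans (f1.mem 12 rfl)
  refine HaltsWithin.of_eval rfl le_rfl ⟨c + d, by omega, by omega, hd1, ?_, ?_, ?_, ?_, ?_⟩
  · simp [Prog.eval, block, Instr.apply, g11, g13]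
  · simp [Prog.eval, block, Instr.apply, g11, g14]
  · simp [Prog.eval, block, Instr.apply, g15]
  · simp [Prog.eval, block, Instr.apply, g11, g16, g1]; ring
  · simp [Prog.eval, block, Instr.apply, g14, g15, gm]

/-- Choosing least admissible gaps never overtakes a fixed optimal sequence `h`, so the gap `h i`
always remains available to clause `i`. -/
theorem greedyProg_spec {A : ℕ → ℕ → ℕ} {m n : ℕ} {s : State} (h0 : s.reg 0 = m) (h1 : s.reg 1 = n)
    (hR : Rows A n m s) :
    HaltsWithin greedyProg s (m * (n * 5 + 9) + 9) (fun s' => IsGapSeq m n (s'.mem 12) ∧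
      ∀ i < m, cost A n i (s'.mem 12 i) ≤ width A n m n) := by
  obtain ⟨h, hh, hk⟩ := (width_le_iff A n m n _).1 le_rfl
  set k := width A n m n
  refine HaltsWithin.mono (T := 7 + ((m * ((n * 5 + 8) + 1) + 1) + 1)) ?_
    (by simp only [Nat.add_assoc, Nat.reduceAdd]; omega) fun _ h => h
  refine (HaltsWithin.of_eval (R := fun s1 => s1.reg 11 = 1 ∧ s1.reg 12 = k ∧ s1.reg 13 = m ∧
    s1.reg 14 = 0 ∧ s1.reg 15 = 0 ∧ s1.reg 16 = 0) rfl le_rfl ?_).seq ?_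
  · simp [Prog.eval, block, Instr.apply, h0, h1, hR.best n le_rfl, k]
  rintro s1 ⟨e11, e12, e13, e14, e15, e16⟩ f1
  refine (HaltsWithin.loop (N := m) (c := n * 5 + 8) (fun i s' => s'.reg 13 = m - i ∧ s'.reg 14 = i ∧
    s'.reg 16 = i * (n + 1) + s'.reg 15 ∧ (∀ x, i ≤ x → x < m → s'.reg 15 ≤ h x) ∧ s'.reg 15 ≤ n ∧
    (∀ x < i, s'.mem 12 x ≤ s'.reg 15) ∧ (∀ x y, x ≤ y → y < i → s'.mem 12 x ≤ s'.mem 12 y) ∧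
    ∀ x < i, cost A n x (s'.mem 12 x) ≤ k) ?_ ?_ ?_).seq ?_
  · simp [e13, e14, e15, e16]
  · rintro i s' hi ⟨g13, g14, g16, hx, hn, h12, hm, hck⟩ hf
    have g1 : s'.reg 1 = n := ((hf.reg 1 rfl).trans (f1.reg 1 rfl)).trans h1
    have g11 : s'.reg 11 = 1 := (hf.reg 11 rfl).trans e11
    have g12 : s'.reg 12 = k := (hf.reg 12 rfl).trans e12
    refine ⟨by omega, (greedyRow_spec (A := A) ?_ g1 g11 g12 g14 rfl g16 (hx i le_rfl hi)
      (hh.le i hi) (hk i hi)).mono le_rfl ?_⟩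
    · intro g hg
      rw [hf.mem 10 rfl, f1.mem 10 rfl]
      exact hR.costs i hi g hg
    rintro s'' ⟨c, hc1, hc2, hc3, k13, k14, k15, k16, km⟩
    rw [km, k15]
    have hci := hh.le i hi
    refine ⟨by omega, k14, k16, fun x h1 h2 => hc2.trans (hh.mono i x (by omega) h2), by omega,
      fun x hxi => ?_, fun x y hxy hy => ?_, fun x hxi => ?_⟩
    · by_cases hxx : x = i
      · subst hxx; simp
      · rw [Function.update_of_ne hxx]
        exact (h12 x (by omega)).trans hc1
    · by_cases hyy : y = i
      · subst hyy
        rw [Function.update_self]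
        by_cases hxx : x = y
        · subst hxx; simp
        · rw [Function.update_of_ne hxx]
          exact (h12 x (by omega)).trans hc1
      · rw [Function.update_of_ne hyy, Function.update_of_ne (by omega)]
        exact hm x y hxy (by omega)
    · by_cases hxx : x = i
      · subst hxx; simpa using hc3
      · rw [Function.update_of_ne hxx]
        exact hck x (by omega)
  · rintro s' ⟨h, -⟩; omega
  rintro s2 ⟨⟨-, -, -, -, hn, h12, hm, hck⟩, f2⟩ -
  have g0 : s2.reg 0 = m := ((f2.reg 0 rfl).trans (f1.reg 0 rfl)).trans h0
  have g1 : s2.reg 1 = n := ((f2.reg 1 rfl).trans (f1.reg 1 rfl)).trans h1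
  refine HaltsWithin.of_eval rfl le_rfl ?_
  have he : ((block [.store 12 0 1]).eval s2).mem 12 = Function.update (s2.mem 12) m n := by
    simp [Prog.eval, block, Instr.apply, g0, g1]
  rw [he]
  refine ⟨⟨fun x y hxy hy => ?_, by simp⟩, fun i hi => ?_⟩
  · by_cases hyy : y = m
    · subst hyy
      rw [Function.update_self]
      by_cases hxx : x = y
      · subst hxx; simp
      · rw [Function.update_of_ne hxx]
        exact (h12 x (by omega)).trans hn
    · rw [Function.update_of_ne hyy, Function.update_of_ne (by omega)]
      exact hm x y hxy (by omega)
  · rw [Function.update_of_ne (by omega)]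
    exact hck i hi

end KInterval

namespace KInterval

open Prog

/-! ### The masks of all elements -/

open Classical in
theorem code_succ {lo hi : ℕ} (h : lo ≤ hi) (P : ℕ → Prop) :
    code lo (hi + 1) P = code lo hi P + if P hi then 2 ^ hi else 0 := by
  simp only [code, Finset.sum_Ico_succ_top h]

/-- One clause of `acc`. -/
def accBody (o o' : ℕ) : Prog :=
  .seq (block [.load 28 7 18, .load 29 8 18, .load 30 4 19])
    (.seq (.branch 28 (block [.add o o 30]) .skip) (.seq (.branch 29 (block [.add o' o' 30]) .skip)
      (block [.add 18 18 1, .add 19 19 11, .sub 20 20 11])))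

/-- The values for a variable. -/
def varProg : Prog :=
  .seq (block [.add 18 15 10, .const 19 0, .add 20 14 10, .const 21 0, .const 22 0, .const 23 0, .const 24 0,
      .const 25 0, .const 26 0, .load 27 4 15])
    (.seq (.loop 20 (accBody 21 22)) (.seq (block [.sub 20 0 14])
      (.seq (.loop 20 (accBody 23 24)) (block [.add 15 15 11]))))

/-- The values for a clause. -/
def clauseProg : Prog :=
  block [.load 21 4 14, .add 22 21 10, .add 23 21 10, .add 24 21 10, .add 25 21 10, .load 26 4 1,
    .add 27 26 10, .add 14 14 11]

/-- The values for one element. -/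
def maskStep : Prog :=
  .seq (block [.sub 13 13 11, .load 17 12 14, .sub 17 17 15])
    (.seq (.branch 17 varProg clauseProg)
      (block [.store 13 12 23, .store 14 12 24, .store 15 12 25, .store 19 13 21, .store 20 13 22,
        .store 21 13 25, .store 25 12 26, .store 26 12 27, .add 12 12 11, .sub 16 16 11]))

/-- Write all masks and weights. -/
def maskProg : Prog :=
  .seq (block [.const 10 0, .const 11 1, .const 12 0, .add 13 0 1, .const 14 0, .const 15 0, .add 16 0 1])
    (.loop 16 maskStep)

section

variable {L : Bool → ℕ → ℕ → ℕ} {m n : ℕ}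

/-- Used twice for each variable: over the clauses before the cut for the backward masks and over
those behind it for the forward masks. -/
theorem acc_loop {o o' lo cnt j : ℕ} (ho : 21 ≤ o ∧ o < o' ∧ o' ≤ 24) {s : State} (hcnt : lo + cnt ≤ m)
    (hj : j < n) (hE : Entries L m n s) (hpow : ∀ i ≤ m + n, s.mem 4 i = 2 ^ i) (h1 : s.reg 1 = n)
    (h11 : s.reg 11 = 1) (h18 : s.reg 18 = lo * n + j) (h19 : s.reg 19 = lo) (h20 : s.reg 20 = cnt)
    (h : s.reg o = 0) (h' : s.reg o' = 0) :
    HaltsWithin (.loop 20 (accBody o o')) s (cnt * 11 + 1) (fun s' =>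
      s'.reg 18 = (lo + cnt) * n + j ∧ s'.reg 19 = lo + cnt ∧
      s'.reg o = code lo (lo + cnt) (fun i => L false i j ≠ 0) ∧
      s'.reg o' = code lo (lo + cnt) (fun i => L true i j ≠ 0)) := by
  refine HaltsWithin.mono (HaltsWithin.loop (N := cnt) (c := 10) (fun e s' => s'.reg 20 = cnt - e ∧
    s'.reg 18 = (lo + e) * n + j ∧ s'.reg 19 = lo + e ∧
    s'.reg o = code lo (lo + e) (fun i => L false i j ≠ 0) ∧
    s'.reg o' = code lo (lo + e) (fun i => L true i j ≠ 0)) ?_ ?_ ?_) le_rfl fun s' h => h.1.2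
  · simp [h18, h19, h20, h, h', code_self]
  · rintro e s' he ⟨g20, g18, g19, go, go'⟩ hf
    have hreg : ∀ r, r = 1 ∨ r = 11 → s'.reg r = s.reg r := by
      intro r hr
      refine hf.reg r ?_
      simp [accBody, block, writesReg, Instr.regTarget]; omega
    have g1 : s'.reg 1 = n := (hreg 1 (by simp)).trans h1
    have g11 : s'.reg 11 = 1 := (hreg 11 (by simp)).trans h11
    obtain ⟨m7, m8⟩ := hE (lo + e) (by omega) j hj
    rw [← hf.mem 7 rfl] at m7
    rw [← hf.mem 8 rfl] at m8
    have m4 := hpow (lo + e) (by omega)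
    rw [← hf.mem 4 rfl] at m4
    refine ⟨by omega, HaltsWithin.of_eval rfl (by rfl) ?_⟩
    rw [← add_assoc, code_succ (by omega), code_succ (by omega), ← go, ← go']
    have hr : (lo + e + 1) * n + j = (lo + e) * n + j + n := by ring
    have o1 : o ≠ 18 := by omega
    have o2 : o ≠ 19 := by omega
    have o3 : o ≠ 20 := by omega
    have o4 : o ≠ 28 := by omega
    have o5 : o ≠ 29 := by omega
    have o6 : o ≠ 30 := by omega
    have o7 : o ≠ o' := by omega
    have o8 : o ≠ 1 := by omega
    have o9 : o ≠ 11 := by omega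
    have p1 : o' ≠ 18 := by omega
    have p2 : o' ≠ 19 := by omega
    have p3 : o' ≠ 20 := by omega
    have p4 : o' ≠ 28 := by omega
    have p5 : o' ≠ 29 := by omega
    have p6 : o' ≠ 30 := by omega
    have p8 : o' ≠ 1 := by omega
    have p9 : o' ≠ 11 := by omega
    rw [hr]
    by_cases c1 : L false (lo + e) j = 0 <;> by_cases c2 : L true (lo + e) j = 0 <;>
      simp [accBody, Prog.eval, block, Instr.apply, g1, g11, g18, g19, g20, m7, m8, m4, c1, c2, o1, o2, o3, o4,
        o5, o6, o7, p1, p2, p3, p4, p5, p6, o1.symm, o2.symm, o3.symm, o5.symm, o6.symm, o7.symm, o8.symm,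
        o9.symm, p1.symm, p2.symm, p3.symm, p8.symm, p9.symm] <;> omega
  · rintro s' ⟨h, -⟩; omega

/-- The registers hold the masks and weights of element `t`. -/
structure MaskRegs (L : Bool → ℕ → ℕ → ℕ) (m n : ℕ) (g : ℕ → ℕ) (t : ℕ) (s : State) : Prop where
  b0 : s.reg 21 = maskB L g false t
  b1 : s.reg 22 = maskB L g true t
  f0 : s.reg 23 = maskF L m g false t
  f1 : s.reg 24 = maskF L m g true t
  self : s.reg 25 = maskC g t
  w0 : s.reg 26 = weight n g false t
  w1 : s.reg 27 = weight n g true t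

theorem maskRegs_spec {g : ℕ → ℕ} (hg : IsGapSeq m n g) {t : ℕ} {s : State} (ht : t < m + n)
    (hE : Entries L m n s) (hpow : ∀ i ≤ m + n, s.mem 4 i = 2 ^ i) (h0 : s.reg 0 = m) (h1 : s.reg 1 = n)
    (h10 : s.reg 10 = 0) (h11 : s.reg 11 = 1) (h14 : s.reg 14 = (pos g t).1) (h15 : s.reg 15 = (pos g t).2)
    (h17 : s.reg 17 = g (pos g t).1 - (pos g t).2) :
    HaltsWithin (.branch 17 varProg clauseProg) s (m * 11 + 15) (fun s' => MaskRegs L m n g t s' ∧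
      s'.reg 14 = (pos g (t + 1)).1 ∧ s'.reg 15 = (pos g (t + 1)).2) := by
  have hle := (pos_le hg ht.le).1
  refine HaltsWithin.branch (fun hr => ?_) (fun hr => ?_)
  · have hv : IsVar g t := by unfold IsVar; omega
    have hjn := pos_lt_of_var hg ht hv
    refine HaltsWithin.mono (T := 10 + (((pos g t).1 * 11 + 1) + (1 + (((m - (pos g t).1) * 11 + 1) + 1)))) ?_
      (by omega) fun _ h => h
    refine (HaltsWithin.of_eval (R := fun s1 => s1.reg 18 = (pos g t).2 ∧ s1.reg 19 = 0 ∧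
      s1.reg 20 = (pos g t).1 ∧ (s1.reg 21 = 0 ∧ s1.reg 22 = 0 ∧ s1.reg 23 = 0 ∧ s1.reg 24 = 0) ∧
      s1.reg 25 = 0 ∧ s1.reg 26 = 0 ∧ s1.reg 27 = 2 ^ (pos g t).2) rfl le_rfl ?_).seq ?_
    · simp [Prog.eval, block, Instr.apply, h10, h14, h15, hpow (pos g t).2 (by omega)]
    rintro s1 ⟨e18, e19, e20, ⟨e21, e22, e23, e24⟩, e25, e26, e27⟩ f1
    have m1 : s1.mem = s.mem := funext fun a => f1.mem a rfl
    refine (acc_loop (L := L) (m := m) (n := n) (o := 21) (o' := 22) (lo := 0) (j := (pos g t).2)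
      (by norm_num) (by omega) hjn
      (hE.congr (by rw [m1]) (by rw [m1])) (by rw [m1]; exact hpow) ((f1.reg 1 rfl).trans h1)
      ((f1.reg 11 rfl).trans h11) (by rw [e18]; ring) e19 e20 e21 e22).seq ?_
    rintro s2 ⟨k18, k19, k21, k22⟩ f2
    have m2 : s2.mem = s.mem := (funext fun a => f2.mem a rfl).trans m1
    rw [zero_add] at k18 k19 k21 k22
    refine (HaltsWithin.of_eval (R := fun s3 => s3.reg 20 = m - (pos g t).1) rfl le_rfl ?_).seq ?_
    · simp [Prog.eval, block, Instr.apply, ((f2.reg 0 rfl).trans (f1.reg 0 rfl)).trans h0,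
        ((f2.reg 14 rfl).trans (f1.reg 14 rfl)).trans h14]
    rintro s3 l20 f3
    have m3 : s3.mem = s.mem := (funext fun a => f3.mem a rfl).trans m2
    have r3 : ∀ r, r ≠ 20 → s3.reg r = s2.reg r := fun r hr => f3.reg r (by
      simp [block, writesReg, Instr.regTarget]; omega)
    have r2 : ∀ r, r < 18 ∨ (23 ≤ r ∧ r ≤ 27) → s2.reg r = s1.reg r := fun r hr => f2.reg r (by
      simp [accBody, block, writesReg, Instr.regTarget]; omega)
    refine (acc_loop (L := L) (m := m) (n := n) (o := 23) (o' := 24) (lo := (pos g t).1)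
      (j := (pos g t).2) (by norm_num) (by omega) hjn
      (hE.congr (by rw [m3]) (by rw [m3])) (by rw [m3]; exact hpow)
      ((r3 1 (by norm_num)).trans ((r2 1 (by norm_num)).trans ((f1.reg 1 rfl).trans h1)))
      ((r3 11 (by norm_num)).trans ((r2 11 (by norm_num)).trans ((f1.reg 11 rfl).trans h11)))
      ((r3 18 (by norm_num)).trans k18) ((r3 19 (by norm_num)).trans k19) l20
      ((r3 23 (by norm_num)).trans ((r2 23 (by norm_num)).trans e23))
      ((r3 24 (by norm_num)).trans ((r2 24 (by norm_num)).trans e24))).seq ?_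
    rintro s4 ⟨-, -, p23, p24⟩ f4
    rw [Nat.add_sub_cancel' hle] at p23 p24
    have r4 : ∀ r, r < 18 ∨ r = 21 ∨ r = 22 ∨ (25 ≤ r ∧ r ≤ 27) → s4.reg r = s3.reg r :=
      fun r hr => f4.reg r (by simp [accBody, block, writesReg, Instr.regTarget]; omega)
    have r1 : ∀ r, r < 18 → s4.reg r = s.reg r := fun r hr =>
      (r4 r (by omega)).trans ((r3 r (by omega)).trans ((r2 r (by omega)).trans (f1.reg r (by
        simp [block, writesReg, Instr.regTarget]; omega))))
    have r5 : ∀ r, 25 ≤ r → r ≤ 27 → s4.reg r = s1.reg r := fun r hr hr' =>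
      (r4 r (by omega)).trans ((r3 r (by omega)).trans (r2 r (by omega)))
    have p21 := (r4 21 (by norm_num)).trans ((r3 21 (by norm_num)).trans k21)
    have p22 := (r4 22 (by norm_num)).trans ((r3 22 (by norm_num)).trans k22)
    rw [pos_succ_var hv]
    refine HaltsWithin.of_eval rfl le_rfl ⟨?_, ?_, ?_⟩
    · constructor <;>
        simp [Prog.eval, block, Instr.apply, maskF, maskB, maskC, weight, hv, p21, p22, p23, p24,
          r5 25, r5 26, r5 27, e25, e26, e27]
    · simp [Prog.eval, block, Instr.apply, r1 14, h14]
    · simp [Prog.eval, block, Instr.apply, r1 15, r1 11, h15, h11]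
  · have hv : ¬ IsVar g t := by unfold IsVar; omega
    have hcm := pos_lt_of_clause hg ht hv
    rw [pos_succ_clause hv]
    refine HaltsWithin.of_eval rfl (by change 8 ≤ _; omega) ⟨?_, ?_, ?_⟩
    · constructor <;>
        simp [clauseProg, Prog.eval, block, Instr.apply, maskF, maskB, maskC, weight, hv, h10, h14, h1,
          hpow (pos g t).1 (by omega), hpow n (by omega)]
    · simp [clauseProg, Prog.eval, block, Instr.apply, h14, h11]
    · simp [clauseProg, Prog.eval, block, Instr.apply, h15]

/-- The backward masks are stored in reverse, so that the enumeration program for forward sets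
serves for backward sets without change. -/
theorem maskProg_spec {s : State} (hg : IsGapSeq m n (s.mem 12)) (h0 : s.reg 0 = m) (h1 : s.reg 1 = n)
    (hE : Entries L m n s) (hpow : ∀ i ≤ m + n, s.mem 4 i = 2 ^ i) :
    HaltsWithin maskProg s ((m + n) * (m * 11 + 29) + 8) (Masks L m n (s.mem 12)) := by
  set g := s.mem 12 with hgs
  refine HaltsWithin.mono (T := 7 + ((m + n) * ((m * 11 + 28) + 1) + 1)) ?_
    (by simp only [Nat.add_assoc, Nat.reduceAdd]; omega) fun _ h => h
  refine (HaltsWithin.of_eval (R := fun s1 => s1.reg 10 = 0 ∧ s1.reg 11 = 1 ∧ s1.reg 12 = 0 ∧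
    s1.reg 13 = m + n ∧ s1.reg 14 = 0 ∧ s1.reg 15 = 0 ∧ s1.reg 16 = m + n) rfl le_rfl ?_).seq ?_
  · simp [Prog.eval, block, Instr.apply, h0, h1]
  rintro s1 ⟨e10, e11, e12, e13, e14, e15, e16⟩ f1
  have m1 : s1.mem = s.mem := funext fun a => f1.mem a rfl
  refine HaltsWithin.mono (HaltsWithin.loop (N := m + n) (c := m * 11 + 28) (fun t s' => s'.reg 12 = t ∧
    s'.reg 13 = m + n - t ∧ s'.reg 14 = (pos g t).1 ∧ s'.reg 15 = (pos g t).2 ∧ s'.reg 16 = m + n - t ∧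
    (∀ x < t, s'.mem 13 x = maskF L m g false x ∧ s'.mem 14 x = maskF L m g true x ∧
      s'.mem 15 x = maskC g x ∧ s'.mem 19 (m + n - 1 - x) = maskB L g false x ∧
      s'.mem 20 (m + n - 1 - x) = maskB L g true x ∧ s'.mem 21 (m + n - 1 - x) = maskC g x ∧
      s'.mem 25 x = weight n g false x ∧ s'.mem 26 x = weight n g true x)) ?_ ?_ ?_) le_rfl ?_
  · simp [e12, e13, e14, e15, e16, pos]
  · rintro t s' ht ⟨g12, g13, g14, g15, g16, hx⟩ hf
    have z0 : s'.reg 0 = m := ((hf.reg 0 rfl).trans (f1.reg 0 rfl)).trans h0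
    have z1 : s'.reg 1 = n := ((hf.reg 1 rfl).trans (f1.reg 1 rfl)).trans h1
    have g10 : s'.reg 10 = 0 := (hf.reg 10 rfl).trans e10
    have g11 : s'.reg 11 = 1 := (hf.reg 11 rfl).trans e11
    have hmem : ∀ a, a = 4 ∨ a = 7 ∨ a = 8 ∨ a = 12 → s'.mem a = s.mem a := by
      intro a ha
      rw [← m1]
      refine hf.mem a ?_
      simp [maskStep, varProg, clauseProg, accBody, block, writesSeg, Instr.segTarget]; omega
    refine ⟨by omega, ?_⟩
    refine HaltsWithin.mono (T := 3 + ((m * 11 + 15) + 10)) ?_ (by omega) fun _ h => h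
    refine (HaltsWithin.of_eval (R := fun s2 => s2.reg 13 = m + n - 1 - t ∧
      s2.reg 17 = g (pos g t).1 - (pos g t).2) rfl le_rfl ?_).seq ?_
    · simp [Prog.eval, block, Instr.apply, g11, g13, g14, g15, hmem 12, ← hgs]; omega
    rintro s2 ⟨k13, k17⟩ f2
    have m2 : s2.mem = s'.mem := funext fun a => f2.mem a rfl
    refine (maskRegs_spec hg ht (hE.congr (by rw [m2, hmem 7 (by simp)]) (by rw [m2, hmem 8 (by simp)]))
      (by rw [m2, hmem 4 (by simp)]; exact hpow) ((f2.reg 0 rfl).trans z0) ((f2.reg 1 rfl).trans z1)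
      ((f2.reg 10 rfl).trans g10) ((f2.reg 11 rfl).trans g11) ((f2.reg 14 rfl).trans g14)
      ((f2.reg 15 rfl).trans g15) k17).seq ?_
    rintro s3 ⟨⟨b0, b1, w0, w1, v0, u0, u1⟩, l14, l15⟩ f3
    have m3 : s3.mem = s'.mem := (funext fun a => f3.mem a rfl).trans m2
    have l11 : s3.reg 11 = 1 := ((f3.reg 11 rfl).trans (f2.reg 11 rfl)).trans g11
    have l12 : s3.reg 12 = t := ((f3.reg 12 rfl).trans (f2.reg 12 rfl)).trans g12
    have l13 : s3.reg 13 = m + n - 1 - t := (f3.reg 13 rfl).trans k13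
    have l16 : s3.reg 16 = m + n - t := ((f3.reg 16 rfl).trans (f2.reg 16 rfl)).trans g16
    refine HaltsWithin.of_eval rfl le_rfl ⟨?_, ?_, ?_, ?_, ?_, fun x hxt => ?_⟩
    · simp [Prog.eval, block, Instr.apply, l11, l12]
    · simp [Prog.eval, block, Instr.apply, l13]; omega
    · simp [Prog.eval, block, Instr.apply, l14]
    · simp [Prog.eval, block, Instr.apply, l15]
    · simp [Prog.eval, block, Instr.apply, l11, l16]; omega
    · by_cases h : x = t
      · subst h
        simp [Prog.eval, block, Instr.apply, l12, l13, b0, b1, w0, w1, v0, u0, u1]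
      · have h' : m + n - 1 - x ≠ m + n - 1 - t := by omega
        have := hx x (by omega)
        simpa [Prog.eval, block, Instr.apply, l12, l13, h, h', m3] using this
  · rintro s' ⟨-, -, -, -, h, -⟩; omega
  · rintro s' ⟨⟨-, -, -, -, -, hx⟩, -⟩
    exact ⟨fun t ht => (hx t ht).1, fun t ht => (hx t ht).2.1, fun t ht => (hx t ht).2.2.1,
      fun t ht => (hx t ht).2.2.2.1, fun t ht => (hx t ht).2.2.2.2.1, fun t ht => (hx t ht).2.2.2.2.2.1,
      fun t ht => (hx t ht).2.2.2.2.2.2.1, fun t ht => (hx t ht).2.2.2.2.2.2.2⟩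

end

end KInterval

namespace KInterval

open Prog

/-! ### The programs -/

/-- Read the input and compute the least width. -/
def prepProg : Prog :=
  .seq powProg (.seq (block [.const 10 0, .const 16 1]) (.seq (invProg 3 5 1)
    (.seq (block [.add 16 1 10]) (.seq (invProg 2 6 0) (.seq matrixProg costProg)))))

/-- Compute the least `k`. -/
def widthProg : Prog := .seq prepProg (block [.load 0 11 1])

/-- Fill the table. -/
def coreProg : Prog :=
  .seq prepProg (.seq greedyProg (.seq maskProg (.seq (reachProg 13) (.seq (reachProg 19) tableProg))))

/-- Count the models. -/
def countProg : Prog := .seq coreProg (block [.load 0 27 14])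

namespace CNF

variable {m n : ℕ} (F : CNF m n) (σ : Equiv.Perm (Fin m)) (ρ : Equiv.Perm (Fin n))

theorem initState_mem_two (i : Fin m) : (F.initState σ ρ).mem 2 i = σ i := by
  simp [initState]

theorem initState_mem_three (j : Fin n) : (F.initState σ ρ).mem 3 j = ρ j := by
  simp [initState]

theorem prepProg_spec :
    HaltsWithin prepProg (F.initState σ ρ) (50 * (m * n + m + n + F.stream.length + 1)) (fun s =>
      (Entries (F.lit σ ρ) m n s ∧ Rows (F.occ σ ρ) n m s ∧ ∀ i ≤ m + n, s.mem 4 i = 2 ^ i) ∧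
      Frame prepProg (F.initState σ ρ) s) := by
  refine HaltsWithin.framed ?_
  set s := F.initState σ ρ with hs
  refine HaltsWithin.mono (T := ((m + n + 1) * 5 + 6) + (2 + ((n * 6 + 5) + (1 + ((m * 6 + 5) +
    ((F.stream.length * 11 + 5) + (m * (n * 37 + 39) + 6))))))) ?_ (by
      have : m * (n * 37 + 39) = 37 * (m * n) + 39 * m := by ring
      rw [this]
      generalize m * n = x
      omega) fun _ h => h
  refine HaltsWithin.seq (powProg_spec s) fun s1 hpow f1 => ?_
  refine (HaltsWithin.of_eval (R := fun s2 => s2.reg 10 = 0 ∧ s2.reg 16 = 1) rfl le_rfl ?_).seq ?_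
  · simp [Prog.eval, block, Instr.apply]
  rintro s2 ⟨e10, e16⟩ f2
  have mem2 : ∀ a, a ≠ 4 → s2.mem a = s.mem a := fun a ha => (f2.mem a rfl).trans (f1.mem a (by
    simp [powProg, block, writesSeg, Instr.segTarget]; omega))
  have r20 : s2.reg 0 = m := (f2.reg 0 rfl).trans (f1.reg 0 rfl)
  have r21 : s2.reg 1 = n := (f2.reg 1 rfl).trans (f1.reg 1 rfl)
  refine HaltsWithin.seq (invProg_spec (src := 3) (dst := 5) (cnt := 1) (N := n) (by norm_num) (by norm_num)
    r21 ?_) fun s3 h5 f3 => ?_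
  · intro i hi j hj hij
    rw [mem2 3 (by norm_num)] at hij
    have := F.initState_mem_three σ ρ ⟨i, hi⟩
    have h' := F.initState_mem_three σ ρ ⟨j, hj⟩
    simp only at this h'
    rw [this, h'] at hij
    exact congrArg Fin.val (ρ.injective (Fin.ext hij))
  rw [e16, mem2 3 (by norm_num)] at h5
  refine (HaltsWithin.of_eval (R := fun s4 => s4.reg 16 = n) rfl le_rfl ?_).seq ?_
  · simp [Prog.eval, block, Instr.apply, (f3.reg 1 rfl).trans r21, (f3.reg 10 rfl).trans e10]
  intro s4 e16 f4
  have mem4 : ∀ a, a ≠ 5 → s4.mem a = s2.mem a := fun a ha => (f4.mem a rfl).trans (f3.mem a (by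
    simp [invProg, block, writesSeg, Instr.segTarget]; omega))
  have r40 : s4.reg 0 = m := (f4.reg 0 rfl).trans ((f3.reg 0 rfl).trans r20)
  have r41 : s4.reg 1 = n := (f4.reg 1 rfl).trans ((f3.reg 1 rfl).trans r21)
  have m42 : s4.mem 2 = s.mem 2 := (mem4 2 (by norm_num)).trans (mem2 2 (by norm_num))
  refine HaltsWithin.seq (invProg_spec (src := 2) (dst := 6) (cnt := 0) (N := m) (by norm_num) (by norm_num)
    r40 ?_) fun s5 h6 f5 => ?_
  · intro i hi j hj hij
    rw [m42] at hij
    have := F.initState_mem_two σ ρ ⟨i, hi⟩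
    have h' := F.initState_mem_two σ ρ ⟨j, hj⟩
    simp only at this h'
    rw [this, h'] at hij
    exact congrArg Fin.val (σ.injective (Fin.ext hij))
  rw [e16, m42] at h6
  have mem5 : ∀ a, a ≠ 4 → a ≠ 5 → a ≠ 6 → s5.mem a = s.mem a := fun a h h' h'' =>
    (f5.mem a (by simp [invProg, block, writesSeg, Instr.segTarget]; omega)).trans
      ((mem4 a h').trans (mem2 a h))
  have r50 : s5.reg 0 = m := (f5.reg 0 rfl).trans r40
  have r51 : s5.reg 1 = n := (f5.reg 1 rfl).trans r41
  refine HaltsWithin.seq (F.matrixProg_spec σ ρ r50 (mem5 0 (by norm_num) (by norm_num) (by norm_num))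
    (mem5 1 (by norm_num) (by norm_num) (by norm_num)) (fun j => ?_) (fun i => ?_) (fun x => ?_)
    fun x => ?_) fun s6 hE f6 => ?_
  · have := h5 j j.2
    rw [initState_mem_three, mul_one] at this
    rw [f5.mem 5 rfl, f4.mem 5 rfl]
    exact this
  · have := h6 i i.2
    rw [initState_mem_two] at this
    exact this
  · rw [mem5 7 (by norm_num) (by norm_num) (by norm_num)]; rfl
  · rw [mem5 8 (by norm_num) (by norm_num) (by norm_num)]; rfl
  refine HaltsWithin.mono (HaltsWithin.framed (costProg_spec (A := F.occ σ ρ) (fun _ _ => rfl)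
    ((f6.reg 0 rfl).trans r50) ((f6.reg 1 rfl).trans r51) hE (fun x => ?_) fun x => ?_)) le_rfl ?_
  · rw [f6.mem 9 rfl, mem5 9 (by norm_num) (by norm_num) (by norm_num)]; rfl
  · rw [f6.mem 11 rfl, mem5 11 (by norm_num) (by norm_num) (by norm_num)]; rfl
  rintro s7 ⟨hR, f7⟩
  refine ⟨Entries.congr hE (f7.mem 7 rfl) (f7.mem 8 rfl), hR, ?_⟩
  rw [f7.mem 4 rfl, f6.mem 4 rfl, f5.mem 4 rfl, f4.mem 4 rfl, f3.mem 4 rfl, f2.mem 4 rfl]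
  exact hpow

theorem widthProg_spec :
    HaltsWithin widthProg (F.initState σ ρ) (50 * (m * n + m + n + F.stream.length + 1) + 1) (fun s =>
      s.reg 0 = width (F.occ σ ρ) n m n) := by
  refine (F.prepProg_spec σ ρ).seq ?_
  rintro s ⟨⟨-, hR, -⟩, f⟩ -
  have h1 : s.reg 1 = n := f.reg 1 rfl
  refine HaltsWithin.of_eval rfl le_rfl ?_
  simp [Prog.eval, block, Instr.apply, h1, hR.best n le_rfl]

/-- The running time of `coreProg`, for lists of length at most `K`. -/
def coreTime (m n l K : ℕ) : ℕ :=
  50 * (m * n + m + n + l + 1) + ((m * (n * 5 + 9) + 9) + (((m + n) * (m * 11 + 29) + 8) +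
    (((m + n) * (K * (30 * m + 30) + 10) + 9) + (((m + n) * (K * (30 * m + 30) + 10) + 9) +
      ((m + n) * (K * (K * (120 * m + 99) + 8) + 22) + 9)))))

theorem coreProg_spec :
    HaltsWithin coreProg (F.initState σ ρ)
      (coreTime m n F.stream.length ((m + 1) * 2 ^ width (F.occ σ ρ) n m n)) (fun s =>
      (∃ g, IsGapSeq m n g ∧ s.reg 14 = (m + n) * 2 ^ m ∧ Tab (table (F.lit σ ρ) m n g (m + n)) s ∧
        ∀ i ≤ m + n, s.mem 4 i = 2 ^ i) ∧
      Frame coreProg (F.initState σ ρ) s) := by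
  refine HaltsWithin.framed ?_
  set k := width (F.occ σ ρ) n m n with hk
  set L := F.lit σ ρ with hL
  refine (F.prepProg_spec σ ρ).seq ?_
  rintro s1 ⟨⟨hE, hR, hpow⟩, f1⟩ -
  have r10 : s1.reg 0 = m := f1.reg 0 rfl
  have r11 : s1.reg 1 = n := f1.reg 1 rfl
  refine (greedyProg_spec r10 r11 hR).seq ?_
  rintro s2 ⟨hg, hcost⟩ f2
  have r20 : s2.reg 0 = m := (f2.reg 0 rfl).trans r10
  have r21 : s2.reg 1 = n := (f2.reg 1 rfl).trans r11
  refine (maskProg_spec hg r20 r21 (hE.congr (f2.mem 7 rfl) (f2.mem 8 rfl))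
    (by rw [f2.mem 4 rfl]; exact hpow)).seq ?_
  intro s3 hM f3
  set g := s2.mem 12
  have r30 : s3.reg 0 = m := (f3.reg 0 rfl).trans r20
  have r31 : s3.reg 1 = n := (f3.reg 1 rfl).trans r21
  have p3 : ∀ i ≤ m + n, s3.mem 4 i = 2 ^ i := by rw [f3.mem 4 rfl, f2.mem 4 rfl]; exact hpow
  -- The interval condition enters the running time only through these two bounds.
  have hlF : ∀ u ≤ m + n, (fwdList L m g u).length ≤ (m + 1) * 2 ^ k :=
    fun u hu => length_fwdList_le hg hcost hu
  have hlB : ∀ u ≤ m + n, (bwdList L m n g u).length ≤ (m + 1) * 2 ^ k :=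
    fun u hu => length_bwdList_le hg hcost hu
  have hF := reachProg_spec (base := 13) (K := (m + 1) * 2 ^ k) (s := s3) le_rfl
    (by rw [r30]; exact fun i hi => p3 i (by omega))
    (by rw [r30, r31]; exact fun u hu => by rw [hM.f0 u hu]; exact (elt_lt hg hu).fwd false)
    (by rw [r30, r31]; exact fun u hu => by
          change s3.mem 14 u < _
          rw [hM.f1 u hu]; exact (elt_lt hg hu).fwd true)
    (by change s3.mem 17 0 = 0; rw [f3.mem 17 rfl, f2.mem 17 rfl, f1.mem 17 rfl]; rfl)
    (fun y => by change s3.mem 18 y = 0; rw [f3.mem 18 rfl, f2.mem 18 rfl, f1.mem 18 rfl]; rfl)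
    (by rw [r30, r31]; exact fun u hu => by
          change (reach (s3.mem 13) (s3.mem 14) (s3.mem 15) u).length ≤ _
          rw [hM.reach_fwd hu.le]; exact hlF u hu.le)
  rw [r30, r31] at hF
  refine hF.seq ?_
  intro s4 hF4 f4
  have r40 : s4.reg 0 = m := (f4.reg 0 rfl).trans r30
  have r41 : s4.reg 1 = n := (f4.reg 1 rfl).trans r31
  have p4 : ∀ i ≤ m + n, s4.mem 4 i = 2 ^ i := by rw [f4.mem 4 rfl]; exact p3
  have hM4 : Masks L m n g s4 := by
    constructor
    · rw [f4.mem 13 rfl]; exact hM.f0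
    · rw [f4.mem 14 rfl]; exact hM.f1
    · rw [f4.mem 15 rfl]; exact hM.self
    · rw [f4.mem 19 rfl]; exact hM.b0
    · rw [f4.mem 20 rfl]; exact hM.b1
    · rw [f4.mem 21 rfl]; exact hM.self'
    · rw [f4.mem 25 rfl]; exact hM.w0
    · rw [f4.mem 26 rfl]; exact hM.w1
  have hrev : ∀ u < m + n, m + n - 1 - (m + n - 1 - u) = u := fun u hu => by omega
  have hB := reachProg_spec (base := 19) (K := (m + 1) * 2 ^ k) (s := s4) (by norm_num)
    (by rw [r40]; exact fun i hi => p4 i (by omega))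
    (by rw [r40, r41]; exact fun u hu => by
          rw [← hrev u hu, hM4.b0 _ (by omega)]; exact (elt_lt hg (by omega)).bwd false)
    (by rw [r40, r41]; exact fun u hu => by
          change s4.mem 20 u < _
          rw [← hrev u hu, hM4.b1 _ (by omega)]; exact (elt_lt hg (by omega)).bwd true)
    (by change s4.mem 23 0 = 0; rw [f4.mem 23 rfl, f3.mem 23 rfl, f2.mem 23 rfl, f1.mem 23 rfl]; rfl)
    (fun y => by change s4.mem 24 y = 0; rw [f4.mem 24 rfl, f3.mem 24 rfl, f2.mem 24 rfl, f1.mem 24 rfl]; rfl)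
    (by rw [r40, r41]; exact fun u hu => by
          change (reach (s4.mem 19) (s4.mem 20) (s4.mem 21) u).length ≤ _
          rw [hM4.reach_bwd hu.le]; exact hlB u hu.le)
  rw [r40, r41] at hB
  refine hB.seq ?_
  intro s5 hB5 f5
  have hM5 : Masks L m n g s5 := by
    constructor
    · rw [f5.mem 13 rfl]; exact hM4.f0
    · rw [f5.mem 14 rfl]; exact hM4.f1
    · rw [f5.mem 15 rfl]; exact hM4.self
    · rw [f5.mem 19 rfl]; exact hM4.b0
    · rw [f5.mem 20 rfl]; exact hM4.b1
    · rw [f5.mem 21 rfl]; exact hM4.self'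
    · rw [f5.mem 25 rfl]; exact hM4.w0
    · rw [f5.mem 26 rfl]; exact hM4.w1
  have p5 : ∀ i ≤ m + n, s5.mem 4 i = 2 ^ i := by rw [f5.mem 4 rfl]; exact p4
  refine HaltsWithin.mono (HaltsWithin.framed (tableProg_spec hg (K := (m + 1) * 2 ^ k) (s := s5)
    ((f5.reg 0 rfl).trans r40) ((f5.reg 1 rfl).trans r41) (fun i hi => p5 i (by omega)) hM5 ?_ ?_ hlF hlB
    (fun x => ?_) fun x => ?_)) le_rfl ?_
  · intro u hu
    have := hF4 u hu
    rw [show 13 + 3 = 16 from rfl, show 13 + 4 = 17 from rfl, show 13 + 1 = 14 from rfl,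
      show 13 + 2 = 15 from rfl, hM.reach_fwd hu] at this
    rw [f5.mem 16 rfl, f5.mem 17 rfl]
    exact this
  · intro u hu
    have := hB5 u hu
    rw [show 19 + 3 = 22 from rfl, show 19 + 4 = 23 from rfl, show 19 + 1 = 20 from rfl,
      show 19 + 2 = 21 from rfl, hM4.reach_bwd hu] at this
    exact this
  · rw [f5.mem 27 rfl, f4.mem 27 rfl, f3.mem 27 rfl, f2.mem 27 rfl, f1.mem 27 rfl]; rfl
  · rw [f5.mem 28 rfl, f4.mem 28 rfl, f3.mem 28 rfl, f2.mem 28 rfl, f1.mem 28 rfl]; rfl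
  · rintro s6 ⟨⟨h14, hT⟩, f6⟩
    exact ⟨g, hg, h14, hT, by rw [f6.mem 4 rfl]; exact p5⟩

theorem countProg_spec :
    HaltsWithin countProg (F.initState σ ρ)
      (coreTime m n F.stream.length ((m + 1) * 2 ^ width (F.occ σ ρ) n m n) + 1) (fun s =>
      s.reg 0 = F.numModels) := by
  refine (F.coreProg_spec σ ρ).seq ?_
  rintro s ⟨⟨g, hg, h14, hT, -⟩, -⟩ -
  refine HaltsWithin.of_eval rfl le_rfl ?_
  simp [Prog.eval, block, Instr.apply, h14, hT.count, F.numModels_eq σ ρ hg]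

end CNF

end KInterval

namespace KInterval

open Prog

/-! ### Decoding an optimal assignment -/

/-- Write the bits of `reg 12` as values of the variables. -/
def bitStep : Prog :=
  .seq (block [.sub 16 16 11, .load 18 4 16, .load 19 3 16, .add 17 12 11, .sub 17 17 18])
    (.branch 17 (block [.sub 12 12 18, .store 0 19 11]) (block [.store 0 19 10]))

/-- Decode the best entry of the table. -/
def decodeProg : Prog :=
  .seq (block [.const 10 0, .const 11 1, .load 12 28 14, .sub 12 12 11, .load 13 4 1, .const 15 0, .add 16 1 10,
      .add 17 12 11, .sub 17 17 13])
    (.seq (.loop 17 (block [.sub 12 12 13, .add 15 15 11, .add 17 12 11, .sub 17 17 13]))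
      (.seq (.loop 16 bitStep) (block [.add 0 15 10])))

/-- Solve the maximum satisfiability problem. -/
def maxProg : Prog := .seq coreProg decodeProg

theorem mod_two_pow_succ (x i : ℕ) : x % 2 ^ (i + 1) = x % 2 ^ i + if x.testBit i then 2 ^ i else 0 := by
  rw [Nat.mod_pow_succ, Nat.testBit_eq_decide_div_mod_eq]
  rcases Nat.mod_two_eq_zero_or_one (x / 2 ^ i) with h | h <;> simp [h]

/-- Division is replaced by subtracting `2 ^ n` exactly `q` times, which is cheap as `q` will be a
number of clauses. The comparison `2 ^ n ≤ x` is tested as `x + 1 - 2 ^ n ≠ 0`. -/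
theorem decodeProg_spec {n : ℕ} (ρ : Equiv.Perm (Fin n)) {τ q : ℕ} (hτ : τ < 2 ^ n) {s : State}
    (h1 : s.reg 1 = n) (hv : s.mem 28 (s.reg 14) = 1 + τ + 2 ^ n * q) (hpow : ∀ i ≤ n, s.mem 4 i = 2 ^ i)
    (h3 : ∀ j : Fin n, s.mem 3 j = ρ j) :
    HaltsWithin decodeProg s (q * 5 + n * 9 + 12) (fun s' => s'.reg 0 = q ∧
      ∀ j : Fin n, s'.mem 0 (ρ j) = (τ.testBit j).toNat) := by
  refine HaltsWithin.mono (T := 9 + ((q * (4 + 1) + 1) + ((n * (8 + 1) + 1) + 1))) ?_ (by omega)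
    fun _ h => h
  refine (HaltsWithin.of_eval (R := fun s1 => s1.reg 10 = 0 ∧ s1.reg 11 = 1 ∧ s1.reg 12 = τ + 2 ^ n * q ∧
    s1.reg 13 = 2 ^ n ∧ s1.reg 15 = 0 ∧ s1.reg 16 = n ∧ s1.reg 17 = τ + 2 ^ n * q + 1 - 2 ^ n) rfl
    le_rfl ?_).seq ?_
  · have : 1 + τ + 2 ^ n * q - 1 = τ + 2 ^ n * q := by omega
    simp [Prog.eval, block, Instr.apply, h1, hv, hpow n le_rfl, this]
  rintro s1 ⟨e10, e11, e12, e13, e15, e16, e17⟩ f1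
  refine (HaltsWithin.loop (N := q) (c := 4) (fun d s' => s'.reg 12 = τ + 2 ^ n * (q - d) ∧ s'.reg 15 = d ∧
    s'.reg 17 = τ + 2 ^ n * (q - d) + 1 - 2 ^ n) ?_ ?_ ?_).seq ?_
  · simp [e12, e15, e17]
  · rintro d s' hd ⟨g12, g15, g17⟩ hf
    have g11 : s'.reg 11 = 1 := (hf.reg 11 rfl).trans e11
    have g13 : s'.reg 13 = 2 ^ n := (hf.reg 13 rfl).trans e13
    obtain ⟨c, hc⟩ : ∃ c, q - d = c + 1 := ⟨q - d - 1, by omega⟩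
    have hc' : q - (d + 1) = c := by omega
    rw [hc, mul_add, mul_one] at g12 g17
    rw [hc']
    refine ⟨by omega, HaltsWithin.of_eval rfl le_rfl ⟨?_, ?_, ?_⟩⟩
    · simp [Prog.eval, block, Instr.apply, g12, g13]; omega
    · simp [Prog.eval, block, Instr.apply, g11, g15]
    · simp [Prog.eval, block, Instr.apply, g11, g12, g13]; omega
  · rintro s' ⟨-, -, h⟩
    rw [h, Nat.sub_self, mul_zero]; omega
  rintro s2 ⟨⟨g12, g15, -⟩, f2⟩ -
  rw [Nat.sub_self, mul_zero, add_zero] at g12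
  have g16 : s2.reg 16 = n := (f2.reg 16 rfl).trans e16
  have m2 : s2.mem = s.mem := funext fun a => (f2.mem a rfl).trans (f1.mem a rfl)
  refine (HaltsWithin.loop (N := n) (c := 8) (fun e s' => s'.reg 16 = n - e ∧ s'.reg 12 = τ % 2 ^ (n - e) ∧
    ∀ j : Fin n, n - e ≤ j → s'.mem 0 (ρ j) = (τ.testBit j).toNat) ?_ ?_ ?_).seq ?_
  · refine ⟨by simpa using g16, by simpa [Nat.mod_eq_of_lt hτ] using g12, fun j hj => ?_⟩
    have := j.2
    omega
  · rintro e s' he ⟨k16, k12, km⟩ hf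
    have k10 : s'.reg 10 = 0 := ((hf.reg 10 rfl).trans (f2.reg 10 rfl)).trans e10
    have k11 : s'.reg 11 = 1 := ((hf.reg 11 rfl).trans (f2.reg 11 rfl)).trans e11
    obtain ⟨d, hd⟩ : ∃ d, n - e = d + 1 := ⟨n - e - 1, by omega⟩
    have hd' : n - (e + 1) = d := by omega
    have hdn : d < n := by omega
    have k4 : s'.mem 4 d = 2 ^ d := by rw [hf.mem 4 rfl, m2]; exact hpow d hdn.le
    have k3 : s'.mem 3 d = ρ ⟨d, hdn⟩ := by rw [hf.mem 3 rfl, m2]; exact h3 ⟨d, hdn⟩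
    rw [hd] at k16 k12 km
    rw [hd']
    rw [mod_two_pow_succ] at k12
    have hlt : τ % 2 ^ d < 2 ^ d := Nat.mod_lt _ (by positivity)
    refine ⟨by omega, HaltsWithin.of_eval rfl (by decide) ?_⟩
    have hstep : (bitStep.eval s').reg 16 = d ∧ (bitStep.eval s').reg 12 = τ % 2 ^ d ∧
        (bitStep.eval s').mem 0 = Function.update (s'.mem 0) (ρ ⟨d, hdn⟩) (τ.testBit d).toNat := by
      cases hb : τ.testBit d
      · have : τ % 2 ^ d + 1 - 2 ^ d = 0 := by omega
        simp [hb] at k12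
        simp [bitStep, Prog.eval, block, Instr.apply, k10, k11, k12, k16, k4, k3, this]
      · have : τ % 2 ^ d + 2 ^ d + 1 - 2 ^ d ≠ 0 := by omega
        simp [hb] at k12
        simp [bitStep, Prog.eval, block, Instr.apply, k11, k12, k16, k4, k3, this]
    obtain ⟨hr, hr', hmem⟩ := hstep
    refine ⟨hr, hr', fun j hj => ?_⟩
    rw [hmem]
    by_cases hjd : j = ⟨d, hdn⟩
    · subst hjd; simp
    · have hne : (j : ℕ) ≠ d := fun h => hjd (Fin.ext h)
      rw [Function.update_of_ne fun h => hjd (ρ.injective (Fin.ext h))]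
      exact km j (by omega)
  · rintro s' ⟨h, -⟩; omega
  rintro s3 ⟨⟨-, -, hm⟩, f3⟩ -
  refine HaltsWithin.of_eval rfl le_rfl ⟨?_, fun j => ?_⟩
  · simp [Prog.eval, block, Instr.apply, (f3.reg 15 rfl).trans g15,
      ((f3.reg 10 rfl).trans (f2.reg 10 rfl)).trans e10]
  · exact hm j (by omega)

/-! ### Correctness for MaxSAT and the total running time -/

namespace CNF

variable {m n : ℕ} (F : CNF m n) (σ : Equiv.Perm (Fin m)) (ρ : Equiv.Perm (Fin n))

theorem numSatisfied_le (τ : Fin n → Bool) : F.numSatisfied τ ≤ m :=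
  (Finset.card_filter_le _ _).trans (by simp)

theorem maxProg_spec :
    HaltsWithin maxProg (F.initState σ ρ)
      (coreTime m n F.stream.length ((m + 1) * 2 ^ width (F.occ σ ρ) n m n) + (m * 5 + n * 9 + 12)) (fun s =>
      ∃ τ : Fin n → Bool, (∀ τ' : Fin n → Bool, F.numSatisfied τ' ≤ F.numSatisfied τ) ∧
        s.reg 0 = F.numSatisfied τ ∧ ∀ x : Fin n, s.mem 0 x = (τ x).toNat) := by
  refine (F.coreProg_spec σ ρ).seq ?_
  rintro s ⟨⟨g, hg, h14, hT, hpow⟩, f⟩ -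
  obtain ⟨τ, hτ, hv, hmax⟩ := F.exists_best σ ρ hg
  refine HaltsWithin.mono (decodeProg_spec ρ hτ (q := F.numSatisfied (assign ρ τ)) (s := s) (f.reg 1 rfl) ?_
    (fun i hi => hpow i (by omega)) ?_) ?_ ?_
  · rw [hT.best, h14]; exact hv
  · intro j
    rw [f.mem 3 rfl, initState_mem_three]
  · have := F.numSatisfied_le (assign ρ τ)
    omega
  · rintro s' ⟨h0, h⟩
    refine ⟨assign ρ τ, hmax, h0, fun x => ?_⟩
    have := h (ρ.symm x)
    rwa [Equiv.apply_symm_apply] at this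

/-- A clause without repetition has at most `2 * n` literals. Reading the input is thus within O(m(n
+ 1)) steps, and the bound in (b) needs no separate term for the input size. -/
theorem length_stream_le (F : CNF m n) : F.stream.length ≤ m + 2 * (m * n) := by
  rw [length_stream]
  have h : ∀ C, (F.clause C).length ≤ 2 * n := fun C => by
    have := (F.nodup C).length_le_card
    simpa [mul_comm] using this
  have := Finset.sum_le_sum fun C (_ : C ∈ Finset.univ) => h C
  rw [Finset.sum_const, Finset.card_univ, Fintype.card_fin, smul_eq_mul] at this
  calc m + ∑ C, (F.clause C).length ≤ m + m * (2 * n) := Nat.add_le_add_left this m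
    _ = m + 2 * (m * n) := by ring

/-- The dominant term is `N * K ^ 2 * m` with `N = m + n`, `K ≤ 2 * m * W` and `W = 2 ^ k`, which is
of order `m ^ 3 * W ^ 2 * N`. The other terms are absorbed because `m`, `N` and `W` are at least 1;
for `m = 0` the right side would vanish. The constant 3000 is generous. -/
theorem coreTime_le {l k : ℕ} (hm : 1 ≤ m) (hl : l ≤ m + 2 * (m * n)) :
    coreTime m n l ((m + 1) * 2 ^ k) + (m * 5 + n * 9 + 12) ≤ 3000 * (m ^ 3 * 4 ^ k * (m + n)) := by
  have h4 : (4 : ℕ) ^ k = 2 ^ k * 2 ^ k := by rw [← mul_pow]; norm_num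
  have hW : 1 ≤ 2 ^ k := Nat.one_le_two_pow
  rw [h4]
  generalize 2 ^ k = W at hW
  obtain ⟨N, hN⟩ : ∃ N, m + n = N := ⟨_, rfl⟩
  obtain ⟨K, hK⟩ : ∃ K, (m + 1) * W = K := ⟨_, rfl⟩
  have hKW : K ≤ 2 * (m * W) := by rw [← hK]; nlinarith
  have hmN : m * n ≤ m * N := Nat.mul_le_mul_left _ (by omega)
  have hNm : N ≤ m * N := Nat.le_mul_of_pos_left _ hm
  have hWW : 1 ≤ W * W := Nat.mul_pos hW hW
  have hWle : W ≤ W * W := Nat.le_mul_of_pos_left _ hW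
  have hm2 : m ≤ m * m := Nat.le_mul_of_pos_left _ hm
  have hm3 : m * m ≤ m * m * m := Nat.le_mul_of_pos_right _ hm
  have h1 : m * N ≤ m ^ 3 * (W * W) * N := by
    refine Nat.mul_le_mul_right _ ?_
    calc m = m * 1 := (mul_one m).symm
      _ ≤ m ^ 3 * (W * W) := Nat.mul_le_mul (by rw [pow_succ, pow_two]; omega) hWW
  have h2 : N * (K * m) ≤ 2 * (m ^ 3 * (W * W) * N) := by
    calc N * (K * m) ≤ N * (2 * (m * W) * m) := by gcongr
      _ = 2 * ((m * m) * W * N) := by ring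
      _ ≤ 2 * (m ^ 3 * (W * W) * N) := by
        gcongr
        rw [pow_succ, pow_two]; exact hm3
  have h3 : N * (K * (K * m)) ≤ 4 * (m ^ 3 * (W * W) * N) := by
    calc N * (K * (K * m)) ≤ N * (2 * (m * W) * (2 * (m * W) * m)) := by gcongr
      _ = 4 * (m ^ 3 * (W * W) * N) := by ring
  have h2' : N * K ≤ N * (K * m) := Nat.mul_le_mul_left _ (Nat.le_mul_of_pos_right _ hm)
  have h3' : N * (K * K) ≤ N * (K * (K * m)) :=
    Nat.mul_le_mul_left _ (Nat.mul_le_mul_left _ (Nat.le_mul_of_pos_right _ hm))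
  have hN1 : 1 ≤ N := by omega
  rw [coreTime, hK, hN]
  have e1 : m * (n * 5 + 9) = 5 * (m * n) + 9 * m := by ring
  have e2 : N * (m * 11 + 29) = 11 * (m * N) + 29 * N := by ring
  have e3 : N * (K * (30 * m + 30) + 10) = 30 * (N * (K * m)) + 30 * (N * K) + 10 * N := by ring
  have e4 : N * (K * (K * (120 * m + 99) + 8) + 22) =
      120 * (N * (K * (K * m))) + 99 * (N * (K * K)) + 8 * (N * K) + 22 * N := by ring
  rw [e1, e2, e3, e4]
  omega

end CNF

end KInterval

theorem mainTheorem6 :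
    ∃ (findWidth countModels maxSat : KInterval.Prog) (p : Polynomial ℕ) (A : ℕ),
      ∀ (m n : ℕ) (F : KInterval.CNF m n) (σ : Equiv.Perm (Fin m)) (ρ : Equiv.Perm (Fin n)),
        ∃ k : ℕ,
          IsLeast {q : ℕ | ∃ π : Fin m ⊕ Fin n ≃ Fin (m + n),
            KInterval.IsMerge σ ρ π ∧ F.IsKIntervalOrdering q π} k ∧
          KInterval.HaltsWithin findWidth (F.initState σ ρ) (p.eval F.size)
            (fun s => s.reg 0 = k) ∧
          (1 ≤ m →
            KInterval.HaltsWithin countModels (F.initState σ ρ)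
              (A * (m ^ 3 * 4 ^ k * (m + n)))
              (fun s => s.reg 0 = F.numModels) ∧
            KInterval.HaltsWithin maxSat (F.initState σ ρ)
              (A * (m ^ 3 * 4 ^ k * (m + n)))
              (fun s => ∃ τ : Fin n → Bool,
                (∀ τ' : Fin n → Bool, F.numSatisfied τ' ≤ F.numSatisfied τ) ∧
                s.reg 0 = F.numSatisfied τ ∧
                ∀ x : Fin n, s.mem 0 x = (τ x).toNat)) := by
  -- Both `m + n` and the length of the stream are at most the size, and `m * n` is at most its
  -- square; this gives the polynomial `50 * (X + 1) ^ 2 + 1`.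
  refine ⟨KInterval.widthProg, KInterval.countProg, KInterval.maxProg,
    Polynomial.C 50 * (Polynomial.X + 1) ^ 2 + 1, 3000, fun m n F σ ρ =>
    ⟨KInterval.width (F.occ σ ρ) n m n, F.isLeast_width σ ρ,
      (F.widthProg_spec σ ρ).mono ?_ fun _ h => h, fun hm =>
      ⟨(F.countProg_spec σ ρ).mono ?_ fun _ h => h, (F.maxProg_spec σ ρ).mono ?_ fun _ h => h⟩⟩⟩
  · simp only [Polynomial.eval_add, Polynomial.eval_mul, Polynomial.eval_C, Polynomial.eval_pow,
      Polynomial.eval_X, Polynomial.eval_one]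
    have hl := KInterval.CNF.length_stream F
    have hs : F.size = m + n + ∑ C, (F.clause C).length := rfl
    have h1 : m * n ≤ F.size * F.size := Nat.mul_le_mul (by omega) (by omega)
    have h2 : (F.size + 1) ^ 2 = F.size * F.size + 2 * F.size + 1 := by ring
    rw [h2]
    generalize F.size * F.size = y at h1
    generalize m * n = x at h1
    omega
  · have := KInterval.CNF.coreTime_le (k := KInterval.width (F.occ σ ρ) n m n) hm F.length_stream_le
    omega
  · exact KInterval.CNF.coreTime_le hm F.length_stream_le
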